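/- Let $R$ be a (finite, reduced, crystallographic) irreducible root system in a real vector space, $P$ its weight lattice, $W_0$ its Weyl group, and $W = W_0 \ltimes P$ the extended affine Weyl group. Fix a base of $R$. Let $S$ be the set of simple reflections of $W_a = W_0 \ltimes \mathbb{Z}R$, $S_0 = S \cap W_0$, $s_0$ the unique element of $S \setminus S_0$, and $l$ and $\le$ the length function and the Bruhat order on $W$. For $w \in W$ put $R(w) = \{s \in S \mid ws \le w\}$, and let $Y_0 = \{w \in W \mid R(w) \subseteq \{s_0\}\}$ and $\Gamma_0 = \{w \in W \mid R(w) = S_0\}$. Let $w_0$ be the longest element of $W_0$. Let $k$ be a field, $q \in k$ nonzero, and $q^{1/2} \in k$ a square root of $q$. Let $H$ be the Hecke algebra of $(W,S)$ over $k$ with parameter $q$, with standard basis $T_w$ ($w \in W$), so that $T_1 = 1$, $T_xT_y = T_{xy}$ if $l(xy) = l(x) + l(y)$, and $(T_s - q)(T_s+1) = 0$ for $s \in S$. With the Kazhdan–Lusztig polynomials $P_{y,w}$ put $$C_w = q^{-\frac{l(w)}{2}} \sum_{y \le w} P_{y,w}(q)\, T_y, \qquad C'_w = q^{\frac{l(w)}{2}}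 \sum_{y \le w} (-1)^{l(w)-l(y)} q^{-l(y)} P_{y,w}(q^{-1})\, T_y,$$ and $C = C_{w_0}$, $C' = C'_{w_0}$. Let $\mathcal{I}$, $\mathcal{I}'$ be the $k$-subspaces of $H$ spanned by all $C_w$, respectively all $C'_w$, with $w \in W \setminus Y_0$, and let $M$, $M'$ be the $k$-subspaces spanned by all $C_w$, respectively all $C'_w$, with $w \in \Gamma_0$. **Lemma 2.2.** The subspaces $\mathcal{I}, \mathcal{I}', M, M'$ are left ideals of $H$, and $M = HC$, $M' = HC'$. The map $h \mapsto hC'$ induces an isomorphism of left $H$-modules from $N = H/\mathcal{I}$ onto $M'$, and the map $h \mapsto hC$ induces an isomorphism of left $H$-modules from $N' = H/\mathcal{I}'$ onto $M$. -/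

import Mathlib

open scoped Polynomial

noncomputable section

namespace AffineHecke

universe u₁ u₂ u₃ u₄

section Group

variable {ι : Type u₁} {V : Type u₂} {V' : Type u₃} [AddCommGroup V] [Module ℝ V]
  [AddCommGroup V'] [Module ℝ V'] (R : RootPairing ι ℝ V V')

/-- The weight lattice: the vectors having integral pairing with every coroot. -/
def weightLattice : AddSubgroup V where
  carrier := {x | ∀ i, ∃ n : ℤ, R.coroot' i x = n}
  zero_mem' := fun i => ⟨0, by simp⟩
  add_mem' := by
    intro x y hx hy i
    obtain ⟨m, hm⟩ := hx i
    obtain ⟨n, hn⟩ := hy i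
    exact ⟨m + n, by rw [map_add, hm, hn]; push_cast; rfl⟩
  neg_mem' := by
    intro x hx i
    obtain ⟨m, hm⟩ := hx i
    exact ⟨-m, by rw [map_neg, hm]; push_cast; rfl⟩

theorem root_mem_weightLattice [R.IsCrystallographic] (i : ι) :
    R.root i ∈ weightLattice R := by
  intro j
  exact ⟨R.pairingIn ℤ i j, by
    simpa using (R.algebraMap_pairingIn ℤ i j).symm⟩

theorem smul_mem_weightLattice (w : R.weylGroup) {x : V} (hx : x ∈ weightLattice R) :
    w • x ∈ weightLattice R := by
  obtain ⟨g, hg⟩ := w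
  change g • x ∈ weightLattice R
  revert x
  induction hg using RootPairing.weylGroup.induction with
  | mem j =>
    intro x hx i
    obtain ⟨m, hm⟩ := hx (R.reflectionPerm j i)
    refine ⟨m, ?_⟩
    rw [← hm]
    change R.coroot' i (R.reflection j x) = R.coroot' (R.reflectionPerm j i) x
    simp [RootPairing.reflection_apply, RootPairing.coroot_reflectionPerm,
      RootPairing.coreflection_apply, RootPairing.coroot', RootPairing.root', mul_comm]
  | one => intro x hx; simpa using hx
  | mul g₁ g₂ _ _ h₁ h₂ => intro x hx; rw [mul_smul]; exact h₁ (h₂ hx)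

/-- The action of the finite Weyl group on the weight lattice, the latter written
multiplicatively. -/
def weylAct : R.weylGroup →* MulAut (Multiplicative (weightLattice R)) where
  toFun w :=
    { toFun := fun x => .ofAdd ⟨w • (x.toAdd : V), smul_mem_weightLattice R w x.toAdd.2⟩
      invFun := fun x => .ofAdd ⟨w⁻¹ • (x.toAdd : V), smul_mem_weightLattice R w⁻¹ x.toAdd.2⟩
      left_inv := fun x => by
        apply Multiplicative.toAdd.injective; apply Subtype.ext; simp
      right_inv := fun x => by
        apply Multiplicative.toAdd.injective; apply Subtype.ext; simp
      map_mul' := fun x y => by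
        apply Multiplicative.toAdd.injective; apply Subtype.ext; simp }
  map_one' := by
    refine MulEquiv.ext fun x => Multiplicative.toAdd.injective (Subtype.ext ?_)
    exact one_smul R.weylGroup (x.toAdd : V)
  map_mul' w w' := by
    refine MulEquiv.ext fun x => Multiplicative.toAdd.injective (Subtype.ext ?_)
    exact mul_smul w w' (x.toAdd : V)

/-- The extended affine Weyl group: the semidirect product of the weight lattice by the finite
Weyl group. -/
abbrev ExtAffineWeyl : Type (max u₁ u₂ u₃) :=
  SemidirectProduct (Multiplicative (weightLattice R)) R.weylGroup (weylAct R)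

/-- The finite Weyl group as a subgroup of the extended affine Weyl group. -/
def finiteWeyl : Subgroup (ExtAffineWeyl R) := SemidirectProduct.inr.range

variable {R}

/-- The action of the extended affine Weyl group on `V` by affine transformations: the finite
Weyl group acts linearly, the weight lattice by translations. -/
def affAct (g : ExtAffineWeyl R) (x : V) : V := g.right • x + (g.left.toAdd : V)

/-- The affine reflection `x ↦ x - (⟨x, αᵢ^∨⟩ - n) αᵢ`, in the hyperplane `⟨x, αᵢ^∨⟩ = n`.
These are the reflections of the affine Weyl group (finite Weyl group) ⋉ (root lattice). -/
def affRefl [R.IsCrystallographic] (i : ι) (n : ℤ) : ExtAffineWeyl R :=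
  ⟨.ofAdd (n • ⟨R.root i, root_mem_weightLattice R i⟩), RootPairing.weylGroup.ofIdx R i⟩

variable (b : R.Base)

/-- The fundamental alcove. -/
def alcove : Set V := {x | ∀ i, b.IsPos i → 0 < R.coroot' i x ∧ R.coroot' i x < 1}

/-- The hyperplane `⟨x, αᵢ^∨⟩ = n` separates `A` from `B`. -/
def Separates (i : ι) (n : ℤ) (A B : Set V) : Prop :=
  ((∀ x ∈ A, R.coroot' i x < n) ∧ ∀ y ∈ B, n < R.coroot' i y) ∨
  ((∀ x ∈ A, n < R.coroot' i x) ∧ ∀ y ∈ B, R.coroot' i y < n)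

/-- The length of `g`: the number of hyperplanes `⟨x, α^∨⟩ = n` (`α` a positive root, `n` an
integer) separating the fundamental alcove from its image under `g`. -/
def length (g : ExtAffineWeyl R) : ℕ :=
  {h : ι × ℤ | b.IsPos h.1 ∧
    Separates (R := R) h.1 h.2 (alcove b) (affAct g '' alcove b)}.ncard

/-- The coroot of index `i` is the highest coroot. -/
def IsHighestCoroot (i : ι) : Prop :=
  ∀ j, R.coroot i - R.coroot j ∈ AddSubmonoid.closure (R.coroot '' b.support)

variable [R.IsCrystallographic]

/-- The set `{s₀}`, where `s₀` is the reflection in the wall of the fundamental alcove that does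
not pass through the origin. -/
def affineSimple : Set (ExtAffineWeyl R) := {s | ∃ i, IsHighestCoroot b i ∧ s = affRefl i 1}

/-- The simple reflections of the affine Weyl group. -/
def simples : Set (ExtAffineWeyl R) := {s | ∃ i ∈ b.support, s = affRefl i 0} ∪ affineSimple b

/-- The simple reflections of the finite Weyl group. -/
def finiteSimples : Set (ExtAffineWeyl R) := simples b ∩ finiteWeyl R

/-- The Bruhat order: `y ≤ w` if `w` is obtained from `y` by successive multiplications by
reflections, each of which increases the length. -/
def BruhatLE (y w : ExtAffineWeyl R) : Prop :=
  Relation.ReflTransGen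
    (fun x z => length b x < length b z ∧ ∃ (i : ι) (n : ℤ), z = x * affRefl i n) y w

/-- The right descent set `R(w)`. -/
def rightDescents (w : ExtAffineWeyl R) : Set (ExtAffineWeyl R) :=
  {s ∈ simples b | BruhatLE b (w * s) w}

/-- The set `Y₀` of all `w` with `R(w) ⊆ {s₀}`. -/
def Y₀ : Set (ExtAffineWeyl R) := {w | rightDescents b w ⊆ affineSimple b}

/-- The set `Γ₀` of all `w` such that `R(w)` is the set of finite simple reflections. -/
def Γ₀ : Set (ExtAffineWeyl R) := {w | rightDescents b w = finiteSimples b}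

end Group

section Hecke

variable {ι : Type u₁} {V : Type u₂} {V' : Type u₃} [AddCommGroup V] [Module ℝ V]
  [AddCommGroup V'] [Module ℝ V'] {R : RootPairing ι ℝ V V'} [R.IsCrystallographic]
  (b : R.Base) {A : Type u₄} [CommRing A]

/-- The defining relations of the Hecke algebra with parameter `q`. -/
inductive HeckeRel (q : A) :
    FreeAlgebra A (ExtAffineWeyl R) → FreeAlgebra A (ExtAffineWeyl R) → Prop
  | one : HeckeRel q (FreeAlgebra.ι A 1) 1
  | mul (x y : ExtAffineWeyl R) (h : length b (x * y) = length b x + length b y) :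
      HeckeRel q (FreeAlgebra.ι A x * FreeAlgebra.ι A y) (FreeAlgebra.ι A (x * y))
  | quad (s : ExtAffineWeyl R) (hs : s ∈ simples b) :
      HeckeRel q ((FreeAlgebra.ι A s - algebraMap A _ q) * (FreeAlgebra.ι A s + 1)) 0

/-- The Hecke algebra of the extended affine Weyl group over `A` with parameter `q`, presented by
generators `T_w` and the relations `T_1 = 1`, `T_x T_y = T_{xy}` if lengths add, and
`(T_s - q)(T_s + 1) = 0` for simple reflections `s`. -/
abbrev Hecke (q : A) : Type (max u₁ u₂ u₃ u₄) := RingQuot (HeckeRel b q)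

/-- The standard basis element `T_w`. -/
def T (q : A) (w : ExtAffineWeyl R) : Hecke b q :=
  RingQuot.mkAlgHom A (HeckeRel b q) (FreeAlgebra.ι A w)

/-- The square of the generator `v = q^{1/2}` of `ℤ[v, v⁻¹]`: the generic parameter. -/
abbrev genericParam : LaurentPolynomial ℤ := LaurentPolynomial.T 2

/-- The family `p` is `(P_{y,w})_y`, the Kazhdan–Lusztig polynomials for `w`: it vanishes off
`{y | y ≤ w}`, `P_{w,w} = 1`, `deg P_{y,w} ≤ (l(w) - l(y) - 1)/2` for `y < w`, and in the generic
Hecke algebra `v^{-l(w)} ∑_y P_{y,w}(v²) T_y` equals its image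
`v^{l(w)} ∑_y P_{y,w}(v⁻²) (T_{y⁻¹})⁻¹` under the bar involution. -/
structure IsKL (w : ExtAffineWeyl R) (p : ExtAffineWeyl R →₀ ℤ[X]) : Prop where
  le_of_ne_zero : ∀ y, p y ≠ 0 → BruhatLE b y w
  self : p w = 1
  degree : ∀ y, BruhatLE b y w → y ≠ w → 2 * (p y).natDegree + 1 + length b y ≤ length b w
  bar :
    (LaurentPolynomial.T (-(length b w : ℤ)) : LaurentPolynomial ℤ) •
        p.sum (fun y f => Polynomial.aeval (LaurentPolynomial.T 2 : LaurentPolynomial ℤ) f •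
          T b genericParam y) =
      (LaurentPolynomial.T (length b w : ℤ) : LaurentPolynomial ℤ) •
        p.sum (fun y f => Polynomial.aeval (LaurentPolynomial.T (-2) : LaurentPolynomial ℤ) f •
          Ring.inverse (T b genericParam y⁻¹))

open Classical in
/-- The family `(P_{y,w})_y` of Kazhdan–Lusztig polynomials for `w`; there is exactly one family
as in `IsKL`. -/
def klPoly (w : ExtAffineWeyl R) : ExtAffineWeyl R →₀ ℤ[X] :=
  if h : ∃ p, IsKL b w p then h.choose else 0

variable {k : Type u₄} [Field k]

/-- `C_w = q^{-l(w)/2} ∑_{y ≤ w} P_{y,w}(q) T_y`, where `v` is the chosen square root of `q`. -/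
def C (q v : k) (w : ExtAffineWeyl R) : Hecke b q :=
  v⁻¹ ^ length b w • (klPoly b w).sum fun y f => Polynomial.aeval q f • T b q y

/-- `C'_w = q^{l(w)/2} ∑_{y ≤ w} (-1)^{l(w)-l(y)} q^{-l(y)} P_{y,w}(q⁻¹) T_y`, where `v` is the
chosen square root of `q`. -/
def C' (q v : k) (w : ExtAffineWeyl R) : Hecke b q :=
  v ^ length b w • (klPoly b w).sum fun y f =>
    ((-1) ^ (length b w - length b y) * q⁻¹ ^ length b y * Polynomial.aeval q⁻¹ f) • T b q y

end Hecke

end AffineHecke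

end

/-
The affine reflections whose mirrors separate an alcove from its image satisfy an exchange property.
It yields the standard basis of `H` and the existence of the Kazhdan–Lusztig polynomials, together
with their symmetry `P_{ys,w} = P_{y,w}` for `ws < w`, which says that `C_w (T_s - q) = 0` and
`C'_w (T_s + 1) = 0`. By triangularity, the `C_w` with `ws < w` form a basis of the left ideal of
all `h` with `h (T_s - q) = 0`, so `𝓘` is the sum, and `M` the intersection, of these left ideals
over `s ∈ S₀`; likewise for `C'_w`. An element of `M'` is determined by its coefficients at the
`T_d` with `d` of minimal length in `d W₀`, whence `M' = H C'`. Since `h (T_s - q) = 0` makes `h` a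
right multiple of `T_s + 1`, which annihilates `C'`, the kernel of `h ↦ h C'` contains `𝓘`. It is
no larger, because the `T_d` span `H` modulo `𝓘` and the `T_d C'` are linearly independent.
-/

noncomputable section

namespace AffineHecke

section Length

open scoped Pointwise symmDiff

variable {W : Type*} [Group W]

/-- Inversion sets `N g` of the elements of a group generated by simple reflections `S` and a
group of elements of length zero. Geometrically `N g` is the set of those reflections in `T` whose
mirror separates the fundamental chamber from its image under `g`; then `N` is a cocycle for the
conjugation action on sets of reflections. -/
structure IsInversionSystem (S T : Set W) (N : W → Set W) : Prop where
  finite : ∀ g, (N g).Finite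
  mul : ∀ g h, N (g * h) = N g ∆ (MulAut.conj g • N h)
  simple_subset : S ⊆ T
  sq : ∀ t ∈ T, t * t = 1
  conj : ∀ t ∈ T, ∀ g : W, g * t * g⁻¹ ∈ T
  self_mem : ∀ t ∈ T, t ∈ N t
  simple : ∀ s ∈ S, N s = {s}
  exists_simple : ∀ g, (N g).Nonempty → ∃ s ∈ S, s ∈ N g

/-- The properties of the length function of an extended Coxeter group with simple reflections `S`
and reflections `T` from which its Hecke algebra and its Kazhdan–Lusztig polynomials are
constructed. The field `lt_mul_mul_iff` says that `x ↦ {t ∈ T | l (t * x) < l x}` is a cocycle. -/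
structure IsLengthFn (S T : Set W) (l : W → ℕ) : Prop where
  one : l 1 = 0
  inv : ∀ g, l g⁻¹ = l g
  mul_le : ∀ g h, l (g * h) ≤ l g + l h
  simple_subset : S ⊆ T
  sq : ∀ t ∈ T, t * t = 1
  conj : ∀ t ∈ T, ∀ g : W, g * t * g⁻¹ ∈ T
  length_simple : ∀ s ∈ S, l s = 1
  eq_of_simple_mul_lt : ∀ s ∈ S, ∀ t ∈ T, l (s * t) < l s → t = s
  lt_mul_mul_iff : ∀ t ∈ T, ∀ x y, l (x * y) < l (x * t * y) ↔ (l x < l (x * t) ↔ l y < l (t * y))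
  exists_simple_mul_lt : ∀ g, l g ≠ 0 → ∃ s ∈ S, l (s * g) < l g

namespace IsInversionSystem

variable {S T : Set W} {N : W → Set W} (h : IsInversionSystem S T N)
include h

theorem mem_mul (g k t : W) : t ∈ N (g * k) ↔ ¬ (t ∈ N g ↔ g⁻¹ * t * g ∈ N k) := by
  rw [h.mul, Set.mem_symmDiff, Set.mem_smul_set_iff_inv_smul_mem, MulAut.smul_def,
    MulAut.conj_inv_apply]
  tauto

theorem one : N 1 = ∅ := by
  simpa using h.mul 1 1

theorem inv (g : W) : N g⁻¹ = MulAut.conj g⁻¹ • N g := by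
  rw [← symmDiff_eq_bot, ← h.mul, inv_mul_cancel, h.one, Set.bot_eq_empty]

theorem mem_inv (g t : W) : t ∈ N g⁻¹ ↔ g * t * g⁻¹ ∈ N g := by
  rw [h.inv, Set.mem_smul_set_iff_inv_smul_mem, map_inv, inv_inv, MulAut.smul_def,
    MulAut.conj_apply]

theorem ncard_inv (g : W) : (N g⁻¹).ncard = (N g).ncard := by
  rw [h.inv, Set.ncard_smul_set]

theorem ncard_mul_le (g k : W) : (N (g * k)).ncard ≤ (N g).ncard + (N k).ncard := by
  have hsub : N (g * k) ⊆ N g ∪ MulAut.conj g • N k := h.mul g k ▸ symmDiff_le_sup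
  calc (N (g * k)).ncard ≤ (N g ∪ MulAut.conj g • N k).ncard :=
        Set.ncard_le_ncard hsub ((h.finite g).union (h.finite k).smul_set)
    _ ≤ (N g).ncard + (MulAut.conj g • N k).ncard := Set.ncard_union_le _ _
    _ = (N g).ncard + (N k).ncard := by rw [Set.ncard_smul_set]

theorem simple_mul_self {s : W} (hs : s ∈ S) : s * s = 1 := h.sq s (h.simple_subset hs)

theorem simple_inv {s : W} (hs : s ∈ S) : s⁻¹ = s :=
  inv_eq_of_mul_eq_one_left (h.simple_mul_self hs)

theorem mem_mul_self {t : W} (ht : t ∈ T) (g : W) : t ∈ N (t * g) ↔ t ∉ N g := by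
  rw [h.mem_mul, inv_mul_cancel, one_mul]
  have := h.self_mem t ht
  tauto

theorem ncard_simple_mul_add_one {s g : W} (hs : s ∈ S) (hsg : s ∈ N g) :
    (N (s * g)).ncard + 1 = (N g).ncard := by
  have hmem : s ∈ MulAut.conj s • N g := by
    simpa [Set.mem_smul_set_iff_inv_smul_mem, MulAut.smul_def] using hsg
  have hdiff : N (s * g) = (MulAut.conj s • N g) \ {s} := by
    rw [h.mul, h.simple s hs, symmDiff_of_le (Set.singleton_subset_iff.2 hmem)]
  rw [hdiff, Set.ncard_sdiff_singleton_add_one hmem (h.finite g).smul_set, Set.ncard_smul_set]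

theorem ncard_mul_lt_of_mem {g t : W} (ht : t ∈ T) (htg : t ∈ N g) :
    (N (t * g)).ncard < (N g).ncard := by
  induction hn : (N g).ncard using Nat.strong_induction_on generalizing g t with
  | _ n ih =>
    obtain ⟨s, hs, hsg⟩ := h.exists_simple g ⟨t, htg⟩
    have hlt := h.ncard_simple_mul_add_one hs hsg
    obtain rfl | hts := eq_or_ne t s
    · lia
    have hss := h.simple_mul_self hs
    have hmem : s * t * s ∈ N (s * g) := by
      have hne : s * t * s ≠ s := fun heq => hts <|
        eq_inv_of_mul_eq_one_right (mul_eq_right.1 heq) |>.trans (h.simple_inv hs)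
      have hconj : s⁻¹ * (s * t * s) * s = t := by simp only [mul_assoc, inv_mul_cancel_left, hss,
        mul_one]
      rw [h.mem_mul, h.simple s hs, Set.mem_singleton_iff, hconj]
      tauto
    have hconj : s * t * s ∈ T := by simpa only [h.simple_inv hs] using h.conj t ht s
    have hswap : s * t * s * (s * g) = s * (t * g) := by
      simp only [mul_assoc, mul_left_cancel_iff]
      rw [← mul_assoc s s g, hss, one_mul]
    have hrec := ih _ (by lia) hconj hmem rfl
    have hstep := h.ncard_mul_le s (s * (t * g))
    rw [← mul_assoc, hss, one_mul, h.simple s hs, Set.ncard_singleton] at hstep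
    rw [hswap] at hrec
    lia

theorem mem_iff_ncard_mul_lt {t : W} (ht : t ∈ T) (g : W) :
    t ∈ N g ↔ (N (t * g)).ncard < (N g).ncard := by
  refine ⟨h.ncard_mul_lt_of_mem ht, fun hlt => ?_⟩
  by_contra htg
  have hgt := h.ncard_mul_lt_of_mem ht ((h.mem_mul_self ht g).2 htg)
  rw [← mul_assoc, h.sq t ht, one_mul] at hgt
  exact lt_asymm hlt hgt

theorem notMem_iff_ncard_lt_mul {t : W} (ht : t ∈ T) (g : W) :
    t ∉ N g ↔ (N g).ncard < (N (t * g)).ncard := by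
  rw [← h.mem_mul_self ht, h.mem_iff_ncard_mul_lt ht, ← mul_assoc, h.sq t ht, one_mul]

theorem notMem_inv_iff_ncard_lt_mul {t : W} (ht : t ∈ T) (g : W) :
    t ∉ N g⁻¹ ↔ (N g).ncard < (N (g * t)).ncard := by
  rw [h.notMem_iff_ncard_lt_mul ht, h.ncard_inv, ← h.ncard_inv (g * t), mul_inv_rev,
    inv_eq_of_mul_eq_one_left (h.sq t ht)]

theorem ncard_lt_mul_mul_iff {t : W} (ht : t ∈ T) (x y : W) :
    (N (x * y)).ncard < (N (x * t * y)).ncard ↔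
      ((N x).ncard < (N (x * t)).ncard ↔ (N y).ncard < (N (t * y)).ncard) := by
  have hxty : x * t * y = x * t * x⁻¹ * (x * y) := by group
  have hconj : x⁻¹ * (x * t * x⁻¹) * x = t := by group
  rw [hxty, ← h.notMem_iff_ncard_lt_mul (h.conj t ht x), ← h.notMem_iff_ncard_lt_mul ht,
    ← h.notMem_inv_iff_ncard_lt_mul ht, h.mem_mul, h.mem_inv, hconj]
  tauto

theorem isLengthFn : IsLengthFn S T fun g => (N g).ncard where
  one := by rw [h.one, Set.ncard_empty]
  inv := h.ncard_inv
  mul_le := h.ncard_mul_le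
  simple_subset := h.simple_subset
  sq := h.sq
  conj := h.conj
  length_simple s hs := by rw [h.simple s hs, Set.ncard_singleton]
  eq_of_simple_mul_lt s hs t ht hlt := by
    have hmem : t ∈ N s⁻¹ := by
      by_contra hnot
      exact lt_asymm hlt ((h.notMem_inv_iff_ncard_lt_mul ht s).1 hnot)
    rwa [h.simple_inv hs, h.simple s hs] at hmem
  lt_mul_mul_iff _ ht := h.ncard_lt_mul_mul_iff ht
  exists_simple_mul_lt g hg := by
    obtain ⟨s, hs, hsg⟩ := h.exists_simple g (Set.nonempty_of_ncard_ne_zero hg)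
    exact ⟨s, hs, h.ncard_mul_lt_of_mem (h.simple_subset hs) hsg⟩

end IsInversionSystem

namespace IsLengthFn

variable {S T : Set W} {l : W → ℕ} (h : IsLengthFn S T l)
include h

theorem simple_mul_self {s : W} (hs : s ∈ S) : s * s = 1 := h.sq s (h.simple_subset hs)

theorem refl_inv {t : W} (ht : t ∈ T) : t⁻¹ = t := inv_eq_of_mul_eq_one_left (h.sq t ht)

theorem simple_inv {s : W} (hs : s ∈ S) : s⁻¹ = s := h.refl_inv (h.simple_subset hs)

theorem simple_mul_cancel {s : W} (hs : s ∈ S) (g : W) : s * (s * g) = g := by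
  rw [← mul_assoc, h.simple_mul_self hs, one_mul]

theorem mul_simple_cancel {s : W} (hs : s ∈ S) (g : W) : g * s * s = g := by
  rw [mul_assoc, h.simple_mul_self hs, mul_one]

theorem length_mul_refl {t : W} (ht : t ∈ T) (g : W) : l (g * t) = l (t * g⁻¹) := by
  rw [← h.inv, mul_inv_rev, h.refl_inv ht]

theorem length_mul_simple {s : W} (hs : s ∈ S) (g : W) : l (g * s) = l (s * g⁻¹) :=
  h.length_mul_refl (h.simple_subset hs) g

theorem mul_refl_lt_iff {t : W} (ht : t ∈ T) (g : W) : l (g * t) < l g ↔ ¬ l g < l (g * t) := by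
  have hcocycle := h.lt_mul_mul_iff t ht g t
  rwa [mul_assoc, h.sq t ht, mul_one, h.one, iff_false_right (Nat.not_lt_zero _)] at hcocycle

theorem mul_simple {s : W} (hs : s ∈ S) (g : W) : l (g * s) = l g + 1 ∨ l (g * s) + 1 = l g := by
  have hup := h.mul_le g s
  have hdown := h.mul_le (g * s) s
  have hne := h.mul_refl_lt_iff (h.simple_subset hs) g
  rw [h.mul_simple_cancel hs] at hdown
  rw [h.length_simple s hs] at hup hdown
  lia

theorem simple_mul {s : W} (hs : s ∈ S) (g : W) : l (s * g) = l g + 1 ∨ l (s * g) + 1 = l g := by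
  have := h.mul_simple hs g⁻¹
  rwa [h.length_mul_simple hs, inv_inv, h.inv] at this

theorem mul_simple_of_lt {s : W} (hs : s ∈ S) {g : W} (hg : l g < l (g * s)) :
    l (g * s) = l g + 1 := by
  have := h.mul_simple hs g
  lia

theorem mul_simple_of_gt {s : W} (hs : s ∈ S) {g : W} (hg : l (g * s) < l g) :
    l (g * s) + 1 = l g := by
  have := h.mul_simple hs g
  lia

theorem mul_simple_lt_or_gt {s : W} (hs : s ∈ S) (g : W) : l g < l (g * s) ∨ l (g * s) < l g := by
  have := h.mul_simple hs g
  lia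

theorem exists_mul_simple_lt (g : W) (hg : l g ≠ 0) : ∃ s ∈ S, l (g * s) < l g := by
  obtain ⟨s, hs, hlt⟩ := h.exists_simple_mul_lt g⁻¹ (by rwa [h.inv])
  exact ⟨s, hs, by rwa [h.length_mul_simple hs, ← h.inv g]⟩

theorem length_zero_mul {x : W} (hx : l x = 0) (g : W) : l (x * g) = l g := by
  have hle := h.mul_le x g
  have hge := h.mul_le x⁻¹ (x * g)
  rw [inv_mul_cancel_left, h.inv] at hge
  lia

theorem length_mul_zero {x : W} (hx : l x = 0) (g : W) : l (g * x) = l g := by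
  rw [← h.inv, mul_inv_rev, h.length_zero_mul (by rw [h.inv, hx]), h.inv]

theorem lt_refl_mul_simple {s : W} (hs : s ∈ S) {t : W} (ht : t ∈ T) (hts : t ≠ s) :
    l s < l (t * s) := by
  have hle : ¬ l (s * t) < l s := fun hlt => hts (h.eq_of_simple_mul_lt s hs t ht hlt)
  rw [h.mul_refl_lt_iff ht, not_not, h.length_mul_refl ht, h.simple_inv hs] at hle
  exact hle

theorem mul_simple_lt_mul_mul_simple {s : W} (hs : s ∈ S) {t : W} (ht : t ∈ T) (hts : t ≠ s)
    {x : W} (hx : l x < l (x * t)) : l (x * s) < l (x * t * s) :=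
  (h.lt_mul_mul_iff t ht x s).2 (iff_of_true hx (h.lt_refl_mul_simple hs ht hts))

theorem simple_mul_lt_iff_of_ne {s t : W} (hs : s ∈ S) (ht : t ∈ S) {x : W}
    (hne : s * x ≠ x * t) : l (s * x) < l (s * (x * t)) ↔ l x < l (x * t) := by
  have hconj := h.conj t (h.simple_subset ht) x
  have hcocycle := h.lt_mul_mul_iff _ hconj s x
  rw [mul_assoc s, inv_mul_cancel_right] at hcocycle
  have hup : l s < l (s * (x * t * x⁻¹)) := by
    by_contra hnot
    have heq := h.eq_of_simple_mul_lt s hs _ hconj ((h.mul_refl_lt_iff hconj s).2 hnot)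
    exact hne (by rw [← heq, inv_mul_cancel_right])
  rw [hcocycle, iff_true_left hup]

end IsLengthFn

/-- `g` has a reduced expression in the elements of `S₀`. -/
inductive ReducedIn (l : W → ℕ) (S₀ : Set W) : W → Prop
  | one : ReducedIn l S₀ 1
  | mul_simple (g s : W) (hs : s ∈ S₀) (hg : ReducedIn l S₀ g) (hl : l g < l (g * s)) :
      ReducedIn l S₀ (g * s)

/-- `d` is a minimal representative of its left coset modulo the subgroup generated by the simple
reflections in `S₀`. -/
def IsMinRep (l : W → ℕ) (S₀ : Set W) (d : W) : Prop := ∀ s ∈ S₀, l d < l (d * s)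

namespace IsLengthFn

variable {S T S₀ : Set W} {l : W → ℕ} (h : IsLengthFn S T l) (hS₀ : S₀ ⊆ S)
include h hS₀

theorem reducedIn_simple_mul {s g : W} (hs : s ∈ S₀) (hg : ReducedIn l S₀ g) :
    ReducedIn l S₀ (s * g) := by
  have hs' := hS₀ hs
  induction hg with
  | one =>
    simpa using ReducedIn.mul_simple (l := l) 1 s hs .one
      (by rw [one_mul, h.one, h.length_simple s hs']; exact one_pos)
  | mul_simple g r hr _ hl ih =>
    have hr' := hS₀ hr
    by_cases hexch : s * g = g * r
    · rwa [← hexch, h.simple_mul_cancel hs']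
    · have hlt := (h.simple_mul_lt_iff_of_ne hs' hr' hexch).2 hl
      rw [← mul_assoc] at hlt ⊢
      exact .mul_simple _ r hr ih hlt

theorem reducedIn_of_mem_closure {g : W} (hg : g ∈ Subgroup.closure S₀) : ReducedIn l S₀ g := by
  induction hg using Subgroup.closure_induction_left with
  | one => exact .one
  | mul_left s hs g _ ih => exact h.reducedIn_simple_mul hS₀ hs ih
  | inv_mul_cancel s hs g _ ih =>
    rw [h.simple_inv (hS₀ hs)]
    exact h.reducedIn_simple_mul hS₀ hs ih

theorem exists_mul_simple_lt_of_mem_closure {g : W} (hg : g ∈ Subgroup.closure S₀) (hne : g ≠ 1) :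
    ∃ s ∈ S₀, l (g * s) < l g := by
  cases h.reducedIn_of_mem_closure hS₀ hg with
  | one => exact absurd rfl hne
  | mul_simple g s hs _ hl => exact ⟨s, hs, by rwa [h.mul_simple_cancel (hS₀ hs)]⟩

theorem length_mul_of_forall_length_le {d : W} (hd : ∀ u ∈ Subgroup.closure S₀, l d ≤ l (d * u))
    {u : W} (hu : u ∈ Subgroup.closure S₀) : l (d * u) = l d + l u := by
  have hred := h.reducedIn_of_mem_closure hS₀ hu
  induction hred with
  | one => rw [mul_one, h.one, add_zero]
  | mul_simple g s hs _ hl ih =>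
    have hs' := hS₀ hs
    have hsW : s ∈ Subgroup.closure S₀ := Subgroup.subset_closure hs
    have hg : g ∈ Subgroup.closure S₀ := (mul_mem_cancel_right hsW).1 hu
    have ht : g * s * g⁻¹ ∈ T := h.conj s (h.simple_subset hs') g
    have hdt : l d < l (d * (g * s * g⁻¹)) := by
      by_contra hnot
      exact ((h.mul_refl_lt_iff ht d).2 hnot).not_ge (hd _ (mul_mem hu (inv_mem hg)))
    have hlt := (h.lt_mul_mul_iff _ ht d g).2
      (iff_of_true hdt (by rwa [inv_mul_cancel_right]))
    rw [mul_assoc d, inv_mul_cancel_right, ← mul_assoc] at hlt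
    rw [← mul_assoc, h.mul_simple_of_lt hs' hlt, h.mul_simple_of_lt hs' hl, ih hg, add_assoc]

theorem length_mul_of_isMinRep {d : W} (hd : IsMinRep l S₀ d) {u : W}
    (hu : u ∈ Subgroup.closure S₀) : l (d * u) = l d + l u := by
  obtain ⟨a, ha, hmin⟩ : ∃ a ∈ Subgroup.closure S₀, ∀ g ∈ Subgroup.closure S₀,
      l (d * a) ≤ l (d * g) :=
    ⟨Function.argminOn (fun g => l (d * g)) _ ⟨1, one_mem (Subgroup.closure S₀)⟩,
      Function.argminOn_mem _ _ _, fun g hg => Function.argminOn_le (fun g => l (d * g)) _ hg⟩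
  have hadd : ∀ g ∈ Subgroup.closure S₀, l (d * g) = l (d * a) + l (a⁻¹ * g) := fun g hg => by
    have := h.length_mul_of_forall_length_le hS₀ (d := d * a)
      (fun u hu => by rw [mul_assoc]; exact hmin _ (mul_mem ha hu)) (mul_mem (inv_mem ha) hg)
    rwa [mul_assoc, mul_inv_cancel_left] at this
  obtain rfl : a = 1 := by
    by_contra hne
    obtain ⟨s, hs, hlt⟩ :=
      h.exists_mul_simple_lt_of_mem_closure hS₀ (inv_mem ha) (inv_ne_one.2 hne)
    have hone := hadd 1 (one_mem _)
    have hds := hd s hs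
    rw [mul_one, mul_one] at hone
    rw [hadd s (Subgroup.subset_closure hs)] at hds
    lia
  simpa only [mul_one, inv_one, one_mul] using hadd u hu

theorem eq_one_of_isMinRep_mul {d u : W} (hd : IsMinRep l S₀ d) (hdu : IsMinRep l S₀ (d * u))
    (hu : u ∈ Subgroup.closure S₀) : u = 1 := by
  by_contra hne
  obtain ⟨s, hs, hlt⟩ := h.exists_mul_simple_lt_of_mem_closure hS₀ hu hne
  have hgt := hdu s hs
  rw [mul_assoc, h.length_mul_of_isMinRep hS₀ hd hu,
    h.length_mul_of_isMinRep hS₀ hd (mul_mem hu (Subgroup.subset_closure hs))] at hgt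
  lia

end IsLengthFn

end Length

section RegularRepresentation

variable {W : Type*} [Group W] (l : W → ℕ) {A : Type*} [CommRing A] (q : A)

open Classical in
/-- Left multiplication by `T_s` on the free module over `W`. -/
def leftOp (s : W) : Module.End A (W →₀ A) :=
  Finsupp.linearCombination A fun x =>
    if l x < l (s * x) then Finsupp.single (s * x) 1
    else q • Finsupp.single (s * x) 1 + (q - 1) • Finsupp.single x 1

open Classical in
/-- Right multiplication by `T_s` on the free module over `W`. -/
def rightOp (s : W) : Module.End A (W →₀ A) :=
  Finsupp.linearCombination A fun x =>
    if l x < l (x * s) then Finsupp.single (x * s) 1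
    else q • Finsupp.single (x * s) 1 + (q - 1) • Finsupp.single x 1

variable (A) in
/-- Left translation on the free module over `W`; for `g` of length zero it is left multiplication
by `T_g`. -/
def leftTranslation (g : W) : Module.End A (W →₀ A) := Finsupp.lmapDomain A A (g * ·)

variable (A) in
/-- Right translation on the free module over `W`; for `g` of length zero it is right multiplication
by `T_g`. -/
def rightTranslation (g : W) : Module.End A (W →₀ A) := Finsupp.lmapDomain A A (· * g)

variable {l}

theorem leftOp_of_lt {s x : W} (hx : l x < l (s * x)) :
    leftOp l q s (Finsupp.single x 1) = Finsupp.single (s * x) 1 := by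
  rw [leftOp, Finsupp.linearCombination_single, one_smul, if_pos hx]

theorem leftOp_of_not_lt {s x : W} (hx : ¬ l x < l (s * x)) :
    leftOp l q s (Finsupp.single x 1) =
      q • Finsupp.single (s * x) 1 + (q - 1) • Finsupp.single x 1 := by
  rw [leftOp, Finsupp.linearCombination_single, one_smul, if_neg hx]

theorem rightOp_of_lt {s x : W} (hx : l x < l (x * s)) :
    rightOp l q s (Finsupp.single x 1) = Finsupp.single (x * s) 1 := by
  rw [rightOp, Finsupp.linearCombination_single, one_smul, if_pos hx]

theorem rightOp_of_not_lt {s x : W} (hx : ¬ l x < l (x * s)) :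
    rightOp l q s (Finsupp.single x 1) =
      q • Finsupp.single (x * s) 1 + (q - 1) • Finsupp.single x 1 := by
  rw [rightOp, Finsupp.linearCombination_single, one_smul, if_neg hx]

@[simp] theorem leftTranslation_single (g x : W) :
    leftTranslation A g (Finsupp.single x 1) = Finsupp.single (g * x) 1 :=
  Finsupp.mapDomain_single

@[simp] theorem rightTranslation_single (g x : W) :
    rightTranslation A g (Finsupp.single x 1) = Finsupp.single (x * g) 1 :=
  Finsupp.mapDomain_single

theorem leftOp_single_eq_rightOp_single {s t x : W} (hx : s * x = x * t) :
    leftOp l q s (Finsupp.single x 1) = rightOp l q t (Finsupp.single x 1) := by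
  simp only [leftOp, rightOp, Finsupp.linearCombination_single, hx]

omit [Group W] in
theorem end_ext_single {f g : Module.End A (W →₀ A)}
    (hfg : ∀ x, f (Finsupp.single x 1) = g (Finsupp.single x 1)) : f = g :=
  Finsupp.lhom_ext' fun x => LinearMap.ext_ring (hfg x)

theorem leftTranslation_comm_rightTranslation (g k : W) :
    Commute (leftTranslation A g) (rightTranslation A k) :=
  end_ext_single fun x => by simp [mul_assoc]

variable {S T : Set W} (h : IsLengthFn S T l)
include h

theorem rightOp_apply_of_lt {s y : W} (hs : s ∈ S) (hy : l y < l (y * s)) (p : W →₀ A) :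
    rightOp l q s p y = q * p (y * s) := by
  classical
  suffices Finsupp.lapply y ∘ₗ rightOp l q s = q • Finsupp.lapply (y * s) from
    LinearMap.congr_fun this p
  refine Finsupp.lhom_ext' fun x => LinearMap.ext_ring ?_
  have hx : x * s = y ↔ x = y * s := by
    rw [← mul_left_inj s, h.mul_simple_cancel hs]
  have hys := h.mul_simple_cancel hs y
  by_cases hup : l x < l (x * s)
  · have hne : x ≠ y * s := by rintro rfl; rw [hys] at hup; exact lt_asymm hup hy
    have hne' : x * s ≠ y := hne ∘ hx.1
    simp [rightOp_of_lt q hup, hne, hne']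
  · have hne : x ≠ y := by rintro rfl; exact hup hy
    simp [rightOp_of_not_lt q hup, Finsupp.single_apply, hne, hx]

theorem rightOp_apply_of_gt {s y : W} (hs : s ∈ S) (hy : l (y * s) < l y) (p : W →₀ A) :
    rightOp l q s p y = p (y * s) + (q - 1) * p y := by
  classical
  suffices Finsupp.lapply y ∘ₗ rightOp l q s =
      Finsupp.lapply (y * s) + (q - 1) • Finsupp.lapply y from LinearMap.congr_fun this p
  refine Finsupp.lhom_ext' fun x => LinearMap.ext_ring ?_
  have hx : x * s = y ↔ x = y * s := by
    rw [← mul_left_inj s, h.mul_simple_cancel hs]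
  have hys := h.mul_simple_cancel hs y
  by_cases hup : l x < l (x * s)
  · have hne : x ≠ y := by rintro rfl; exact lt_asymm hup hy
    simp [rightOp_of_lt q hup, Finsupp.single_apply, hne, hx]
  · have hne : x ≠ y * s := by rintro rfl; rw [hys] at hup; exact hup hy
    have hne' : x * s ≠ y := hne ∘ hx.1
    rcases eq_or_ne x y with rfl | hxy
    · simp [rightOp_of_not_lt q hup, hne, hne']
    · simp [rightOp_of_not_lt q hup, hne, hne', hxy]

theorem leftOp_rightOp_single_of_eq {s t : W} (hs : s ∈ S) (ht : t ∈ S) {x : W}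
    (hx : s * x = x * t) :
    leftOp l q s (rightOp l q t (Finsupp.single x 1)) =
      rightOp l q t (leftOp l q s (Finsupp.single x 1)) := by
  have hxt : s * (x * t) = x * t * t := by
    rw [← hx, h.simple_mul_cancel hs, hx, h.mul_simple_cancel ht]
  rw [leftOp_single_eq_rightOp_single q hx]
  by_cases hup : l x < l (x * t)
  · rw [rightOp_of_lt q hup, leftOp_single_eq_rightOp_single q hxt]
  · rw [rightOp_of_not_lt q hup]
    simp only [map_add, map_smul, leftOp_single_eq_rightOp_single q hx,
      leftOp_single_eq_rightOp_single q hxt]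

theorem leftOp_rightOp_single_of_ne {s t : W} (hs : s ∈ S) (ht : t ∈ S) {x : W}
    (hx : s * x ≠ x * t) :
    leftOp l q s (rightOp l q t (Finsupp.single x 1)) =
      rightOp l q t (leftOp l q s (Finsupp.single x 1)) := by
  have hright : l (s * x) < l (s * x * t) ↔ l x < l (x * t) := by
    rw [mul_assoc, h.simple_mul_lt_iff_of_ne hs ht hx]
  have hleft : l (x * t) < l (s * (x * t)) ↔ l x < l (s * x) := by
    have hsx := h.simple_mul hs x
    have hxt := h.mul_simple ht x
    have hsxt := h.mul_simple ht (s * x)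
    rw [mul_assoc] at hright hsxt
    lia
  by_cases hs_up : l x < l (s * x) <;> by_cases ht_up : l x < l (x * t)
  · rw [leftOp_of_lt q hs_up, rightOp_of_lt q ht_up, leftOp_of_lt q (hleft.2 hs_up),
      rightOp_of_lt q (hright.2 ht_up), mul_assoc]
  · rw [leftOp_of_lt q hs_up, rightOp_of_not_lt q ht_up, map_add, map_smul, map_smul,
      leftOp_of_lt q hs_up, leftOp_of_lt q (hleft.2 hs_up),
      rightOp_of_not_lt q (hright.not.2 ht_up), mul_assoc]
  · rw [leftOp_of_not_lt q hs_up, rightOp_of_lt q ht_up, map_add, map_smul, map_smul,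
      rightOp_of_lt q ht_up, rightOp_of_lt q (hright.2 ht_up),
      leftOp_of_not_lt q (hleft.not.2 hs_up), mul_assoc]
  · rw [leftOp_of_not_lt q hs_up, rightOp_of_not_lt q ht_up]
    simp only [map_add, map_smul]
    rw [leftOp_of_not_lt q hs_up, rightOp_of_not_lt q ht_up,
      leftOp_of_not_lt q (hleft.not.2 hs_up), rightOp_of_not_lt q (hright.not.2 ht_up), mul_assoc]
    module

theorem leftOp_comm_rightOp {s t : W} (hs : s ∈ S) (ht : t ∈ S) :
    Commute (leftOp l q s) (rightOp l q t) :=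
  end_ext_single fun x => by
    by_cases hx : s * x = x * t
    · exact leftOp_rightOp_single_of_eq q h hs ht hx
    · exact leftOp_rightOp_single_of_ne q h hs ht hx

theorem leftOp_comm_rightTranslation (s : W) {g : W} (hg : l g = 0) :
    Commute (leftOp l q s) (rightTranslation A g) := by
  refine end_ext_single fun x => ?_
  simp only [Module.End.mul_apply, rightTranslation_single]
  have hlen : l (x * g) < l (s * (x * g)) ↔ l x < l (s * x) := by
    rw [← mul_assoc, h.length_mul_zero hg, h.length_mul_zero hg]
  by_cases hx : l x < l (s * x)
  · rw [leftOp_of_lt q hx, leftOp_of_lt q (hlen.2 hx), rightTranslation_single, mul_assoc]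
  · rw [leftOp_of_not_lt q hx, leftOp_of_not_lt q (hlen.not.2 hx)]
    simp only [map_add, map_smul, rightTranslation_single, mul_assoc]

theorem leftTranslation_comm_rightOp (s : W) {g : W} (hg : l g = 0) :
    Commute (leftTranslation A g) (rightOp l q s) := by
  refine end_ext_single fun x => ?_
  simp only [Module.End.mul_apply, leftTranslation_single]
  have hlen : l (g * x) < l (g * x * s) ↔ l x < l (x * s) := by
    rw [mul_assoc, h.length_zero_mul hg, h.length_zero_mul hg]
  by_cases hx : l x < l (x * s)
  · rw [rightOp_of_lt q hx, rightOp_of_lt q (hlen.2 hx), leftTranslation_single, mul_assoc]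
  · rw [rightOp_of_not_lt q hx, rightOp_of_not_lt q (hlen.not.2 hx)]
    simp only [map_add, map_smul, leftTranslation_single, mul_assoc]

variable (S l)

omit h in
/-- The commutant of the right multiplications by the `T_s` and by the `T_g` with `g` of length
zero. It is the image of the left regular representation, which is how that is constructed. -/
def rightCommutant : Subalgebra A (Module.End A (W →₀ A)) :=
  Subalgebra.centralizer A (rightOp l q '' S ∪ rightTranslation A '' {g | l g = 0})

variable {S l}

omit h in
theorem mem_rightCommutant {f : Module.End A (W →₀ A)} : f ∈ rightCommutant l q S ↔
    (∀ s ∈ S, Commute f (rightOp l q s)) ∧ ∀ g, l g = 0 → Commute f (rightTranslation A g) := by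
  simp only [rightCommutant, Subalgebra.mem_centralizer_iff, Set.mem_union, or_imp, forall_and,
    Set.forall_mem_image, Set.mem_ofPred_eq, Commute, SemiconjBy, eq_comm]

theorem leftOp_mem_rightCommutant {s : W} (hs : s ∈ S) : leftOp l q s ∈ rightCommutant l q S :=
  (mem_rightCommutant q).2 ⟨fun _ ht => leftOp_comm_rightOp q h hs ht,
    fun _ hg => leftOp_comm_rightTranslation q h s hg⟩

theorem leftTranslation_mem_rightCommutant {g : W} (hg : l g = 0) :
    leftTranslation A g ∈ rightCommutant l q S :=
  (mem_rightCommutant q).2 ⟨fun s _ => leftTranslation_comm_rightOp q h s hg,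
    fun k _ => leftTranslation_comm_rightTranslation g k⟩

theorem rightCommutant_ext {f g : Module.End A (W →₀ A)} (hf : f ∈ rightCommutant l q S)
    (hg : g ∈ rightCommutant l q S)
    (hone : f (Finsupp.single 1 1) = g (Finsupp.single 1 1)) : f = g := by
  rw [mem_rightCommutant] at hf hg
  refine end_ext_single fun x => ?_
  induction hn : l x using Nat.strong_induction_on generalizing x with
  | _ n ih =>
    obtain hx | hx := eq_or_ne (l x) 0
    · have hfx := LinearMap.congr_fun (hf.2 x hx).eq (Finsupp.single 1 1)
      have hgx := LinearMap.congr_fun (hg.2 x hx).eq (Finsupp.single 1 1)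
      simp only [Module.End.mul_apply, rightTranslation_single, one_mul] at hfx hgx
      rw [hfx, hgx, hone]
    · obtain ⟨s, hs, hlt⟩ := h.exists_mul_simple_lt x hx
      have hfx := LinearMap.congr_fun (hf.1 s hs).eq (Finsupp.single (x * s) 1)
      have hgx := LinearMap.congr_fun (hg.1 s hs).eq (Finsupp.single (x * s) 1)
      simp only [Module.End.mul_apply] at hfx hgx
      rw [rightOp_of_lt q (by rwa [h.mul_simple_cancel hs]), h.mul_simple_cancel hs] at hfx hgx
      rw [hfx, hgx, ih _ (hn ▸ hlt) _ rfl]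

theorem exists_mem_rightCommutant (w : W) :
    ∃ f ∈ rightCommutant l q S, f (Finsupp.single 1 1) = Finsupp.single w 1 := by
  induction hn : l w using Nat.strong_induction_on generalizing w with
  | _ n ih =>
    obtain hw | hw := eq_or_ne (l w) 0
    · exact ⟨_, leftTranslation_mem_rightCommutant q h hw, by rw [leftTranslation_single, mul_one]⟩
    · obtain ⟨s, hs, hlt⟩ := h.exists_simple_mul_lt w hw
      obtain ⟨f, hf, hf1⟩ := ih _ (hn ▸ hlt) (s * w) rfl
      refine ⟨leftOp l q s * f, mul_mem (leftOp_mem_rightCommutant q h hs) hf, ?_⟩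
      rw [Module.End.mul_apply, hf1, leftOp_of_lt q (by rwa [h.simple_mul_cancel hs]),
        h.simple_mul_cancel hs]

/-- The operator of the standard basis element `T_w` in the left regular representation: the unique
element of `rightCommutant l q S` that maps the basis vector at `1` to the one at `w`. -/
def regularOp (w : W) : Module.End A (W →₀ A) := (exists_mem_rightCommutant q h w).choose

theorem regularOp_mem (w : W) : regularOp q h w ∈ rightCommutant l q S :=
  (exists_mem_rightCommutant q h w).choose_spec.1

theorem regularOp_single_one (w : W) :
    regularOp q h w (Finsupp.single 1 1) = Finsupp.single w 1 :=
  (exists_mem_rightCommutant q h w).choose_spec.2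

theorem eq_regularOp {f : Module.End A (W →₀ A)} (hf : f ∈ rightCommutant l q S) {w : W}
    (hfw : f (Finsupp.single 1 1) = Finsupp.single w 1) : f = regularOp q h w :=
  rightCommutant_ext q h hf (regularOp_mem q h w) (by rw [hfw, regularOp_single_one])

theorem regularOp_one : regularOp q h 1 = 1 :=
  (eq_regularOp q h (one_mem _) rfl).symm

theorem regularOp_simple {s : W} (hs : s ∈ S) : regularOp q h s = leftOp l q s := by
  refine (eq_regularOp q h (leftOp_mem_rightCommutant q h hs) ?_).symm
  rw [leftOp_of_lt q (by rw [mul_one, h.one, h.length_simple s hs]; exact one_pos), mul_one]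

theorem regularOp_of_length_eq_zero {g : W} (hg : l g = 0) :
    regularOp q h g = leftTranslation A g :=
  (eq_regularOp q h (leftTranslation_mem_rightCommutant q h hg) (by simp)).symm

theorem regularOp_eq_leftOp_mul {s x : W} (hs : s ∈ S) (hlt : l (s * x) < l x) :
    regularOp q h x = leftOp l q s * regularOp q h (s * x) := by
  refine (eq_regularOp q h
    (mul_mem (leftOp_mem_rightCommutant q h hs) (regularOp_mem q h _)) ?_).symm
  rw [Module.End.mul_apply, regularOp_single_one,
    leftOp_of_lt q (by rwa [h.simple_mul_cancel hs]), h.simple_mul_cancel hs]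

theorem regularOp_single {x y : W} (hxy : l (x * y) = l x + l y) :
    regularOp q h x (Finsupp.single y 1) = Finsupp.single (x * y) 1 := by
  induction hn : l x using Nat.strong_induction_on generalizing x with
  | _ n ih =>
    obtain hx | hx := eq_or_ne (l x) 0
    · rw [regularOp_of_length_eq_zero q h hx, leftTranslation_single]
    · obtain ⟨s, hs, hlt⟩ := h.exists_simple_mul_lt x hx
      have hsxy := h.simple_mul hs (x * y)
      have hle := h.mul_le (s * x) y
      rw [mul_assoc] at hle
      rw [regularOp_eq_leftOp_mul q h hs hlt, Module.End.mul_apply,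
        ih (l (s * x)) (hn ▸ hlt) (by rw [mul_assoc]; lia) rfl, mul_assoc,
        leftOp_of_lt q (by rw [h.simple_mul_cancel hs]; lia), h.simple_mul_cancel hs]

theorem regularOp_mul {x y : W} (hxy : l (x * y) = l x + l y) :
    regularOp q h x * regularOp q h y = regularOp q h (x * y) :=
  eq_regularOp q h (mul_mem (regularOp_mem q h _) (regularOp_mem q h _)) (by
    rw [Module.End.mul_apply, regularOp_single_one, regularOp_single q h hxy])

theorem regularOp_quad {s : W} (hs : s ∈ S) :
    (regularOp q h s - algebraMap A _ q) * (regularOp q h s + 1) = 0 := by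
  have hdown : ¬ l s < l (s * s) := by rw [h.simple_mul_self hs, h.one]; exact Nat.not_lt_zero _
  have hmem := regularOp_mem q h s
  have hadd : regularOp q h s + 1 ∈ rightCommutant l q S := add_mem hmem (one_mem _)
  refine (sub_mul (regularOp q h s) _ _).trans ?_
  rw [sub_eq_zero, ← Algebra.smul_def]
  refine rightCommutant_ext q h (mul_mem hmem hadd) (Subalgebra.smul_mem _ hadd _) ?_
  rw [Module.End.mul_apply, LinearMap.smul_apply, LinearMap.add_apply, regularOp_single_one,
    Module.End.one_apply, map_add, regularOp_single_one, regularOp_simple q h hs,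
    leftOp_of_not_lt q hdown, h.simple_mul_self hs]
  module

end RegularRepresentation

section HeckeBasis

variable {W : Type*} [Group W] {A : Type*} [CommRing A] {H : Type*} [Ring H] [Algebra A H]

/-- The family `τ` satisfies the defining relations of the Hecke algebra with parameter `q`. -/
structure IsHeckeFamily (S : Set W) (l : W → ℕ) (q : A) (τ : W → H) : Prop where
  one : τ 1 = 1
  mul : ∀ x y, l (x * y) = l x + l y → τ x * τ y = τ (x * y)
  quad : ∀ s ∈ S, (τ s - algebraMap A H q) * (τ s + 1) = 0

/-- The family `τ` is the standard basis of a Hecke algebra with parameter `q`. -/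
structure IsHeckeBasis (S : Set W) (l : W → ℕ) (q : A) (τ : W → H) : Prop
    extends IsHeckeFamily S l q τ where
  linearIndependent : LinearIndependent A τ
  span : ⊤ ≤ Submodule.span A (Set.range τ)

namespace IsHeckeFamily

variable {S T : Set W} {l : W → ℕ} {q : A} {τ : W → H} (hτ : IsHeckeFamily S l q τ)
include hτ

theorem simple_mul_simple {s : W} (hs : s ∈ S) : τ s * τ s = (q - 1) • τ s + q • 1 := by
  have hquad := hτ.quad s hs
  rw [Algebra.algebraMap_eq_smul_one, sub_mul, mul_add, mul_one, smul_mul_assoc, one_mul] at hquad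
  rw [← sub_eq_zero, ← hquad]
  module

variable (h : IsLengthFn S T l)
include h

theorem mul_simple_of_lt {s : W} (hs : s ∈ S) {x : W} (hx : l x < l (x * s)) :
    τ x * τ s = τ (x * s) :=
  hτ.mul _ _ (by rw [h.length_simple s hs]; exact h.mul_simple_of_lt hs hx)

theorem mul_simple_of_gt {s : W} (hs : s ∈ S) {x : W} (hx : l (x * s) < l x) :
    τ x * τ s = (q - 1) • τ x + q • τ (x * s) := by
  have hred : τ x = τ (x * s) * τ s := by
    rw [hτ.mul_simple_of_lt h hs (by rwa [h.mul_simple_cancel hs]), h.mul_simple_cancel hs]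
  rw [hred, mul_assoc, hτ.simple_mul_simple hs, mul_add, mul_smul_comm, mul_smul_comm, mul_one]

theorem simple_mul_of_lt {s : W} (hs : s ∈ S) {x : W} (hx : l x < l (s * x)) :
    τ s * τ x = τ (s * x) :=
  hτ.mul _ _ (by
    have := h.simple_mul hs x
    rw [h.length_simple s hs]
    lia)

theorem mul_mem_span_range_of_mem_range (x y : W) :
    τ x * τ y ∈ Submodule.span A (Set.range τ) := by
  induction hn : l y using Nat.strong_induction_on generalizing x y with
  | _ n ih =>
    obtain hy | hy := eq_or_ne (l y) 0
    · rw [hτ.mul _ _ (by rw [h.length_mul_zero hy, hy, add_zero])]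
      exact Submodule.subset_span ⟨_, rfl⟩
    · obtain ⟨s, hs, hlt⟩ := h.exists_simple_mul_lt y hy
      have hred : τ y = τ s * τ (s * y) := by
        rw [hτ.simple_mul_of_lt h hs (by rwa [h.simple_mul_cancel hs]), h.simple_mul_cancel hs]
      have hrec (x : W) := ih _ (hn ▸ hlt) x _ rfl
      rw [hred, ← mul_assoc]
      rcases h.mul_simple_lt_or_gt hs x with hx | hx
      · rw [hτ.mul_simple_of_lt h hs hx]
        exact hrec _
      · rw [hτ.mul_simple_of_gt h hs hx, add_mul, smul_mul_assoc, smul_mul_assoc]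
        exact add_mem (Submodule.smul_mem _ _ (hrec _)) (Submodule.smul_mem _ _ (hrec _))

theorem mul_mem_span_range {x y : H} (hx : x ∈ Submodule.span A (Set.range τ))
    (hy : y ∈ Submodule.span A (Set.range τ)) : x * y ∈ Submodule.span A (Set.range τ) := by
  have hmul := Submodule.mul_mem_mul hx hy
  rw [Submodule.span_mul_span] at hmul
  refine Submodule.span_le.2 ?_ hmul
  rintro _ ⟨_, ⟨x, rfl⟩, _, ⟨y, rfl⟩, rfl⟩
  exact hτ.mul_mem_span_range_of_mem_range h x y

end IsHeckeFamily

namespace IsHeckeBasis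

variable {S T : Set W} {l : W → ℕ} {q : A} {τ : W → H} (hτ : IsHeckeBasis S l q τ)
include hτ

/-- The standard basis of a Hecke algebra as a bundled basis. -/
def basis : Module.Basis W A H := Module.Basis.mk hτ.linearIndependent hτ.span

@[simp] theorem basis_apply (w : W) : hτ.basis w = τ w := Module.Basis.mk_apply _ _ w

@[simp] theorem basis_repr (w : W) : hτ.basis.repr (τ w) = Finsupp.single w 1 := by
  rw [← hτ.basis_apply, Module.Basis.repr_self]

theorem repr_mul_simple (h : IsLengthFn S T l) {s : W} (hs : s ∈ S) (x : H) :
    hτ.basis.repr (x * τ s) = rightOp l q s (hτ.basis.repr x) := by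
  suffices hτ.basis.repr.toLinearMap ∘ₗ LinearMap.mulRight A (τ s) =
      rightOp l q s ∘ₗ hτ.basis.repr.toLinearMap from LinearMap.congr_fun this x
  refine hτ.basis.ext fun w => ?_
  simp only [LinearMap.comp_apply, LinearMap.mulRight_apply, LinearEquiv.coe_coe, basis_apply,
    basis_repr]
  rcases h.mul_simple_lt_or_gt hs w with hw | hw
  · rw [hτ.mul_simple_of_lt h hs hw, rightOp_of_lt q hw, hτ.basis_repr]
  · rw [hτ.mul_simple_of_gt h hs hw, rightOp_of_not_lt q hw.not_gt, map_add, map_smul, map_smul,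
      hτ.basis_repr, hτ.basis_repr, add_comm]

end IsHeckeBasis

end HeckeBasis

section HeckeBasisOfPresentation

variable {ι V V' : Type*} [AddCommGroup V] [Module ℝ V] [AddCommGroup V'] [Module ℝ V']
  {R : RootPairing ι ℝ V V'} [R.IsCrystallographic] (b : R.Base) {A : Type*} [CommRing A] (q : A)

theorem T_one : T b q 1 = 1 := by
  rw [T, RingQuot.mkAlgHom_rel A (HeckeRel.one (b := b) (q := q)), map_one]

theorem T_mul {x y : ExtAffineWeyl R} (hxy : length b (x * y) = length b x + length b y) :
    T b q x * T b q y = T b q (x * y) := by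
  rw [T, T, ← map_mul, RingQuot.mkAlgHom_rel A (HeckeRel.mul (b := b) (q := q) x y hxy), T]

theorem T_quad {s : ExtAffineWeyl R} (hs : s ∈ simples b) :
    (T b q s - algebraMap A _ q) * (T b q s + 1) = 0 := by
  have hquad := RingQuot.mkAlgHom_rel A (HeckeRel.quad (b := b) (q := q) s hs)
  rwa [map_mul, map_sub, map_add, map_zero, map_one, AlgHom.commutes] at hquad

theorem isHeckeFamily_T : IsHeckeFamily (simples b) (length b) q (T b q) where
  one := T_one b q
  mul _ _ := T_mul b q
  quad _ := T_quad b q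

variable {b} {refls : Set (ExtAffineWeyl R)} (h : IsLengthFn (simples b) refls (length b))

/-- The left regular representation of the Hecke algebra. -/
def regularRep : Hecke b q →ₐ[A] Module.End A (ExtAffineWeyl R →₀ A) :=
  RingQuot.liftAlgHom A ⟨FreeAlgebra.lift A (regularOp q h), by
    intro x y hxy
    induction hxy with
    | one => rw [FreeAlgebra.lift_ι_apply, map_one, regularOp_one]
    | mul x y hxy => simp only [map_mul, FreeAlgebra.lift_ι_apply, regularOp_mul q h hxy]
    | quad s hs =>
      rw [map_mul, map_sub, map_add, map_zero, map_one, AlgHom.commutes, FreeAlgebra.lift_ι_apply]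
      exact regularOp_quad q h hs⟩

theorem regularRep_T (w : ExtAffineWeyl R) : regularRep q h (T b q w) = regularOp q h w := by
  rw [regularRep, T, RingQuot.liftAlgHom_mkAlgHom_apply, FreeAlgebra.lift_ι_apply]

include h

theorem linearIndependent_T : LinearIndependent A (T b q) := by
  refine .of_comp
    (LinearMap.applyₗ (Finsupp.single 1 (1 : A)) ∘ₗ (regularRep q h).toLinearMap) ?_
  convert Finsupp.linearIndependent_single_one A (ExtAffineWeyl R) with w
  simp only [Function.comp_apply, LinearMap.comp_apply, LinearMap.applyₗ_apply_apply,
    AlgHom.toLinearMap_apply, regularRep_T, regularOp_single_one]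

theorem span_T : ⊤ ≤ Submodule.span A (Set.range (T b q)) := by
  rintro x -
  obtain ⟨x, rfl⟩ := RingQuot.mkAlgHom_surjective A (HeckeRel b q) x
  induction x using FreeAlgebra.induction with
  | grade0 r =>
    rw [AlgHom.commutes, Algebra.algebraMap_eq_smul_one, ← T_one b q]
    exact Submodule.smul_mem _ _ (Submodule.subset_span ⟨1, rfl⟩)
  | grade1 x => exact Submodule.subset_span ⟨x, rfl⟩
  | mul x y hx hy =>
    rw [map_mul]
    exact (isHeckeFamily_T b q).mul_mem_span_range h hx hy
  | add x y hx hy => rw [map_add]; exact add_mem hx hy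

theorem isHeckeBasis_T : IsHeckeBasis (simples b) (length b) q (T b q) where
  toIsHeckeFamily := isHeckeFamily_T b q
  linearIndependent := linearIndependent_T q h
  span := span_T q h

end HeckeBasisOfPresentation

section Bruhat

variable {W : Type*} [Group W] {S T : Set W} {l : W → ℕ}

/-- The Bruhat order attached to the length function `l` and the set of reflections `T`. -/
def AbstractBruhatLE (T : Set W) (l : W → ℕ) (y w : W) : Prop :=
  Relation.ReflTransGen (fun x z => l x < l z ∧ ∃ t ∈ T, z = x * t) y w

namespace AbstractBruhatLE

theorem eq_or_length_lt {y w : W} (hyw : AbstractBruhatLE T l y w) : y = w ∨ l y < l w := by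
  induction hyw with
  | refl => exact .inl rfl
  | tail _ hxz ih =>
    rcases ih with rfl | ih
    · exact .inr hxz.1
    · exact .inr (ih.trans hxz.1)

theorem length_lt {y w : W} (hyw : AbstractBruhatLE T l y w) (hne : y ≠ w) : l y < l w :=
  hyw.eq_or_length_lt.resolve_left hne

variable (h : IsLengthFn S T l)
include h

theorem self_mul_simple {s w : W} (hs : s ∈ S) (hw : l w < l (w * s)) :
    AbstractBruhatLE T l w (w * s) :=
  .single ⟨hw, s, h.simple_subset hs, rfl⟩

theorem mul_simple_or {s y w : W} (hs : s ∈ S) (hyw : AbstractBruhatLE T l y w) :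
    AbstractBruhatLE T l (y * s) w ∨ AbstractBruhatLE T l (y * s) (w * s) := by
  induction hyw with
  | refl => exact .inr .refl
  | @tail x z _ hxz ih =>
    rcases ih with ih | ih
    · exact .inl (ih.tail hxz)
    · obtain ⟨hlt, t, ht, rfl⟩ := hxz
      obtain rfl | hts := eq_or_ne t s
      · exact .inl ih
      · exact .inr (ih.tail ⟨h.mul_simple_lt_mul_mul_simple hs ht hts hlt, _, h.conj t ht s⁻¹,
          by group⟩)

theorem mul_simple {s y w : W} (hs : s ∈ S) (hyw : AbstractBruhatLE T l y w)
    (hw : l w < l (w * s)) : AbstractBruhatLE T l (y * s) (w * s) :=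
  (hyw.mul_simple_or h hs).elim (·.trans (self_mul_simple h hs hw)) id

end AbstractBruhatLE

end Bruhat

section EvalSum

variable {W A M : Type*} [CommRing A] [AddCommGroup M] [Module A M] (a : A) (ρ : W → M)

/-- The element `∑_y p_y(a) ρ_y` attached to a family `p` of polynomials. -/
def evalSum : (W →₀ ℤ[X]) →+ M :=
  (Finsupp.linearCombination A ρ).toAddMonoidHom.comp
    (Finsupp.mapRange.addMonoidHom (Polynomial.aeval a : ℤ[X] →ₐ[ℤ] A).toAddMonoidHom)

theorem evalSum_eq_sum (p : W →₀ ℤ[X]) :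
    evalSum a ρ p = p.sum fun y f => Polynomial.aeval a f • ρ y :=
  (Finsupp.linearCombination_apply A _).trans
    (Finsupp.sum_mapRange_index (hf := map_zero _) fun _ => zero_smul A _)

@[simp] theorem evalSum_single (y : W) (f : ℤ[X]) :
    evalSum a ρ (Finsupp.single y f) = Polynomial.aeval a f • ρ y := by
  rw [evalSum_eq_sum, Finsupp.sum_single_index (by rw [map_zero, zero_smul])]

theorem evalSum_smul (f : ℤ[X]) (p : W →₀ ℤ[X]) :
    evalSum a ρ (f • p) = Polynomial.aeval a f • evalSum a ρ p := by
  induction p using Finsupp.induction_linear with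
  | zero => simp only [smul_zero, map_zero]
  | add p q hp hq => rw [smul_add, map_add, map_add, hp, hq, smul_add]
  | single y g => rw [Finsupp.smul_single, evalSum_single, evalSum_single, smul_eq_mul, map_mul,
      mul_smul]

end EvalSum

section Bar

variable {W : Type*} [Group W] {H : Type*} [Ring H]

/-- The image `(T_{y⁻¹})⁻¹` of the standard basis element `T_y` under the bar involution. -/
def barBasis (τ : W → H) (y : W) : H := Ring.inverse (τ y⁻¹)

variable {S T : Set W} {l : W → ℕ} {A : Type*} [CommRing A] [Algebra A H] {q a : A} {τ : W → H}

namespace IsHeckeFamily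

variable (hτ : IsHeckeFamily S l q τ) (h : IsLengthFn S T l)
include hτ

theorem isUnit_simple (haq : a * q = 1) {s : W} (hs : s ∈ S) : IsUnit (τ s) := by
  have hcomm : Commute (τ s) (τ s - (q - 1) • 1) :=
    (Commute.refl _).sub_right ((Commute.one_right _).smul_right _)
  have hmul : τ s * (τ s - (q - 1) • 1) = q • 1 := by
    rw [mul_sub, hτ.simple_mul_simple hs, mul_smul_comm, mul_one, add_sub_cancel_left]
  refine (hcomm.isUnit_mul_iff.1 ?_).1
  rw [hmul, ← Algebra.algebraMap_eq_smul_one]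
  exact (IsUnit.of_mul_eq_one_right a haq).map _

include h

theorem mul_inv_of_length_eq_zero {w : W} (hw : l w = 0) : τ w * τ w⁻¹ = 1 := by
  rw [hτ.mul _ _ (by rw [mul_inv_cancel, h.one, h.inv, hw]), mul_inv_cancel, hτ.one]

theorem inv_mul_of_length_eq_zero {w : W} (hw : l w = 0) : τ w⁻¹ * τ w = 1 := by
  simpa only [inv_inv] using hτ.mul_inv_of_length_eq_zero h (w := w⁻¹) (by rw [h.inv, hw])

theorem barBasis_of_length_eq_zero {w : W} (hw : l w = 0) : barBasis τ w = τ w :=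
  Ring.inverse_unit ⟨τ w⁻¹, τ w, hτ.inv_mul_of_length_eq_zero h hw,
    hτ.mul_inv_of_length_eq_zero h hw⟩

variable (haq : a * q = 1)
include haq

theorem isUnit (w : W) : IsUnit (τ w) := by
  induction hn : l w using Nat.strong_induction_on generalizing w with
  | _ n ih =>
    obtain hw | hw := eq_or_ne (l w) 0
    · exact (⟨τ w, τ w⁻¹, hτ.mul_inv_of_length_eq_zero h hw,
        hτ.inv_mul_of_length_eq_zero h hw⟩ : Hˣ).isUnit
    · obtain ⟨s, hs, hlt⟩ := h.exists_mul_simple_lt w hw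
      rw [← h.mul_simple_cancel hs w,
        ← hτ.mul_simple_of_lt h hs (by rwa [h.mul_simple_cancel hs])]
      exact (ih _ (hn ▸ hlt) _ rfl).mul (hτ.isUnit_simple haq hs)

theorem barBasis_mul_simple_of_gt {s : W} (hs : s ∈ S) {y : W} (hy : l (y * s) < l y) :
    barBasis τ y * τ s = barBasis τ (y * s) := by
  have hlt : l (y * s)⁻¹ < l (s * (y * s)⁻¹) := by
    rwa [mul_inv_rev, h.simple_inv hs, h.simple_mul_cancel hs, ← h.length_mul_simple hs, h.inv]
  have hred : τ s * τ (y * s)⁻¹ = τ y⁻¹ := by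
    rw [hτ.simple_mul_of_lt h hs hlt, mul_inv_rev, h.simple_inv hs, h.simple_mul_cancel hs]
  calc barBasis τ y * τ s
      = barBasis τ y * (τ s * τ (y * s)⁻¹) * barBasis τ (y * s) := by
        rw [mul_assoc, mul_assoc, barBasis, barBasis,
          Ring.mul_inverse_cancel _ (hτ.isUnit h haq _), mul_one]
    _ = barBasis τ (y * s) := by
        rw [hred, barBasis, Ring.inverse_mul_cancel _ (hτ.isUnit h haq _), one_mul]

theorem barBasis_mul_simple_of_lt {s : W} (hs : s ∈ S) {y : W} (hy : l y < l (y * s)) :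
    barBasis τ y * τ s = (q - 1) • barBasis τ y + q • barBasis τ (y * s) := by
  have hbar : barBasis τ (y * s) * τ s = barBasis τ y := by
    simpa only [h.mul_simple_cancel hs] using
      hτ.barBasis_mul_simple_of_gt h haq hs (y := y * s) (by rwa [h.mul_simple_cancel hs])
  rw [← hbar, mul_assoc, hτ.simple_mul_simple hs, mul_add, mul_smul_comm, mul_smul_comm, mul_one]

theorem barBasis_mul_simple_eq {s : W} (hs : s ∈ S) {y : W} (hy : l y < l (y * s)) :
    barBasis τ (y * s) = a • (barBasis τ y * τ s - (q - 1) • barBasis τ y) := by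
  rw [hτ.barBasis_mul_simple_of_lt h haq hs hy, add_sub_cancel_left, smul_smul, haq, one_smul]

omit haq in
theorem evalSum_rightOp {s : W} (hs : s ∈ S) (p : W →₀ ℤ[X]) :
    evalSum q τ (rightOp l Polynomial.X s p) = evalSum q τ p * τ s := by
  induction p using Finsupp.induction_linear with
  | zero => simp only [map_zero, zero_mul]
  | add p r hp hr => rw [map_add, map_add, hp, hr, map_add, add_mul]
  | single y f =>
    rw [← Finsupp.smul_single_one, map_smul, evalSum_smul, evalSum_smul, smul_mul_assoc,
      evalSum_single, map_one, one_smul]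
    congr 1
    rcases h.mul_simple_lt_or_gt hs y with hy | hy
    · rw [rightOp_of_lt _ hy, hτ.mul_simple_of_lt h hs hy, evalSum_single, map_one, one_smul]
    · rw [rightOp_of_not_lt _ hy.not_gt, hτ.mul_simple_of_gt h hs hy, map_add, evalSum_smul,
        evalSum_smul, evalSum_single, evalSum_single, map_sub, map_one, Polynomial.aeval_X,
        one_smul, one_smul, add_comm]

theorem smul_evalSum_barBasis_rightOp {s : W} (hs : s ∈ S) (p : W →₀ ℤ[X]) :
    q • evalSum a (barBasis τ) (rightOp l Polynomial.X s p) =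
      evalSum a (barBasis τ) p * τ s - (q - 1) • evalSum a (barBasis τ) p := by
  induction p using Finsupp.induction_linear with
  | zero => simp only [map_zero, zero_mul, smul_zero, sub_zero]
  | add p r hp hr => rw [map_add, map_add, smul_add, hp, hr, map_add, add_mul]; module
  | single y f =>
    rw [← Finsupp.smul_single_one, map_smul, evalSum_smul, evalSum_smul, smul_mul_assoc,
      smul_comm q, smul_comm (q - 1), ← smul_sub, evalSum_single, map_one, one_smul]
    congr 1
    rcases h.mul_simple_lt_or_gt hs y with hy | hy
    · rw [rightOp_of_lt _ hy, hτ.barBasis_mul_simple_of_lt h haq hs hy, evalSum_single, map_one,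
        one_smul, add_sub_cancel_left]
    · rw [rightOp_of_not_lt _ hy.not_gt, hτ.barBasis_mul_simple_of_gt h haq hs hy, map_add,
        evalSum_smul, evalSum_smul, evalSum_single, evalSum_single, map_sub, map_one,
        Polynomial.aeval_X, one_smul, one_smul, smul_add, smul_smul, smul_smul, mul_sub, mul_comm q,
        haq]
      module

end IsHeckeFamily

namespace IsHeckeBasis

variable (hτ : IsHeckeBasis S l q τ) (h : IsLengthFn S T l) (haq : a * q = 1)
include hτ

theorem repr_evalSum (p : W →₀ ℤ[X]) (y : W) :
    hτ.basis.repr (evalSum a τ p) y = Polynomial.aeval a (p y) := by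
  have hρ : evalSum a τ p = evalSum a hτ.basis p := by
    rw [show ⇑hτ.basis = τ from funext hτ.basis_apply]
  rw [hρ]
  exact DFunLike.congr_fun (hτ.basis.repr_linearCombination _) y

include h haq

theorem repr_barBasis {z y : W} (hzy : l z ≤ l y) :
    hτ.basis.repr (barBasis τ z) y = Finsupp.single z (a ^ l z) y := by
  induction hn : l z using Nat.strong_induction_on generalizing z y with
  | _ n ih =>
    subst hn
    obtain hz | hz := eq_or_ne (l z) 0
    · rw [hτ.barBasis_of_length_eq_zero h hz, hz, pow_zero, hτ.basis_repr]
    · obtain ⟨s, hs, hlt⟩ := h.exists_mul_simple_lt z hz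
      obtain ⟨x, rfl⟩ : ∃ x, z = x * s := ⟨z * s, (h.mul_simple_cancel hs z).symm⟩
      rw [h.mul_simple_cancel hs] at hlt
      have hx {y : W} (hy : l x ≤ l y) := ih _ hlt hy rfl
      have hlen := h.mul_simple_of_lt hs hlt
      have hxy : x ≠ y := by rintro rfl; lia
      rw [hτ.barBasis_mul_simple_eq h haq hs hlt, map_smul, map_sub, map_smul,
        hτ.repr_mul_simple h hs, Finsupp.smul_apply, Finsupp.sub_apply, Finsupp.smul_apply,
        hx (by lia), Finsupp.single_eq_of_ne hxy.symm, smul_zero, sub_zero]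
      rcases h.mul_simple_lt_or_gt hs y with hy | hy
      · have hne : x * s ≠ y := by rintro rfl; rw [h.mul_simple_cancel hs] at hy; lia
        have hne' : x ≠ y * s := by rintro rfl; lia
        rw [rightOp_apply_of_lt q h hs hy, hx (by lia), Finsupp.single_eq_of_ne hne.symm,
          Finsupp.single_eq_of_ne hne'.symm, mul_zero, smul_zero]
      · have hy' := h.mul_simple_of_gt hs hy
        rw [rightOp_apply_of_gt q h hs hy, hx (by lia), hx (by lia),
          Finsupp.single_eq_of_ne hxy.symm, mul_zero, add_zero, hlen, pow_succ']
        obtain ⟨y, rfl⟩ : ∃ z, y = z * s := ⟨y * s, (h.mul_simple_cancel hs y).symm⟩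
        rw [h.mul_simple_cancel hs, ← smul_eq_mul a (a ^ l x), ← Finsupp.smul_single,
          Finsupp.smul_apply, Finsupp.single_apply_left (mul_left_injective s) x y]

theorem repr_evalSum_barBasis {p : W →₀ ℤ[X]} {y : W} (hp : ∀ z, p z ≠ 0 → l z ≤ l y) :
    hτ.basis.repr (evalSum a (barBasis τ) p) y = Polynomial.aeval a (p y) * a ^ l y := by
  rw [evalSum_eq_sum, Finsupp.sum, map_sum, Finsupp.finsetSum_apply,
    Finset.sum_congr rfl fun z hz => by
      rw [map_smul, Finsupp.smul_apply,
        hτ.repr_barBasis h haq (hp z (Finsupp.mem_support_iff.1 hz))],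
    Finset.sum_eq_single y (fun z _ hzy => by rw [Finsupp.single_eq_of_ne hzy.symm, smul_zero])
      fun hy => by rw [Finsupp.notMem_support_iff.1 hy, map_zero, zero_smul],
    Finsupp.single_eq_same, smul_eq_mul]

end IsHeckeBasis

end Bar

section KazhdanLusztig

open scoped LaurentPolynomial

local notation "𝐯" => LaurentPolynomial.T (R := ℤ)

theorem coeff_T_mul_aeval_T (f : ℤ[X]) (m a i : ℤ) :
    (𝐯 m * Polynomial.aeval (𝐯 a) f).coeff i =
      ∑ j ∈ Finset.range (f.natDegree + 1), if m + a * j = i then f.coeff j else 0 := by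
  rw [Polynomial.aeval_eq_sum_range, Finset.mul_sum, AddMonoidAlgebra.coeff_sum,
    Finsupp.finsetSum_apply]
  refine Finset.sum_congr rfl fun j _ => ?_
  rw [LaurentPolynomial.T_pow, mul_smul_comm, ← LaurentPolynomial.T_add,
    AddMonoidAlgebra.coeff_smul, Finsupp.smul_apply, LaurentPolynomial.T_apply, smul_eq_mul,
    mul_ite, mul_one, mul_zero, mul_comm (j : ℤ)]

theorem eq_zero_of_T_mul_aeval_eq {f : ℤ[X]} {m n : ℤ}
    (hf : 𝐯 m * Polynomial.aeval (𝐯 2) f = 𝐯 n * Polynomial.aeval (𝐯 (-2)) f)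
    (hmn : 4 * (f.natDegree : ℤ) < n - m) : f = 0 := by
  refine Polynomial.leadingCoeff_eq_zero.1 ?_
  have hk := congrArg (fun g => g.coeff (m + 2 * f.natDegree)) hf
  simp only [coeff_T_mul_aeval_T] at hk
  rw [Finset.sum_eq_single_of_mem _ (Finset.self_mem_range_succ _) fun j _ hj => if_neg (by lia),
    if_pos rfl, Finset.sum_eq_zero fun j hj => if_neg ?_] at hk
  · exact hk
  · have := Finset.mem_range.1 hj
    lia

variable {W : Type*} [Group W] {S T : Set W} {l : W → ℕ}

section RightOp

theorem rightOp_add_self_apply_of_gt {A : Type*} [CommRing A] (q : A) (h : IsLengthFn S T l)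
    {s y : W} (hs : s ∈ S) (hy : l (y * s) < l y) (p : W →₀ A) :
    (rightOp l q s p + p) y = p (y * s) + q * p y := by
  rw [Finsupp.add_apply, rightOp_apply_of_gt q h hs hy]
  ring

theorem rightOp_add_self_apply_mul {A : Type*} [CommRing A] (q : A) (h : IsLengthFn S T l)
    {s : W} (hs : s ∈ S) (p : W →₀ A) (y : W) :
    (rightOp l q s p + p) (y * s) = (rightOp l q s p + p) y := by
  have hof {x : W} (hx : l x < l (x * s)) :
      (rightOp l q s p + p) (x * s) = (rightOp l q s p + p) x := by
    rw [rightOp_add_self_apply_of_gt q h hs (by rwa [h.mul_simple_cancel hs]),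
      h.mul_simple_cancel hs, Finsupp.add_apply, rightOp_apply_of_lt q h hs hx, add_comm]
  rcases h.mul_simple_lt_or_gt hs y with hy | hy
  · exact hof hy
  · simpa only [h.mul_simple_cancel hs] using
      (hof (x := y * s) (by rwa [h.mul_simple_cancel hs])).symm

end RightOp

variable {H : Type*} [Ring H] [Algebra ℤ[T;T⁻¹] H] {τ : W → H}

/-- The families `p` of polynomials for which `v⁻ⁿ ∑_y p_y(v²) T_y` is invariant under the bar
involution of the generic Hecke algebra. -/
def barInvariants (τ : W → H) (n : ℤ) : AddSubgroup (W →₀ ℤ[X]) :=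
  ((DistribSMul.toAddMonoidHom H (𝐯 (-n))).comp (evalSum (𝐯 2) τ)).eqLocus
    ((DistribSMul.toAddMonoidHom H (𝐯 n)).comp (evalSum (𝐯 (-2)) (barBasis τ)))

theorem mem_barInvariants_iff {n : ℤ} {p : W →₀ ℤ[X]} : p ∈ barInvariants τ n ↔
    𝐯 (-n) • evalSum (𝐯 2) τ p = 𝐯 n • evalSum (𝐯 (-2)) (barBasis τ) p :=
  Iff.rfl

theorem X_pow_smul_mem_barInvariants {n : ℤ} {p : W →₀ ℤ[X]} (hp : p ∈ barInvariants τ n)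
    (e : ℕ) : (Polynomial.X ^ e : ℤ[X]) • p ∈ barInvariants τ (n + 2 * e) := by
  rw [mem_barInvariants_iff] at hp ⊢
  have hneg : -(n + 2 * (e : ℤ)) + e * 2 = -n := by ring
  have hpos : n + 2 * (e : ℤ) + e * -2 = n := by ring
  rw [evalSum_smul, evalSum_smul, smul_smul, smul_smul, Polynomial.aeval_X_pow,
    Polynomial.aeval_X_pow, LaurentPolynomial.T_pow, LaurentPolynomial.T_pow,
    ← LaurentPolynomial.T_add, ← LaurentPolynomial.T_add, hneg, hpos, hp]

theorem T_neg_two_mul_T_two : 𝐯 (-2) * 𝐯 2 = 1 := by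
  rw [← LaurentPolynomial.T_add, neg_add_cancel, LaurentPolynomial.T_zero]

theorem rightOp_add_self_mem_barInvariants (hτ : IsHeckeFamily S l (𝐯 2) τ)
    (h : IsLengthFn S T l) {s : W} (hs : s ∈ S) {n : ℤ} {p : W →₀ ℤ[X]}
    (hp : p ∈ barInvariants τ n) :
    rightOp l Polynomial.X s p + p ∈ barInvariants τ (n + 1) := by
  rw [mem_barInvariants_iff] at hp ⊢
  calc 𝐯 (-(n + 1)) • evalSum (𝐯 2) τ (rightOp l Polynomial.X s p + p)
      = 𝐯 (-1) • ((𝐯 (-n) • evalSum (𝐯 2) τ p) * (τ s + 1)) := by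
        rw [map_add, hτ.evalSum_rightOp h hs, smul_mul_assoc, smul_smul,
          ← LaurentPolynomial.T_add, mul_add, mul_one, neg_add_rev]
    _ = 𝐯 (n - 1) • (evalSum (𝐯 (-2)) (barBasis τ) p * (τ s + 1)) := by
        rw [hp, smul_mul_assoc, smul_smul, ← LaurentPolynomial.T_add, neg_add_eq_sub]
    _ = 𝐯 (n - 1) • (𝐯 2 • evalSum (𝐯 (-2)) (barBasis τ) (rightOp l Polynomial.X s p) +
          𝐯 2 • evalSum (𝐯 (-2)) (barBasis τ) p) := by
        rw [hτ.smul_evalSum_barBasis_rightOp h T_neg_two_mul_T_two hs, mul_add, mul_one]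
        module
    _ = 𝐯 (n + 1) • evalSum (𝐯 (-2)) (barBasis τ) (rightOp l Polynomial.X s p + p) := by
        rw [← smul_add, smul_smul, ← LaurentPolynomial.T_add, map_add, sub_add,
          show (1 - 2 : ℤ) = -1 from rfl, sub_neg_eq_add]

theorem eq_zero_of_mem_barInvariants (hτ : IsHeckeBasis S l (𝐯 2) τ) (h : IsLengthFn S T l)
    {n : ℕ} {p : W →₀ ℤ[X]} (hp : p ∈ barInvariants τ n)
    (hdeg : ∀ y, p y ≠ 0 → 2 * (p y).natDegree + l y < n) : p = 0 := by
  by_contra hne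
  obtain ⟨y, hy, hmax⟩ := p.support.exists_max_image l (Finsupp.support_nonempty_iff.2 hne)
  rw [Finsupp.mem_support_iff] at hy
  have hcoeff := congrArg (fun x => hτ.basis.repr x y) hp
  simp only [AddMonoidHom.comp_apply, DistribSMul.toAddMonoidHom_apply, map_smul,
    Finsupp.smul_apply, smul_eq_mul] at hcoeff
  rw [hτ.repr_evalSum, hτ.repr_evalSum_barBasis h T_neg_two_mul_T_two
    fun z hz => hmax z (Finsupp.mem_support_iff.2 hz), mul_left_comm, mul_comm,
    LaurentPolynomial.T_pow, ← LaurentPolynomial.T_add, mul_comm, mul_comm (Polynomial.aeval _ _)]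
    at hcoeff
  refine hy (eq_zero_of_T_mul_aeval_eq hcoeff ?_)
  have := hdeg y hy
  lia

/-- `p` is the family of Kazhdan–Lusztig polynomials `P_{y,w}`, formulated for the generic Hecke
algebra of an arbitrary length function, presented by its standard basis `τ`. -/
structure IsAbstractKL (T : Set W) (l : W → ℕ) (τ : W → H) (w : W) (p : W →₀ ℤ[X]) : Prop where
  le_of_ne_zero : ∀ y, p y ≠ 0 → AbstractBruhatLE T l y w
  self : p w = 1
  degree : ∀ y, AbstractBruhatLE T l y w → y ≠ w → 2 * (p y).natDegree + 1 + l y ≤ l w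
  bar : p ∈ barInvariants τ (l w)

namespace IsAbstractKL

theorem coeff_eq_zero {w y : W} {p : W →₀ ℤ[X]} (hp : IsAbstractKL T l τ w p) (hyw : y ≠ w)
    {j : ℕ} (hj : l w ≤ 2 * j + l y) : (p y).coeff j = 0 := by
  obtain hy | hy := eq_or_ne (p y) 0
  · rw [hy, Polynomial.coeff_zero]
  · have := hp.degree y (hp.le_of_ne_zero y hy) hyw
    exact Polynomial.coeff_eq_zero_of_natDegree_lt (by lia)

theorem unique (hτ : IsHeckeBasis S l (𝐯 2) τ) (h : IsLengthFn S T l) {w : W}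
    {p p' : W →₀ ℤ[X]} (hp : IsAbstractKL T l τ w p) (hp' : IsAbstractKL T l τ w p') :
    p = p' := by
  refine sub_eq_zero.1 (eq_zero_of_mem_barInvariants hτ h (sub_mem hp.bar hp'.bar) fun y hy => ?_)
  have hyw : y ≠ w := by
    rintro rfl
    exact hy (by rw [Finsupp.sub_apply, hp.self, hp'.self, sub_self])
  by_contra! hdeg
  apply Polynomial.leadingCoeff_ne_zero.2 hy
  rw [Polynomial.leadingCoeff]
  nth_rewrite 1 [Finsupp.sub_apply]
  rw [Polynomial.coeff_sub, hp.coeff_eq_zero hyw hdeg, hp'.coeff_eq_zero hyw hdeg, sub_self]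

end IsAbstractKL

theorem isAbstractKL_single_of_length_eq_zero (hτ : IsHeckeFamily S l (𝐯 2) τ)
    (h : IsLengthFn S T l) {w : W} (hw : l w = 0) :
    IsAbstractKL T l τ w (Finsupp.single w 1) where
  le_of_ne_zero y hy := by
    obtain rfl : y = w := by
      by_contra hyw
      exact hy (Finsupp.single_eq_of_ne hyw)
    exact .refl
  self := Finsupp.single_eq_same
  degree y hy hne := absurd (hy.length_lt hne) (by lia)
  bar := by
    rw [mem_barInvariants_iff, evalSum_single, evalSum_single, map_one, map_one,
      hτ.barBasis_of_length_eq_zero h hw, hw, Nat.cast_zero, neg_zero]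

section Step

/-- The elements `z` with `zs < z` that contribute to the Kazhdan–Lusztig recursion for `us`, given
the polynomials `p y = P_{y,u}`. -/
def muSupport (l : W → ℕ) (p : W →₀ ℤ[X]) (u s : W) : Finset W :=
  p.support.filter fun z => l (z * s) < l z ∧ Odd (l u - l z)

/-- The correction term `∑_z μ(z,u) q^{(l(u)-l(z)+1)/2} P_{·,z}` of the Kazhdan–Lusztig recursion;
for `z` in `muSupport`, `(l(u)-l(z)-1)/2` equals the truncated quotient `(l(u)-l(z))/2`. -/
def kLCorrection (l : W → ℕ) (K : W → W →₀ ℤ[X]) (u s : W) : W →₀ ℤ[X] :=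
  ∑ z ∈ muSupport l (K u) u s, (K u z).coeff ((l u - l z) / 2) •
    (Polynomial.X ^ ((l u - l z) / 2 + 1) : ℤ[X]) • K z

/-- The Kazhdan–Lusztig recursion, which computes the polynomials for `us > u` from those for `u`
and the shorter elements. -/
def kLStep (l : W → ℕ) (K : W → W →₀ ℤ[X]) (u s : W) : W →₀ ℤ[X] :=
  rightOp l Polynomial.X s (K u) + K u - kLCorrection l K u s

variable {K : W → W →₀ ℤ[X]} {u s : W}

theorem length_eq_of_mem_muSupport (hKu : IsAbstractKL T l τ u (K u)) (hus : l u < l (u * s))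
    {z : W} (hz : z ∈ muSupport l (K u) u s) :
    AbstractBruhatLE T l z u ∧ l u = l z + 2 * ((l u - l z) / 2) + 1 := by
  obtain ⟨hzu, hzs, hodd⟩ := Finset.mem_filter.1 hz
  have hle := hKu.le_of_ne_zero z (Finsupp.mem_support_iff.1 hzu)
  have hlt := hle.length_lt (by rintro rfl; lia)
  exact ⟨hle, by grind⟩

variable (hK : ∀ z, l z ≤ l u → IsAbstractKL T l τ z (K z)) (hus : l u < l (u * s))
include hK hus

theorem coeff_X_pow_mul_eq_zero_of_mem_muSupport {y z : W} (hz : z ∈ muSupport l (K u) u s)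
    (hyz : y ≠ z) {j : ℕ} (hj : l u + 1 ≤ 2 * j + l y) :
    (Polynomial.X ^ ((l u - l z) / 2 + 1) * K z y).coeff j = 0 := by
  obtain ⟨-, hlen⟩ := length_eq_of_mem_muSupport (hK u le_rfl) hus hz
  rw [Polynomial.coeff_X_pow_mul']
  split_ifs with hle
  · exact (hK z (by lia)).coeff_eq_zero hyz (by lia)
  · rfl

open Classical in
theorem coeff_kLCorrection (y : W) {j : ℕ} (hj : l u + 1 ≤ 2 * j + l y) :
    (kLCorrection l K u s y).coeff j = if y ∈ muSupport l (K u) u s ∧ j = (l u - l y) / 2 + 1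
      then (K u y).coeff ((l u - l y) / 2) else 0 := by
  have hsum : (kLCorrection l K u s y).coeff j = ∑ z ∈ muSupport l (K u) u s,
      (K u z).coeff ((l u - l z) / 2) *
        (Polynomial.X ^ ((l u - l z) / 2 + 1) * K z y).coeff j := by
    simp only [kLCorrection, Finsupp.finsetSum_apply, Polynomial.finsetSum_coeff,
      Finsupp.smul_apply, Polynomial.coeff_smul, smul_eq_mul]
  have hne : ∀ z ∈ muSupport l (K u) u s, z ≠ y → (K u z).coeff ((l u - l z) / 2) *
      (Polynomial.X ^ ((l u - l z) / 2 + 1) * K z y).coeff j = 0 := fun z hz hzy => by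
    rw [coeff_X_pow_mul_eq_zero_of_mem_muSupport hK hus hz hzy.symm hj, mul_zero]
  rw [hsum]
  by_cases hy : y ∈ muSupport l (K u) u s
  · have hlen := (length_eq_of_mem_muSupport (hK u le_rfl) hus hy).2
    rw [Finset.sum_eq_single_of_mem y hy hne, (hK y (by lia)).self, mul_one,
      Polynomial.coeff_X_pow, mul_ite, mul_one, mul_zero]
    simp only [hy, true_and]
  · rw [if_neg (mt And.left hy), Finset.sum_eq_zero fun z hz => hne z hz ?_]
    rintro rfl
    exact hy hz

theorem coeff_kLCorrection_eq_coeff_X_mul {y : W} (hy : l (y * s) < l y) {j : ℕ}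
    (hj : l u + 1 ≤ 2 * j + l y) :
    (kLCorrection l K u s y).coeff j = (Polynomial.X * K u y).coeff j := by
  rw [coeff_kLCorrection hK hus y hj]
  obtain hKy | hKy := eq_or_ne (K u y) 0
  · simp only [hKy, mul_zero, Polynomial.coeff_zero, ite_self]
  have hyu : y ≠ u := by rintro rfl; lia
  have hlt := ((hK u le_rfl).le_of_ne_zero y hKy).length_lt hyu
  obtain ⟨i, rfl⟩ : ∃ i, j = i + 1 := ⟨j - 1, by lia⟩
  rw [Polynomial.coeff_X_mul]
  obtain hi | hi := (show l u ≤ 2 * i + 1 + l y by lia).eq_or_lt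
  · obtain rfl : i = (l u - l y) / 2 := by lia
    exact if_pos ⟨Finset.mem_filter.2 ⟨Finsupp.mem_support_iff.2 hKy, hy, by grind⟩, rfl⟩
  · rw [(hK u le_rfl).coeff_eq_zero (j := i) hyu (by lia), if_neg]
    rintro ⟨hmem, hd⟩
    have := (length_eq_of_mem_muSupport (hK u le_rfl) hus hmem).2
    lia

theorem coeff_kLStep_eq_zero (h : IsLengthFn S T l) (hs : s ∈ S) {y : W}
    (hy : l (y * s) < l y) (hne : y ≠ u * s) {j : ℕ} (hj : l u + 1 ≤ 2 * j + l y) :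
    (kLStep l K u s y).coeff j = 0 := by
  have hysu : y * s ≠ u := by
    rintro rfl
    exact hne (h.mul_simple_cancel hs y).symm
  have := h.mul_simple_of_gt hs hy
  rw [kLStep, Finsupp.sub_apply, Polynomial.coeff_sub, rightOp_add_self_apply_of_gt _ h hs hy,
    Polynomial.coeff_add, (hK u le_rfl).coeff_eq_zero hysu (by lia),
    coeff_kLCorrection_eq_coeff_X_mul hK hus hy hj, zero_add, sub_self]

theorem le_of_kLCorrection_ne_zero {y : W} (hy : kLCorrection l K u s y ≠ 0) :
    AbstractBruhatLE T l y u := by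
  rw [kLCorrection, Finsupp.finsetSum_apply] at hy
  obtain ⟨z, hz, hzy⟩ := Finset.exists_ne_zero_of_sum_ne_zero hy
  obtain ⟨hzu, hlen⟩ := length_eq_of_mem_muSupport (hK u le_rfl) hus hz
  rw [Finsupp.smul_apply, Finsupp.smul_apply] at hzy
  exact ((hK z (by lia)).le_of_ne_zero y
    (right_ne_zero_of_smul (right_ne_zero_of_smul hzy))).trans hzu

theorem kLStep_self (h : IsLengthFn S T l) (hs : s ∈ S) : kLStep l K u s (u * s) = 1 := by
  have hnle : ¬ AbstractBruhatLE T l (u * s) u := fun hle => by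
    rcases hle.eq_or_length_lt with heq | hlt
    · rw [heq] at hus
      lia
    · lia
  rw [kLStep, Finsupp.sub_apply, rightOp_add_self_apply_of_gt _ h hs
    (by rwa [h.mul_simple_cancel hs]), h.mul_simple_cancel hs, (hK u le_rfl).self,
    not_not.1 fun hne => hnle ((hK u le_rfl).le_of_ne_zero _ hne),
    not_not.1 fun hne => hnle (le_of_kLCorrection_ne_zero hK hus hne), mul_zero, add_zero, sub_zero]

theorem le_of_kLStep_ne_zero (h : IsLengthFn S T l) (hs : s ∈ S) {y : W}
    (hy : kLStep l K u s y ≠ 0) : AbstractBruhatLE T l y (u * s) := by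
  have hKu := hK u le_rfl
  have hu := AbstractBruhatLE.self_mul_simple h hs hus
  contrapose! hy
  have hzero : K u y = 0 := not_not.1 fun hne => hy ((hKu.le_of_ne_zero y hne).trans hu)
  have hzero' : K u (y * s) = 0 := not_not.1 fun hne => hy <| by
    simpa only [h.mul_simple_cancel hs] using (hKu.le_of_ne_zero _ hne).mul_simple h hs hus
  have hcorr : kLCorrection l K u s y = 0 :=
    not_not.1 fun hne => hy ((le_of_kLCorrection_ne_zero hK hus hne).trans hu)
  rw [kLStep, Finsupp.sub_apply, hcorr, sub_zero, Finsupp.add_apply, hzero, add_zero]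
  rcases h.mul_simple_lt_or_gt hs y with hlt | hgt
  · rw [rightOp_apply_of_lt _ h hs hlt, hzero', mul_zero]
  · rw [rightOp_apply_of_gt _ h hs hgt, hzero, hzero', mul_zero, add_zero]

theorem kLStep_mem_barInvariants (hτ : IsHeckeFamily S l (𝐯 2) τ) (h : IsLengthFn S T l)
    (hs : s ∈ S) : kLStep l K u s ∈ barInvariants τ (l (u * s)) := by
  rw [h.mul_simple_of_lt hs hus, Nat.cast_succ]
  refine sub_mem (rightOp_add_self_mem_barInvariants hτ h hs (hK u le_rfl).bar)
    (sum_mem fun z hz => zsmul_mem ?_ _)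
  have hlen := (length_eq_of_mem_muSupport (hK u le_rfl) hus hz).2
  convert X_pow_smul_mem_barInvariants (hK z (by lia)).bar ((l u - l z) / 2 + 1) using 2
  lia

variable (hKs : ∀ z, l z ≤ l u → l (z * s) < l z → ∀ y, K z (y * s) = K z y)
include hKs

theorem kLStep_apply_mul_simple (h : IsLengthFn S T l) (hs : s ∈ S) (y : W) :
    kLStep l K u s (y * s) = kLStep l K u s y := by
  rw [kLStep, Finsupp.sub_apply, Finsupp.sub_apply, rightOp_add_self_apply_mul _ h hs,
    kLCorrection, Finsupp.finsetSum_apply, Finsupp.finsetSum_apply]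
  refine congrArg _ (Finset.sum_congr rfl fun z hz => ?_)
  have hlen := (length_eq_of_mem_muSupport (hK u le_rfl) hus hz).2
  simp only [Finsupp.smul_apply, hKs z (by lia) (Finset.mem_filter.1 hz).2.1]

theorem isAbstractKL_kLStep (hτ : IsHeckeFamily S l (𝐯 2) τ) (h : IsLengthFn S T l)
    (hs : s ∈ S) : IsAbstractKL T l τ (u * s) (kLStep l K u s) where
  le_of_ne_zero _ := le_of_kLStep_ne_zero hK hus h hs
  self := kLStep_self hK hus h hs
  bar := kLStep_mem_barInvariants hK hus hτ h hs
  degree y hy hne := by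
    have hlen := h.mul_simple_of_lt hs hus
    have hlt := hy.length_lt hne
    have hdeg {z : W} (hz : l (z * s) < l z) (hzne : z ≠ u * s) (hzero : kLStep l K u s z ≠ 0) :
        2 * (kLStep l K u s z).natDegree + 1 + l z ≤ l (u * s) := by
      by_contra! hcon
      exact Polynomial.leadingCoeff_ne_zero.2 hzero
        (coeff_kLStep_eq_zero hK hus h hs hz hzne (by lia))
    obtain hzero | hzero := eq_or_ne (kLStep l K u s y) 0
    · rw [hzero, Polynomial.natDegree_zero]
      lia
    rcases h.mul_simple_lt_or_gt hs y with hys | hys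
    · rw [← kLStep_apply_mul_simple hK hus hKs h hs] at hzero ⊢
      by_cases heq : y * s = u * s
      · rw [heq, kLStep_self hK hus h hs, Polynomial.natDegree_one]
        lia
      · have hpar := hdeg (z := y * s) (by rwa [h.mul_simple_cancel hs]) heq hzero
        lia
    · exact hdeg hys hne hzero

end Step

theorem exists_isAbstractKL (hτ : IsHeckeBasis S l (𝐯 2) τ) (h : IsLengthFn S T l) (w : W) :
    ∃ p, IsAbstractKL T l τ w p ∧ ∀ s ∈ S, l (w * s) < l w → ∀ y, p (y * s) = p y := by
  induction hn : l w using Nat.strong_induction_on generalizing w with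
  | _ n ih =>
    subst hn
    have hex (z : W) : ∃ p, l z < l w → IsAbstractKL T l τ z p ∧
        ∀ s ∈ S, l (z * s) < l z → ∀ y, p (y * s) = p y := by
      by_cases hz : l z < l w
      · exact (ih _ hz z rfl).imp fun p hp _ => hp
      · exact ⟨0, fun hlt => absurd hlt hz⟩
    choose K hK using hex
    have hstep {s : W} (hs : s ∈ S) (hws : l (w * s) < l w) :
        IsAbstractKL T l τ w (kLStep l K (w * s) s) ∧
          ∀ y, kLStep l K (w * s) s (y * s) = kLStep l K (w * s) s y := by
      have hus : l (w * s) < l (w * s * s) := by rwa [h.mul_simple_cancel hs]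
      have hKL (z : W) (hz : l z ≤ l (w * s)) := (hK z (hz.trans_lt hws)).1
      have hKs (z : W) (hz : l z ≤ l (w * s)) := (hK z (hz.trans_lt hws)).2 s hs
      refine ⟨?_, kLStep_apply_mul_simple hKL hus hKs h hs⟩
      simpa only [h.mul_simple_cancel hs] using
        isAbstractKL_kLStep hKL hus hKs hτ.toIsHeckeFamily h hs
    obtain hw | hw := eq_or_ne (l w) 0
    · exact ⟨_, isAbstractKL_single_of_length_eq_zero hτ.toIsHeckeFamily h hw,
        fun s _ hws => by lia⟩
    · obtain ⟨s, hs, hws⟩ := h.exists_mul_simple_lt w hw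
      obtain ⟨hKL, -⟩ := hstep hs hws
      refine ⟨_, hKL, fun t ht hwt => ?_⟩
      obtain ⟨hKL', hinv⟩ := hstep ht hwt
      rwa [hKL.unique hτ h hKL']

end KazhdanLusztig

section OppositeBasis

open MulOpposite

variable {W : Type*} [Group W] {S T : Set W} {l : W → ℕ} {A : Type*} [CommRing A]
  {H : Type*} [Ring H] [Algebra A H] {q : A} {τ : W → H}

namespace IsHeckeBasis

variable (hτ : IsHeckeBasis S l q τ)
include hτ

theorem mem_span_image {X : Set W} {x : H} :
    x ∈ Submodule.span A (τ '' X) ↔ ∀ w, hτ.basis.repr x w ≠ 0 → w ∈ X := by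
  rw [← Set.image_congr' hτ.basis_apply, hτ.basis.mem_span_image]
  simp only [Set.subset_def, Finset.mem_coe, Finsupp.mem_support_iff]

theorem coe_basis_op_inv :
    ⇑((hτ.basis.map (opLinearEquiv A)).reindex (Equiv.inv W)) = fun w => op (τ w⁻¹) := by
  ext w
  simp

variable (h : IsLengthFn S T l)
include h

/-- `T_w ↦ T_{w⁻¹}` is an anti-involution; it turns statements about right multiplication into
statements about left multiplication. -/
theorem op_inv : IsHeckeBasis S l q fun w => op (τ w⁻¹) where
  one := by rw [inv_one, hτ.one, op_one]
  mul x y hxy := by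
    rw [← op_mul, hτ.mul _ _ (by rw [← mul_inv_rev, h.inv, h.inv, h.inv, hxy, add_comm]),
      mul_inv_rev]
  quad s hs := by
    have hcomm : (τ s + 1) * (τ s - algebraMap A H q) = 0 := by
      rw [← hτ.quad s hs, add_mul, sub_mul, mul_add, mul_sub, ← Algebra.commutes]
      noncomm_ring
    rw [h.simple_inv hs, MulOpposite.algebraMap_apply, ← op_sub, ← op_one, ← op_add, ← op_mul,
      hcomm, op_zero]
  linearIndependent := hτ.coe_basis_op_inv ▸ Module.Basis.linearIndependent _
  span := (hτ.coe_basis_op_inv ▸ Module.Basis.span_eq _).ge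

theorem repr_op_inv (x : H) (w : W) :
    (hτ.op_inv h).basis.repr (op x) w = hτ.basis.repr x w⁻¹ := by
  have hbasis : (hτ.op_inv h).basis =
      (hτ.basis.map (opLinearEquiv A)).reindex (Equiv.inv W) :=
    Module.Basis.eq_of_apply_eq fun w => by rw [basis_apply, coe_basis_op_inv]
  rw [hbasis, Module.Basis.repr_reindex_apply, Module.Basis.map_repr]
  simp

end IsHeckeBasis

end OppositeBasis

section Ideals

variable {W : Type*} [Group W] {S T S₀ : Set W} {l : W → ℕ} {k : Type*} [Field k]
  {H : Type*} [Ring H] [Algebra k H] {q r r' : k} {τ : W → H}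

/-- A family `D` of elements of a Hecke algebra that is triangular with respect to the standard
basis, with nonzero diagonal. -/
structure IsTriangularFamily (hτ : IsHeckeBasis S l q τ) (D : W → H) : Prop where
  self_ne_zero : ∀ w, hτ.basis.repr (D w) w ≠ 0
  eq_or_lt : ∀ w y, hτ.basis.repr (D w) y ≠ 0 → y = w ∨ l y < l w

/-- A triangular family `D` such that the coefficients of `D w` are multiplied by `r` along
`y < y s` whenever `w s < w`. If `r = 1` or `q r = -1`, this says that `D w T_s = q r D w`; the
Kazhdan–Lusztig basis `C` has `r = 1`, and `C'` has `r = -q⁻¹`. -/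
structure IsSymmetricFamily (hτ : IsHeckeBasis S l q τ) (r : k) (D : W → H) : Prop
    extends IsTriangularFamily hτ D where
  mul_simple : ∀ w, ∀ s ∈ S, l (w * s) < l w → ∀ y, l y < l (y * s) →
    hτ.basis.repr (D w) (y * s) = r * hτ.basis.repr (D w) y

/-- The left ideal of the elements `x` with `x T_s = q r x`. -/
def eigenIdeal (q : k) (τ : W → H) (r : k) (s : W) : Submodule H H :=
  LinearMap.ker (LinearMap.toSpanSingleton H H (τ s - (q * r) • 1))

omit [Group W] in
theorem mem_eigenIdeal {s : W} {x : H} : x ∈ eigenIdeal q τ r s ↔ x * τ s = (q * r) • x := by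
  rw [eigenIdeal, LinearMap.mem_ker, LinearMap.toSpanSingleton_apply, smul_eq_mul, mul_sub,
    mul_smul_comm, mul_one, sub_eq_zero]

theorem IsTriangularFamily.exists_mem_span_layer {hτ : IsHeckeBasis S l q τ} {D : W → H}
    (hD : IsTriangularFamily hτ D) {n : ℕ} {x : H} (hx : ∀ z, hτ.basis.repr x z ≠ 0 → l z ≤ n) :
    ∃ y ∈ Submodule.span k (D '' {w | hτ.basis.repr x w ≠ 0 ∧ l w = n}),
      ∀ z, hτ.basis.repr (x - y) z ≠ 0 → l z < n := by
  classical
  let F := (hτ.basis.repr x).support.filter fun w => l w = n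
  have hF {w : W} : w ∈ F ↔ hτ.basis.repr x w ≠ 0 ∧ l w = n := by
    rw [Finset.mem_filter, Finsupp.mem_support_iff]
  let y (w : W) : H := (hτ.basis.repr x w / hτ.basis.repr (D w) w) • D w
  refine ⟨∑ w ∈ F, y w, Submodule.sum_mem _ fun w hw => Submodule.smul_mem _ _
    (Submodule.subset_span ⟨w, hF.1 hw, rfl⟩), fun z => ?_⟩
  contrapose!
  intro hz
  have hoff (w : W) (hw : w ∈ F) (hwz : w ≠ z) : hτ.basis.repr (y w) z = 0 := by
    have hDz : hτ.basis.repr (D w) z = 0 := by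
      by_contra hne
      rcases hD.eq_or_lt w z hne with rfl | hlt
      · exact hwz rfl
      · exact absurd (hlt.trans_eq (hF.1 hw).2) hz.not_gt
    rw [map_smul, Finsupp.smul_apply, hDz, smul_zero]
  rw [map_sub, Finsupp.sub_apply, map_sum, Finsupp.finsetSum_apply, sub_eq_zero]
  by_cases hzF : z ∈ F
  · rw [Finset.sum_eq_single_of_mem z hzF hoff, map_smul, Finsupp.smul_apply, smul_eq_mul,
      div_mul_cancel₀ _ (hD.self_ne_zero z)]
  · rw [Finset.sum_eq_zero fun w hw => hoff w hw (ne_of_mem_of_not_mem hw hzF)]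
    by_contra hne
    exact hzF (hF.2 ⟨hne, (hx z hne).antisymm hz⟩)

theorem IsTriangularFamily.le_span {hτ : IsHeckeBasis S l q τ} {D : W → H}
    (hD : IsTriangularFamily hτ D) {X : Set W} {E : Submodule k H} (hDE : ∀ w ∈ X, D w ∈ E)
    (hX : ∀ x ∈ E, ∀ w, hτ.basis.repr x w ≠ 0 →
      (∀ z, hτ.basis.repr x z ≠ 0 → l z ≤ l w) → w ∈ X) :
    E ≤ Submodule.span k (D '' X) := by
  have hbounded (n : ℕ) : ∀ x ∈ E, (∀ z, hτ.basis.repr x z ≠ 0 → l z < n) →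
      x ∈ Submodule.span k (D '' X) := by
    induction n with
    | zero =>
      intro x _ hx
      have hx0 : hτ.basis.repr x = 0 := Finsupp.ext fun z => by_contra fun hz => by
        simpa using hx z hz
      rw [(hτ.basis.repr.map_eq_zero_iff).1 hx0]
      exact zero_mem _
    | succ n ih =>
      intro x hxE hx
      have hxn z (hz : hτ.basis.repr x z ≠ 0) : l z ≤ n := Nat.lt_succ_iff.1 (hx z hz)
      obtain ⟨y, hy, hlt⟩ := hD.exists_mem_span_layer hxn
      have hlayer : {w | hτ.basis.repr x w ≠ 0 ∧ l w = n} ⊆ X := fun w hw =>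
        hX x hxE w hw.1 fun z hz => (hxn z hz).trans_eq hw.2.symm
      have hyE : y ∈ E := Submodule.span_le.2
        (Set.image_subset_iff.2 fun w hw => hDE w (hlayer hw)) hy
      have hrest := ih (x - y) (sub_mem hxE hyE) hlt
      simpa using add_mem hrest (Submodule.span_mono (Set.image_mono hlayer) hy)
  intro x hx
  refine hbounded ((hτ.basis.repr x).support.sup l + 1) x hx fun z hz => ?_
  exact Nat.lt_succ_of_le (Finset.le_sup (f := l) (Finsupp.mem_support_iff.2 hz))

variable (hτ : IsHeckeBasis S l q τ) (h : IsLengthFn S T l)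

theorem ne_zero_of_add_one_mul_sub_one_eq_zero (hr : (q * r + 1) * (r - 1) = 0) : r ≠ 0 := by
  rintro rfl
  simp at hr

include h

theorem mem_eigenIdeal_iff (hq : q ≠ 0) (hr : (q * r + 1) * (r - 1) = 0) {s : W} (hs : s ∈ S)
    {x : H} : x ∈ eigenIdeal q τ r s ↔
      ∀ y, l y < l (y * s) → hτ.basis.repr x (y * s) = r * hτ.basis.repr x y := by
  rw [mem_eigenIdeal, ← hτ.basis.repr.injective.eq_iff, hτ.repr_mul_simple h hs, map_smul]
  constructor
  · intro hx y hy
    have hxy := DFunLike.congr_fun hx y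
    rw [rightOp_apply_of_lt q h hs hy, Finsupp.smul_apply, smul_eq_mul, mul_assoc] at hxy
    exact mul_left_cancel₀ hq hxy
  · intro hx
    ext y
    rw [Finsupp.smul_apply, smul_eq_mul]
    rcases h.mul_simple_lt_or_gt hs y with hy | hy
    · rw [rightOp_apply_of_lt q h hs hy, hx y hy, mul_assoc]
    · have hxy := hx (y * s) (by rwa [h.mul_simple_cancel hs])
      rw [h.mul_simple_cancel hs] at hxy
      rw [rightOp_apply_of_gt q h hs hy, hxy]
      linear_combination (-hτ.basis.repr x (y * s)) * hr

include hτ in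
theorem exists_eq_mul_of_mem_eigenIdeal (hr : (q * r + 1) * (r - 1) = 0)
    (hrr' : q * r * r' = -1) {s : W} (hs : s ∈ S) {x : H} (hx : x ∈ eigenIdeal q τ r s) :
    ∃ g : H, x = g * (τ s - (q * r') • 1) := by
  classical
  have hq : q ≠ 0 := by rintro rfl; simp at hrr'
  rw [mem_eigenIdeal_iff hτ h hq hr hs] at hx
  refine ⟨hτ.basis.repr.symm ((r • hτ.basis.repr x).filter fun y => l y < l (y * s)),
    hτ.basis.repr.injective (Finsupp.ext fun y => ?_)⟩
  rw [mul_sub, mul_smul_comm, mul_one, map_sub, map_smul, hτ.repr_mul_simple h hs,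
    LinearEquiv.apply_symm_apply, Finsupp.sub_apply, Finsupp.smul_apply, smul_eq_mul]
  have hys := h.mul_simple_cancel hs y
  rcases h.mul_simple_lt_or_gt hs y with hy | hy
  · rw [rightOp_apply_of_lt q h hs hy, Finsupp.filter_apply_neg _ _ (by rw [hys]; exact hy.not_gt),
      Finsupp.filter_apply_pos (fun y => l y < l (y * s)) _ hy, Finsupp.smul_apply, smul_eq_mul]
    linear_combination (hτ.basis.repr x y) * hrr'
  · have hxy := hx (y * s) (by rwa [hys])
    rw [hys] at hxy
    rw [rightOp_apply_of_gt q h hs hy, Finsupp.filter_apply_neg (a := y) _ _ hy.not_gt,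
      Finsupp.filter_apply_pos _ _ (by rwa [hys]), Finsupp.smul_apply, hxy, smul_eq_mul]
    ring

section Family

variable {hτ} {D : W → H} (hD : IsSymmetricFamily hτ r D) (hq : q ≠ 0)
  (hr : (q * r + 1) * (r - 1) = 0)
include hD hq hr

theorem IsSymmetricFamily.mem_eigenIdeal {s w : W} (hs : s ∈ S) (hw : l (w * s) < l w) :
    D w ∈ eigenIdeal q τ r s :=
  (mem_eigenIdeal_iff hτ h hq hr hs).2 (hD.mul_simple w s hs hw)

theorem IsSymmetricFamily.iInf_eigenIdeal_eq_span (hS₀ : S₀ ⊆ S) :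
    (⨅ s ∈ S₀, eigenIdeal q τ r s).restrictScalars k =
      Submodule.span k (D '' {w | ∀ s ∈ S₀, l (w * s) < l w}) := by
  have hmem {w : W} (hw : ∀ s ∈ S₀, l (w * s) < l w) :
      D w ∈ (⨅ s ∈ S₀, eigenIdeal q τ r s).restrictScalars k := by
    simp only [Submodule.restrictScalars_mem, Submodule.mem_iInf]
    exact fun s hs => hD.mem_eigenIdeal h hq hr (hS₀ hs) (hw s hs)
  refine le_antisymm (hD.le_span (fun _ => hmem) fun x hx y hy hmax s hs => ?_)
    (Submodule.span_le.2 (Set.image_subset_iff.2 fun _ => hmem))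
  simp only [Submodule.restrictScalars_mem, Submodule.mem_iInf] at hx
  refine (h.mul_simple_lt_or_gt (hS₀ hs) y).resolve_left fun hlt => hlt.not_ge (hmax _ ?_)
  rw [(mem_eigenIdeal_iff hτ h hq hr (hS₀ hs)).1 (hx s hs) y hlt]
  exact mul_ne_zero (ne_zero_of_add_one_mul_sub_one_eq_zero hr) hy

theorem IsSymmetricFamily.iSup_eigenIdeal_eq_span (hS₀ : S₀ ⊆ S) :
    (⨆ s ∈ S₀, eigenIdeal q τ r s).restrictScalars k =
      Submodule.span k (D '' {w | ∃ s ∈ S₀, l (w * s) < l w}) := by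
  have hset : {w | ∃ s ∈ S₀, l (w * s) < l w} = ⋃ s ∈ S₀, {w | l (w * s) < l w} := by
    ext w
    simp
  simp only [hset, Set.image_iUnion, Submodule.span_iUnion, Submodule.restrictScalars_iSup]
  refine iSup_congr fun s => iSup_congr fun hs => ?_
  simpa using hD.iInf_eigenIdeal_eq_span h hq hr (Set.singleton_subset_iff.2 (hS₀ hs))

end Family

section Longest

/-- `w₀` is the longest element of the subgroup generated by the simple reflections in `S₀`. -/
structure IsLongest (l : W → ℕ) (S₀ : Set W) (w₀ : W) : Prop where
  mem_closure : w₀ ∈ Subgroup.closure S₀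
  length_le : ∀ u ∈ Subgroup.closure S₀, l u ≤ l w₀

variable (hS₀ : S₀ ⊆ S)
include hS₀

theorem IsLongest.mul_simple_lt {w₀ : W} (hw₀ : IsLongest l S₀ w₀) {s : W} (hs : s ∈ S₀) :
    l (w₀ * s) < l w₀ :=
  (h.mul_simple_lt_or_gt (hS₀ hs) w₀).resolve_left
    (hw₀.length_le _ (mul_mem hw₀.mem_closure (Subgroup.subset_closure hs))).not_gt

theorem isMinRep_one : IsMinRep l S₀ 1 := fun s hs => by
  rw [one_mul, h.one, h.length_simple s (hS₀ hs)]
  exact one_pos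

theorem exists_mul_simple_lt_of_not_isMinRep {w : W} (hw : ¬ IsMinRep l S₀ w) :
    ∃ s ∈ S₀, l (w * s) < l w := by
  rw [IsMinRep] at hw
  push Not at hw
  obtain ⟨s, hs, hle⟩ := hw
  exact ⟨s, hs, (h.mul_simple_lt_or_gt (hS₀ hs) w).resolve_left hle.not_gt⟩

include hτ in
/-- Modulo these left ideals `T_{ws}` is a multiple of `T_w`, so that every `T_w` reduces to the one
of minimal length in its coset. -/
theorem iSup_eigenIdeal_sup_span_isMinRep (hr : (q * r + 1) * (r - 1) = 0) :
    (⨆ s ∈ S₀, eigenIdeal q τ r s).restrictScalars k ⊔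
      Submodule.span k (τ '' {d | IsMinRep l S₀ d}) = ⊤ := by
  set E := (⨆ s ∈ S₀, eigenIdeal q τ r s).restrictScalars k ⊔
    Submodule.span k (τ '' {d | IsMinRep l S₀ d})
  suffices hmem : ∀ w, τ w ∈ E from
    top_le_iff.1 (hτ.span.trans (Submodule.span_le.2 (Set.range_subset_iff.2 hmem)))
  intro w
  induction hn : l w using Nat.strong_induction_on generalizing w with
  | _ n ih =>
    by_cases hw : IsMinRep l S₀ w
    · exact Submodule.mem_sup_right (Submodule.subset_span ⟨w, hw, rfl⟩)
    · obtain ⟨s, hs, hlt⟩ := exists_mul_simple_lt_of_not_isMinRep h hS₀ hw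
      have hup : l (w * s) < l (w * s * s) := by rwa [h.mul_simple_cancel (hS₀ hs)]
      have heigen : τ (w * s) + r • τ w ∈ eigenIdeal q τ r s := by
        rw [mem_eigenIdeal, add_mul, smul_mul_assoc, hτ.mul_simple_of_lt h (hS₀ hs) hup,
          hτ.mul_simple_of_gt h (hS₀ hs) hlt, h.mul_simple_cancel (hS₀ hs)]
        linear_combination (norm := module) -(hr • τ w)
      have hsum : τ (w * s) + r • τ w ∈ E := Submodule.mem_sup_left
        (Submodule.mem_iSup_of_mem s (Submodule.mem_iSup_of_mem hs heigen))
      have hw : r • τ w ∈ E := (E.add_mem_iff_right (ih _ (hn ▸ hlt) _ rfl)).1 hsum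
      exact (E.smul_mem_iff (ne_zero_of_add_one_mul_sub_one_eq_zero hr)).1 hw

theorem repr_mul_of_isMinRep {x y : H} (hx : x ∈ Submodule.span k (τ '' {d | IsMinRep l S₀ d}))
    (hy : y ∈ Submodule.span k (τ '' Subgroup.closure S₀)) {d : W} (hd : IsMinRep l S₀ d) :
    hτ.basis.repr (x * y) d = hτ.basis.repr x d * hτ.basis.repr y 1 := by
  classical
  induction hx, hy using Submodule.span_induction₂ with
  | zero_left => simp
  | zero_right => simp
  | add_left x x' y _ _ _ hx hx' => simp [add_mul, hx, hx']
  | add_right x y y' _ _ _ hy hy' => simp [mul_add, hy, hy']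
  | smul_left a x y _ _ hxy => simp [hxy, mul_assoc]
  | smul_right a x y _ _ hxy => simp [hxy, mul_left_comm]
  | mem_mem x y hx hy =>
    obtain ⟨d', hd', rfl⟩ := hx
    obtain ⟨u, hu, rfl⟩ := hy
    rw [hτ.mul _ _ (h.length_mul_of_isMinRep hS₀ hd' hu), hτ.basis_repr, hτ.basis_repr,
      hτ.basis_repr]
    rcases eq_or_ne u 1 with rfl | hu1
    · simp
    · have hne : d' * u ≠ d := fun hdu =>
        hu1 (h.eq_one_of_isMinRep_mul hS₀ hd' (hdu ▸ hd) hu)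
      simp [hne, hu1]

theorem repr_mul_of_mem_closure (hq : q ≠ 0) (hr : (q * r + 1) * (r - 1) = 0) {x : H}
    (hx : x ∈ ⨅ s ∈ S₀, eigenIdeal q τ r s) {d : W} (hd : IsMinRep l S₀ d) {u : W}
    (hu : u ∈ Subgroup.closure S₀) :
    hτ.basis.repr x (d * u) = r ^ l u * hτ.basis.repr x d := by
  simp only [Submodule.mem_iInf] at hx
  have hred := h.reducedIn_of_mem_closure hS₀ hu
  induction hred with
  | one => simp [h.one]
  | mul_simple g s hs _ hl ih =>
    have hsW := Subgroup.subset_closure hs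
    have hg : g ∈ Subgroup.closure S₀ := (mul_mem_cancel_right hsW).1 hu
    have hlt : l (d * g) < l (d * g * s) := by
      rw [mul_assoc, h.length_mul_of_isMinRep hS₀ hd hg, h.length_mul_of_isMinRep hS₀ hd hu]
      exact Nat.add_lt_add_left hl _
    rw [← mul_assoc, (mem_eigenIdeal_iff hτ h hq hr (hS₀ hs)).1 (hx s hs) _ hlt, ih hg,
      h.mul_simple_of_lt (hS₀ hs) hl, pow_succ']
    ring

theorem eq_zero_of_repr_isMinRep_eq_zero (hq : q ≠ 0) (hr : (q * r + 1) * (r - 1) = 0) {x : H}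
    (hx : x ∈ ⨅ s ∈ S₀, eigenIdeal q τ r s)
    (hmin : ∀ d, IsMinRep l S₀ d → hτ.basis.repr x d = 0) : x = 0 := by
  simp only [Submodule.mem_iInf] at hx
  refine hτ.basis.repr.map_eq_zero_iff.1 (Finsupp.ext fun y => ?_)
  rw [Finsupp.zero_apply]
  induction hn : l y using Nat.strong_induction_on generalizing y with
  | _ n ih =>
    by_cases hy : IsMinRep l S₀ y
    · exact hmin y hy
    · obtain ⟨s, hs, hlt⟩ := exists_mul_simple_lt_of_not_isMinRep h hS₀ hy
      have hxy := (mem_eigenIdeal_iff hτ h hq hr (hS₀ hs)).1 (hx s hs) (y * s)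
        (by rwa [h.mul_simple_cancel (hS₀ hs)])
      rw [h.mul_simple_cancel (hS₀ hs)] at hxy
      rw [hxy, ih _ (hn ▸ hlt) _ rfl, mul_zero]

end Longest

section Symmetrizer

variable {hτ} {D : W → H} (hD : IsSymmetricFamily hτ r D) (hq : q ≠ 0)
  (hr : (q * r + 1) * (r - 1) = 0) (hS₀ : S₀ ⊆ S) {w₀ : W} (hw₀ : IsLongest l S₀ w₀)
include hD hq hr hS₀ hw₀ h

namespace IsSymmetricFamily

theorem longest_mem_iInf_eigenIdeal : D w₀ ∈ ⨅ s ∈ S₀, eigenIdeal q τ r s := by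
  simp only [Submodule.mem_iInf]
  exact fun s hs => hD.mem_eigenIdeal h hq hr (hS₀ hs) (hw₀.mul_simple_lt h hS₀ hs)

theorem repr_longest_mul {d u : W} (hd : IsMinRep l S₀ d) (hu : u ∈ Subgroup.closure S₀) :
    hτ.basis.repr (D w₀) (d * u) = r ^ l u * hτ.basis.repr (D w₀) d :=
  repr_mul_of_mem_closure hτ h hS₀ hq hr (hD.longest_mem_iInf_eigenIdeal h hq hr hS₀ hw₀) hd hu

theorem repr_longest {u : W} (hu : u ∈ Subgroup.closure S₀) :
    hτ.basis.repr (D w₀) u = r ^ l u * hτ.basis.repr (D w₀) 1 := by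
  simpa using hD.repr_longest_mul h hq hr hS₀ hw₀ (isMinRep_one h hS₀) hu

theorem repr_longest_one_ne_zero : hτ.basis.repr (D w₀) 1 ≠ 0 := by
  have hself := hD.self_ne_zero w₀
  rw [hD.repr_longest h hq hr hS₀ hw₀ hw₀.mem_closure] at hself
  exact right_ne_zero_of_mul hself

theorem repr_longest_eq_zero {y : W} (hy : y ∉ Subgroup.closure S₀) :
    hτ.basis.repr (D w₀) y = 0 := by
  have hmem := hD.longest_mem_iInf_eigenIdeal h hq hr hS₀ hw₀
  simp only [Submodule.mem_iInf] at hmem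
  induction hn : l y using Nat.strong_induction_on generalizing y with
  | _ n ih =>
    by_cases hmin : IsMinRep l S₀ y
    · have hlen := h.length_mul_of_isMinRep hS₀ hmin hw₀.mem_closure
      have hy1 : y ≠ 1 := fun hy1 => hy (hy1 ▸ one_mem _)
      have hzero : hτ.basis.repr (D w₀) (y * w₀) = 0 := by
        by_contra hne
        rcases hD.eq_or_lt _ _ hne with heq | hlt
        · exact hy1 (mul_eq_right.1 heq)
        · lia
      rw [hD.repr_longest_mul h hq hr hS₀ hw₀ hmin hw₀.mem_closure] at hzero
      exact (mul_eq_zero.1 hzero).resolve_left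
        (pow_ne_zero _ (ne_zero_of_add_one_mul_sub_one_eq_zero hr))
    · obtain ⟨s, hs, hlt⟩ := exists_mul_simple_lt_of_not_isMinRep h hS₀ hmin
      have hstep := (mem_eigenIdeal_iff hτ h hq hr (hS₀ hs)).1 (hmem s hs) (y * s)
        (by rwa [h.mul_simple_cancel (hS₀ hs)])
      rw [h.mul_simple_cancel (hS₀ hs)] at hstep
      rw [hstep, ih _ (hn ▸ hlt)
        ((Subgroup.mul_mem_cancel_right _ (Subgroup.subset_closure hs)).not.2 hy) rfl, mul_zero]

theorem longest_mem_span : D w₀ ∈ Submodule.span k (τ '' Subgroup.closure S₀) := by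
  refine hτ.mem_span_image.2 fun y hy => ?_
  by_contra hyS
  exact hy (hD.repr_longest_eq_zero h hq hr hS₀ hw₀ hyS)

theorem simple_mul_longest {s : W} (hs : s ∈ S₀) : τ s * D w₀ = (q * r) • D w₀ := by
  have hs' := hS₀ hs
  have hsW := Subgroup.subset_closure hs
  have hmem : MulOpposite.op (D w₀) ∈ eigenIdeal q (fun w => MulOpposite.op (τ w⁻¹)) r s := by
    rw [mem_eigenIdeal_iff (hτ.op_inv h) h hq hr hs']
    intro y hy
    rw [hτ.repr_op_inv h, hτ.repr_op_inv h]
    by_cases hyS : y ∈ Subgroup.closure S₀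
    · rw [hD.repr_longest h hq hr hS₀ hw₀ (inv_mem (mul_mem hyS hsW)),
        hD.repr_longest h hq hr hS₀ hw₀ (inv_mem hyS), h.inv, h.inv, h.mul_simple_of_lt hs' hy,
        pow_succ']
      ring
    · rw [hD.repr_longest_eq_zero h hq hr hS₀ hw₀
          (inv_mem_iff.not.2 ((Subgroup.mul_mem_cancel_right _ hsW).not.2 hyS)),
        hD.repr_longest_eq_zero h hq hr hS₀ hw₀ (inv_mem_iff.not.2 hyS), mul_zero]
  rw [AffineHecke.mem_eigenIdeal, h.simple_inv hs'] at hmem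
  exact MulOpposite.op_injective hmem

theorem iInf_eigenIdeal_eq_span_longest :
    ⨅ s ∈ S₀, eigenIdeal q τ r s = Submodule.span H {D w₀} := by
  classical
  have hlongest := hD.longest_mem_iInf_eigenIdeal h hq hr hS₀ hw₀
  have hone := hD.repr_longest_one_ne_zero h hq hr hS₀ hw₀
  refine le_antisymm (fun x hx => Submodule.mem_span_singleton.2 ?_)
    ((Submodule.span_singleton_le_iff_mem _ _).2 hlongest)
  let f : W →₀ k := ((hτ.basis.repr (D w₀) 1)⁻¹ • hτ.basis.repr x).filter (IsMinRep l S₀)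
  have hf : hτ.basis.repr.symm f ∈ Submodule.span k (τ '' {d | IsMinRep l S₀ d}) := by
    refine hτ.mem_span_image.2 fun d hd => ?_
    by_contra hmin
    rw [LinearEquiv.apply_symm_apply] at hd
    exact hd (Finsupp.filter_apply_neg _ _ hmin)
  refine ⟨hτ.basis.repr.symm f, (sub_eq_zero.1 (eq_zero_of_repr_isMinRep_eq_zero hτ h hS₀ hq hr
    (sub_mem hx (Submodule.smul_mem _ _ hlongest)) fun d hd => ?_)).symm⟩
  rw [smul_eq_mul, map_sub, Finsupp.sub_apply, repr_mul_of_isMinRep hτ h hS₀ hf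
      (hD.longest_mem_span h hq hr hS₀ hw₀) hd, LinearEquiv.apply_symm_apply,
    Finsupp.filter_apply_pos _ _ hd, Finsupp.smul_apply, smul_eq_mul, mul_comm _⁻¹,
    inv_mul_cancel_right₀ hone, sub_self]

end IsSymmetricFamily

end Symmetrizer

section Duality

variable {hτ} {D D' : W → H} (hD' : IsSymmetricFamily hτ r' D')
  (hr : (q * r + 1) * (r - 1) = 0) (hr' : (q * r' + 1) * (r' - 1) = 0) (hrr' : q * r * r' = -1)
  (hS₀ : S₀ ⊆ S) {w₀ : W} (hw₀ : IsLongest l S₀ w₀)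
include hD' hr hr' hrr' hS₀ hw₀ h

theorem ker_toSpanSingleton_longest :
    LinearMap.ker (LinearMap.toSpanSingleton H H (D' w₀)) = ⨆ s ∈ S₀, eigenIdeal q τ r s := by
  have hq : q ≠ 0 := by rintro rfl; simp at hrr'
  have hle : ⨆ s ∈ S₀, eigenIdeal q τ r s ≤
      LinearMap.ker (LinearMap.toSpanSingleton H H (D' w₀)) := by
    refine iSup₂_le fun s hs x hx => ?_
    obtain ⟨g, rfl⟩ := exists_eq_mul_of_mem_eigenIdeal hτ h hr hrr' (hS₀ hs) hx
    rw [LinearMap.mem_ker, LinearMap.toSpanSingleton_apply, smul_eq_mul, mul_assoc, sub_mul,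
      hD'.simple_mul_longest h hq hr' hS₀ hw₀ hs, smul_mul_assoc, one_mul, sub_self, mul_zero]
  refine le_antisymm (fun x hx => ?_) hle
  have htop : x ∈ (⊤ : Submodule k H) := Submodule.mem_top
  rw [← iSup_eigenIdeal_sup_span_isMinRep hτ h hS₀ hr] at htop
  obtain ⟨y, hy, z, hz, rfl⟩ := Submodule.mem_sup.1 htop
  have hzD : z * D' w₀ = 0 := ((Submodule.add_mem_iff_right _ (hle hy)).1 hx :)
  have hz0 : z = 0 := by
    refine hτ.basis.repr.map_eq_zero_iff.1 (Finsupp.ext fun d => ?_)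
    by_cases hd : IsMinRep l S₀ d
    · have hrepr := repr_mul_of_isMinRep hτ h hS₀ hz (hD'.longest_mem_span h hq hr' hS₀ hw₀) hd
      rw [hzD, map_zero, Finsupp.zero_apply, zero_eq_mul] at hrepr
      exact hrepr.resolve_right (hD'.repr_longest_one_ne_zero h hq hr' hS₀ hw₀)
    · by_contra hne
      exact hd (hτ.mem_span_image.1 hz d hne)
  rwa [hz0, add_zero]

theorem exists_ideals (hD : IsSymmetricFamily hτ r D) : ∃ I M' : Submodule H H,
    I.restrictScalars k = Submodule.span k (D '' {w | ∃ s ∈ S₀, l (w * s) < l w}) ∧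
    M'.restrictScalars k = Submodule.span k (D' '' {w | ∀ s ∈ S₀, l (w * s) < l w}) ∧
    M' = Submodule.span H {D' w₀} ∧
    ∃ e : (H ⧸ I) ≃ₗ[H] M', ∀ x : H, (e (Submodule.Quotient.mk x) : H) = x * D' w₀ := by
  have hq : q ≠ 0 := by rintro rfl; simp at hrr'
  have hM' := hD'.iInf_eigenIdeal_eq_span_longest h hq hr' hS₀ hw₀
  have hker := ker_toSpanSingleton_longest h hD' hr hr' hrr' hS₀ hw₀
  have hrange : LinearMap.range (LinearMap.toSpanSingleton H H (D' w₀)) =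
      ⨅ s ∈ S₀, eigenIdeal q τ r' s := by
    rw [hM', LinearMap.range_toSpanSingleton]
  exact ⟨_, _, hD.iSup_eigenIdeal_eq_span h hq hr hS₀, hD'.iInf_eigenIdeal_eq_span h hq hr' hS₀,
    hM', (Submodule.quotEquivOfEq _ _ hker.symm).trans
      ((LinearMap.quotKerEquivRange _).trans (LinearEquiv.ofEq _ _ hrange)), fun x => rfl⟩

end Duality

end Ideals

section HighestRoot

variable {ι M N : Type*} [AddCommGroup M] [Module ℝ M] [AddCommGroup N] [Module ℝ N]
  {P : RootPairing ι ℝ M N} (b : P.Base)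

/-- The positive cone of the root lattice: the sums of simple roots. It defines the dominance order
`x ≤ y ↔ y - x ∈ rootCone b`. -/
abbrev rootCone : AddSubmonoid M := AddSubmonoid.closure (P.root '' b.support)

variable {b}

theorem root_mem_rootCone {i : ι} (hi : i ∈ b.support) : P.root i ∈ rootCone b :=
  AddSubmonoid.subset_closure (Set.mem_image_of_mem _ hi)

theorem nonneg_of_mem_rootCone {f : M →ₗ[ℝ] ℝ} (hf : ∀ i ∈ b.support, 0 ≤ f (P.root i)) {x : M}
    (hx : x ∈ rootCone b) : 0 ≤ f x := by
  have hle : rootCone b ≤ (AddSubmonoid.nonneg ℝ).comap f :=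
    AddSubmonoid.closure_le.2 (Set.image_subset_iff.2 hf)
  exact hle hx

theorem eq_zero_or_pos_of_mem_rootCone {f : M →ₗ[ℝ] ℝ} (hf : ∀ i ∈ b.support, 0 < f (P.root i))
    {x : M} (hx : x ∈ rootCone b) : x = 0 ∨ 0 < f x := by
  refine AddSubmonoid.closure_induction ?_ (Or.inl rfl) ?_ hx
  · rintro _ ⟨i, hi, rfl⟩
    exact Or.inr (hf i hi)
  · rintro x y - - (rfl | hx) (rfl | hy)
    · exact Or.inl (add_zero 0)
    · exact Or.inr (by rwa [zero_add])
    · exact Or.inr (by rwa [add_zero])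
    · exact Or.inr (by rw [map_add]; exact add_pos hx hy)

section Crystallographic

variable [Finite ι] [P.IsCrystallographic]

theorem root_mem_rootCone_of_isPos {i : ι} (hi : b.IsPos i) : P.root i ∈ rootCone b :=
  hi.induction_on_add (fun _ hj => root_mem_rootCone hj)
    fun _ _ _ hk hi hj => hk ▸ add_mem hi (root_mem_rootCone hj)

theorem isPos_flip [P.IsReduced] {i : ι} (hi : b.IsPos i) : b.flip.IsPos i := by
  let := P.indexNeg
  refine hi.induction_on_reflect (p := fun i => b.IsPos i → b.flip.IsPos i)
    (fun i hi _ => RootPairing.Base.isPos_of_mem_support (b := b.flip) hi) ?_ hi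
  intro i j ih hj hpos
  have hj' := RootPairing.Base.isPos_of_mem_support hj
  by_cases hij : i = j
  · subst hij
    exact absurd hpos ((RootPairing.Base.IsPos.neg_iff_not b i).not.2 (not_not.2 hj'))
  by_cases hij' : P.reflectionPerm j i = j
  · exact hij'.symm ▸ RootPairing.Base.isPos_of_mem_support (b := b.flip) hj
  · have hi := hpos.reflectionPerm hj hij'
    rw [RootPairing.reflectionPerm_self] at hi
    exact (ih hi).reflectionPerm (b := b.flip) hj hij

end Crystallographic

variable [P.IsRootSystem]

variable (b) in
/-- The linear functional taking the value one on all simple roots. -/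
def heightFunctional : M →ₗ[ℝ] ℝ := b.toWeightBasis.constr ℝ fun _ => (1 : ℝ)

theorem heightFunctional_root {i : ι} (hi : i ∈ b.support) :
    heightFunctional b (P.root i) = 1 := by
  simpa only [heightFunctional, RootPairing.Base.toWeightBasis_apply] using
    b.toWeightBasis.constr_basis ℝ (fun _ => (1 : ℝ)) ⟨i, hi⟩

theorem eq_zero_or_heightFunctional_pos {x : M} (hx : x ∈ rootCone b) :
    x = 0 ∨ 0 < heightFunctional b x :=
  eq_zero_or_pos_of_mem_rootCone (fun _ hi => (heightFunctional_root hi).symm ▸ one_pos) hx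

theorem eq_zero_of_mem_rootCone_of_neg_mem {x : M} (hx : x ∈ rootCone b)
    (hx' : -x ∈ rootCone b) : x = 0 := by
  refine (eq_zero_or_heightFunctional_pos hx).resolve_right fun hpos => ?_
  rcases eq_zero_or_heightFunctional_pos hx' with h | hneg
  · rw [neg_eq_zero.1 h, map_zero] at hpos
    exact hpos.false
  · rw [map_neg] at hneg
    exact (neg_pos.1 hneg).not_gt hpos

theorem repr_nonneg_of_mem_rootCone {x : M} (hx : x ∈ rootCone b) (i : b.support) :
    0 ≤ b.toWeightBasis.repr x i := by
  classical
  refine nonneg_of_mem_rootCone (f := b.toWeightBasis.coord i) (fun j hj => ?_) hx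
  rw [Module.Basis.coord_apply, b.toWeightBasis_repr_root ⟨j, hj⟩, Finsupp.single_apply]
  split <;> norm_num

theorem apply_eq_sum_repr_mul (b : P.Base) (f : M →ₗ[ℝ] ℝ) (x : M) :
    f x = ∑ m : b.support, b.toWeightBasis.repr x m * f (P.root m) := by
  conv_lhs => rw [← b.toWeightBasis.sum_repr x]
  simp only [map_sum, map_smul, RootPairing.Base.toWeightBasis_apply, smul_eq_mul]

variable (b) in
/-- The root of index `i` is maximal for the dominance order. -/
def IsMaximalRoot (i : ι) : Prop := ∀ k, P.root k - P.root i ∈ rootCone b → k = i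

variable [Finite ι]

theorem exists_isMaximalRoot (b : P.Base) (j : ι) :
    ∃ i, IsMaximalRoot b i ∧ P.root i - P.root j ∈ rootCone b := by
  obtain ⟨i, hi, hmax⟩ := Set.exists_max_image {i | P.root i - P.root j ∈ rootCone b}
    (fun i => heightFunctional b (P.root i)) (Set.toFinite _) ⟨j, by simp⟩
  refine ⟨i, fun k hk => ?_, hi⟩
  have hle := hmax k (by simpa using add_mem hk hi)
  rcases eq_zero_or_heightFunctional_pos hk with h | h
  · exact P.root.injective (sub_eq_zero.1 h)
  · rw [map_sub] at h
    linarith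

namespace IsMaximalRoot

omit [P.IsRootSystem] [Finite ι] in
theorem root_mem {i : ι} (hi : IsMaximalRoot b i) : P.root i ∈ rootCone b := by
  refine (b.root_mem_or_neg_mem i).resolve_right fun h => P.ne_neg i (hi _ ?_).symm
  change P.root (P.reflectionPerm i i) - P.root i ∈ rootCone b
  rw [P.root_reflectionPerm, P.reflection_apply_self, sub_eq_add_neg]
  exact add_mem h h

variable [P.IsCrystallographic]

theorem pairing_nonneg {i : ι} (hi : IsMaximalRoot b i) {j : ι} (hj : j ∈ b.support) :
    0 ≤ P.pairing i j := by
  rw [← P.algebraMap_pairingIn ℤ, eq_intCast, Int.cast_nonneg_iff]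
  by_contra! hneg
  by_cases hij : P.root i = -P.root j
  · exact P.ne_zero j
      (eq_zero_of_mem_rootCone_of_neg_mem (root_mem_rootCone hj) (hij ▸ hi.root_mem))
  · obtain ⟨k, hk⟩ := P.root_add_root_mem_of_pairingIn_neg hneg hij
    have hki := hi k (by rw [hk, add_sub_cancel_left]; exact root_mem_rootCone hj)
    rw [hki, left_eq_add] at hk
    exact P.ne_zero j hk

variable [P.IsReduced] [P.IsIrreducible]

/-- If the coefficient of the simple root `k` vanished, then dominance would force every simple root
occurring in the maximal root to be orthogonal to `k`, so the Dynkin diagram would be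
disconnected. -/
theorem repr_pos {i : ι} (hi : IsMaximalRoot b i) (j : b.support) :
    0 < b.toWeightBasis.repr (P.root i) j := by
  set c := b.toWeightBasis.repr (P.root i)
  have hc_nonneg : ∀ k, 0 ≤ c k := repr_nonneg_of_mem_rootCone hi.root_mem
  obtain ⟨k₀, hk₀⟩ : ∃ k, c k ≠ 0 := DFunLike.ne_iff.1 fun h =>
    P.ne_zero i ((LinearEquiv.map_eq_zero_iff _).1 h)
  refine (hc_nonneg j).lt_of_ne' (b.induction_on_cartanMatrix (fun k => c k ≠ 0) hk₀ ?_)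
  intro m k hm hmk hck
  have hterm : ∀ l ∈ Finset.univ, c l * P.pairing l k ≤ 0 := by
    rintro l -
    by_cases hlk : l = k
    · rw [hlk, hck, zero_mul]
    · refine mul_nonpos_of_nonneg_of_nonpos (hc_nonneg l) ?_
      rw [← P.algebraMap_pairingIn ℤ, eq_intCast, Int.cast_nonpos]
      exact b.pairingIn_le_zero_of_ne (Subtype.coe_injective.ne hlk) l.2 k.2
  have hsum : ∑ l, c l * P.pairing l k = 0 :=
    (Finset.sum_nonpos hterm).antisymm
      ((hi.pairing_nonneg k.2).trans_eq (apply_eq_sum_repr_mul b (P.coroot' k) (P.root i)))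
  have hmul := (Finset.sum_eq_zero_iff_of_nonpos hterm).1 hsum m (Finset.mem_univ m)
  refine hmk (b.cartanMatrix_apply_eq_zero_iff_symm.1 ?_)
  exact b.cartanMatrix_apply_eq_zero_iff_pairing.2 ((mul_eq_zero.1 hmul).resolve_left hm)

theorem pairing_pos {i j : ι} (hi : IsMaximalRoot b i) (hj : IsMaximalRoot b j) :
    0 < P.pairing i j := by
  have hsum : ∀ k, P.pairing k j =
      ∑ m : b.support, b.toWeightBasis.repr (P.root k) m * P.pairing m j :=
    fun k => apply_eq_sum_repr_mul b (P.coroot' j) (P.root k)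
  have hnonneg : ∀ m : b.support, 0 ≤ P.pairing m j := fun m => by
    have h := hj.pairing_nonneg m.2
    rw [← P.algebraMap_pairingIn ℤ, eq_intCast, Int.cast_nonneg_iff] at h ⊢
    exact not_lt.1 ((P.pairingIn_lt_zero_iff ℤ).not.1 h.not_gt)
  obtain ⟨m, hm⟩ : ∃ m : b.support, P.pairing m j ≠ 0 := by
    by_contra! h
    simpa [h] using hsum j
  rw [hsum i]
  exact Finset.sum_pos' (fun m _ => mul_nonneg (hi.repr_pos m).le (hnonneg m))
    ⟨m, Finset.mem_univ m, mul_pos (hi.repr_pos m) ((hnonneg m).lt_of_ne' hm)⟩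

theorem unique {i j : ι} (hi : IsMaximalRoot b i) (hj : IsMaximalRoot b j) : i = j := by
  by_contra hij
  have hpos : 0 < P.pairingIn ℤ i j := by
    simpa [← P.algebraMap_pairingIn ℤ] using hi.pairing_pos hj
  obtain ⟨k, hk⟩ := P.root_sub_root_mem_of_pairingIn_pos hpos hij
  rcases b.root_mem_or_neg_mem k with h | h
  · exact hij (hj i (hk ▸ h))
  · exact hij (hi j (by rwa [hk, neg_sub] at h)).symm

end IsMaximalRoot

variable [P.IsCrystallographic] [P.IsReduced] [P.IsIrreducible] [Nonempty ι]

theorem exists_highestRoot (b : P.Base) : ∃ i, ∀ j, P.root i - P.root j ∈ rootCone b := by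
  obtain ⟨i, hi, -⟩ := exists_isMaximalRoot b (Classical.arbitrary ι)
  refine ⟨i, fun j => ?_⟩
  obtain ⟨i', hi', h⟩ := exists_isMaximalRoot b j
  rwa [hi.unique hi']

theorem exists_isHighestCoroot (b : P.Base) : ∃ i, IsHighestCoroot b i :=
  exists_highestRoot b.flip

end HighestRoot

section AffineAction

open scoped Pointwise symmDiff

variable {ι V V' : Type*} [AddCommGroup V] [Module ℝ V] [AddCommGroup V'] [Module ℝ V']
  {R : RootPairing ι ℝ V V'}

theorem affAct_one (x : V) : affAct (1 : ExtAffineWeyl R) x = x := by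
  simp [affAct]

theorem affAct_mul (g h : ExtAffineWeyl R) (x : V) :
    affAct (g * h) x = affAct g (affAct h x) := by
  change (g.right * h.right) • x + ((g.left.toAdd : V) + g.right • (h.left.toAdd : V)) =
    g.right • (h.right • x + (h.left.toAdd : V)) + (g.left.toAdd : V)
  rw [smul_add, mul_smul]
  abel

theorem affAct_inv_affAct (g : ExtAffineWeyl R) (x : V) : affAct g⁻¹ (affAct g x) = x := by
  rw [← affAct_mul, inv_mul_cancel, affAct_one]

theorem affAct_injective : Function.Injective (affAct : ExtAffineWeyl R → V → V) := by
  intro g h hgh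
  have hleft : g.left = h.left :=
    Multiplicative.toAdd.injective (Subtype.ext (by simpa [affAct] using congrFun hgh 0))
  refine SemidirectProduct.ext hleft (Subtype.ext (RootPairing.Equiv.weightHom_injective R ?_))
  refine LinearEquiv.ext fun x => ?_
  have hx := congrFun hgh x
  rw [affAct, affAct, hleft] at hx
  exact add_right_cancel hx

theorem coroot'_weylGroup_smul (w : R.weylGroup) (i : ι) (x : V) :
    R.coroot' (R.weylGroupToPerm w i) (w • x) = R.coroot' i x := by
  obtain ⟨w, hw⟩ := w
  change R.coroot' (RootPairing.Equiv.indexHom R w i) (w • x) = R.coroot' i x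
  induction hw using RootPairing.weylGroup.induction generalizing i x with
  | mem j =>
    change R.coroot' (R.reflectionPerm j i) (R.reflection j x) = R.coroot' i x
    rw [R.coroot'_reflection, R.reflectionPerm_self]
  | one => rw [map_one, one_smul, Equiv.Perm.one_apply]
  | mul g h _ _ hg hh => rw [map_mul, mul_smul, Equiv.Perm.mul_apply, hg, hh]

variable (R) in
/-- The affine coroot `x ↦ ⟨x, αᵢ^∨⟩ - n`, whose zero set is the mirror of `affRefl i n`. -/
def affineCoroot (i : ι) (n : ℤ) (x : V) : ℝ := R.coroot' i x - n

theorem affineCoroot_reflectionPerm_self (i : ι) (n : ℤ) (x : V) :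
    affineCoroot R (R.reflectionPerm i i) (-n) x = -affineCoroot R i n x := by
  simp [affineCoroot, neg_add_eq_sub]

variable [R.IsCrystallographic]

theorem affAct_affRefl (i : ι) (n : ℤ) (x : V) :
    affAct (affRefl (R := R) i n) x = x - affineCoroot R i n x • R.root i := by
  change R.reflection i x + ((n • ⟨R.root i, root_mem_weightLattice R i⟩ : weightLattice R) : V) = _
  rw [R.reflection_apply, AddSubgroup.coe_zsmul, affineCoroot, sub_smul, Int.cast_smul_eq_zsmul]
  abel

theorem coroot'_affAct_affRefl (j i : ι) (n : ℤ) (x : V) :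
    R.coroot' j (affAct (affRefl (R := R) i n) x) =
      R.coroot' j x - affineCoroot R i n x * R.pairing i j := by
  rw [affAct_affRefl, map_sub, map_smul, R.root_coroot'_eq_pairing, smul_eq_mul]

theorem affineCoroot_affAct_affRefl (i : ι) (n : ℤ) (x : V) :
    affineCoroot R i n (affAct (affRefl (R := R) i n) x) = -affineCoroot R i n x := by
  rw [affineCoroot, coroot'_affAct_affRefl, R.pairing_same, affineCoroot]
  ring

theorem affRefl_mul_self (i : ι) (n : ℤ) : affRefl (R := R) i n * affRefl i n = 1 := by
  refine affAct_injective (funext fun x => ?_)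
  rw [affAct_mul, affAct_one, affAct_affRefl i n (affAct _ x), affineCoroot_affAct_affRefl,
    affAct_affRefl, neg_smul, sub_neg_eq_add, sub_add_cancel]

theorem exists_conj_affRefl (g : ExtAffineWeyl R) (i : ι) (n : ℤ) :
    ∃ j m, (∀ x : V, affineCoroot R j m (affAct g x) = affineCoroot R i n x) ∧
      g * affRefl i n * g⁻¹ = affRefl j m := by
  set j := R.weylGroupToPerm g.right i
  obtain ⟨c, hc⟩ := g.left.toAdd.2 j
  have hcoroot : ∀ x : V, affineCoroot R j (n + c) (affAct g x) = affineCoroot R i n x := by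
    intro x
    rw [affineCoroot, affAct, map_add, coroot'_weylGroup_smul, hc, affineCoroot, Int.cast_add]
    ring
  refine ⟨j, n + c, hcoroot, mul_inv_eq_iff_eq_mul.2 (affAct_injective (funext fun x => ?_))⟩
  rw [affAct_mul, affAct_mul, affAct_affRefl, affAct_affRefl, hcoroot,
    ← R.weylGroup_apply_root, affAct, affAct, smul_sub, smul_comm, sub_add_eq_add_sub]

theorem exists_inv_conj_affRefl (g : ExtAffineWeyl R) (i : ι) (n : ℤ) :
    ∃ j m, (∀ x : V, affineCoroot R j m x = affineCoroot R i n (affAct g x)) ∧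
      g⁻¹ * affRefl i n * g = affRefl j m := by
  obtain ⟨j, m, hcoroot, hconj⟩ := exists_conj_affRefl g⁻¹ i n
  exact ⟨j, m, fun x => by rw [← hcoroot, affAct_inv_affAct], by rwa [inv_inv] at hconj⟩

theorem affRefl_reflectionPerm_self (i : ι) (n : ℤ) :
    affRefl (R := R) (R.reflectionPerm i i) (-n) = affRefl i n := by
  refine affAct_injective (funext fun x => ?_)
  rw [affAct_affRefl, affAct_affRefl, affineCoroot_reflectionPerm_self, R.root_reflectionPerm,
    R.reflection_apply_self, smul_neg, neg_smul, neg_neg]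

theorem eq_or_eq_reflectionPerm_of_affRefl_eq [R.IsReduced] {i j : ι} {n m : ℤ}
    (h : affRefl (R := R) i n = affRefl j m) :
    i = j ∧ n = m ∨ i = R.reflectionPerm j j ∧ n = -m := by
  have hsmul (x : V) : affineCoroot R i n x • R.root i = affineCoroot R j m x • R.root j := by
    have hx := congrFun (congrArg affAct h) x
    rwa [affAct_affRefl, affAct_affRefl, sub_right_inj] at hx
  have hdep : ¬ LinearIndependent ℝ ![R.root i, R.root j] := by
    intro hli
    have hone : affineCoroot R i n (((n + 1) / 2 : ℝ) • R.root i) = 1 := by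
      rw [affineCoroot, map_smul, R.root_coroot'_eq_pairing, R.pairing_same, smul_eq_mul]
      ring
    refine one_ne_zero (hone.symm.trans (LinearIndependent.pair_iff.1 hli _
      (-affineCoroot R j m (((n + 1) / 2 : ℝ) • R.root i)) ?_).1)
    rw [hsmul, neg_smul, add_neg_cancel]
  have hzero : (n : ℝ) • R.root i = (m : ℝ) • R.root j := by
    simpa [affineCoroot] using hsmul 0
  have hcancel := smul_left_injective ℝ (R.ne_zero j)
  rcases RootPairing.IsReduced.eq_or_eq_neg (P := R) i j hdep with hij | hij
  · rw [hij] at hzero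
    exact Or.inl ⟨R.root.injective hij, Int.cast_injective (hcancel hzero)⟩
  · rw [hij, smul_neg, ← neg_smul] at hzero
    refine Or.inr ⟨R.root.injective ?_, neg_eq_iff_eq_neg.1 ?_⟩
    · rw [hij, R.root_reflectionPerm, R.reflection_apply_self]
    · exact_mod_cast hcancel hzero

variable (R) in
/-- The set of reflections of the affine Weyl group. -/
def affReflections : Set (ExtAffineWeyl R) := {t | ∃ i n, t = affRefl i n}

/-- The reflections whose mirror separates `x` from `g x`. -/
def inversions (x : V) (g : ExtAffineWeyl R) : Set (ExtAffineWeyl R) :=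
  {t | ∃ i n, t = affRefl i n ∧ affineCoroot R i n x * affineCoroot R i n (affAct g x) < 0}

theorem affRefl_mem_inversions [R.IsReduced] (x : V) (g : ExtAffineWeyl R) (i : ι) (n : ℤ) :
    affRefl i n ∈ inversions x g ↔
      affineCoroot R i n x * affineCoroot R i n (affAct g x) < 0 := by
  refine ⟨?_, fun h => ⟨i, n, rfl, h⟩⟩
  rintro ⟨j, m, hij, h⟩
  rcases eq_or_eq_reflectionPerm_of_affRefl_eq hij with ⟨rfl, rfl⟩ | ⟨rfl, rfl⟩
  · exact h
  · rwa [affineCoroot_reflectionPerm_self, affineCoroot_reflectionPerm_self, neg_mul_neg]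

theorem affRefl_mem_inversions_affRefl [R.IsReduced] (x : V) (i : ι) (m n : ℤ) :
    affRefl i m ∈ inversions x (affRefl (R := R) i n) ↔
      |(m : ℝ) - n| < |affineCoroot R i n x| := by
  have hprod : affineCoroot R i m x * affineCoroot R i m (affAct (affRefl (R := R) i n) x) =
      ((m : ℝ) - n) ^ 2 - affineCoroot R i n x ^ 2 := by
    simp only [affineCoroot, coroot'_affAct_affRefl, R.pairing_same]
    ring
  rw [affRefl_mem_inversions, hprod, sub_neg, sq_lt_sq]

theorem inversions_finite [Finite ι] (x : V) (g : ExtAffineWeyl R) : (inversions x g).Finite := by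
  have hsub : inversions x g ⊆ ⋃ i, affRefl i '' Set.Icc
      ⌊min (R.coroot' i x) (R.coroot' i (affAct g x))⌋
      ⌈max (R.coroot' i x) (R.coroot' i (affAct g x))⌉ := by
    rintro _ ⟨i, n, rfl, h⟩
    refine Set.mem_iUnion.2 ⟨i, n, ?_, rfl⟩
    rw [Set.mem_Icc, Int.floor_le_iff, Int.le_ceil_iff, min_lt_iff, lt_max_iff]
    simp only [affineCoroot] at h
    rcases mul_neg_iff.1 h with ⟨hx, hgx⟩ | ⟨hx, hgx⟩
    · exact ⟨Or.inr (by linarith), Or.inl (by linarith)⟩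
    · exact ⟨Or.inl (by linarith), Or.inr (by linarith)⟩
  exact (Set.finite_iUnion fun i => (Set.finite_Icc _ _).image _).subset hsub

variable (R) in
/-- The point `x` lies on no reflection hyperplane. -/
def IsRegularPoint (x : V) : Prop := ∀ i n, affineCoroot R i n x ≠ 0

theorem IsRegularPoint.affAct {x : V} (hx : IsRegularPoint R x) (g : ExtAffineWeyl R) :
    IsRegularPoint R (affAct g x) := by
  intro i n
  obtain ⟨j, m, hcoroot, -⟩ := exists_inv_conj_affRefl g i n
  exact hcoroot x ▸ hx j m

theorem mul_neg_iff_xor {a b c : ℝ} (ha : a ≠ 0) (hb : b ≠ 0) (hc : c ≠ 0) :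
    a * c < 0 ↔ Xor (a * b < 0) (b * c < 0) := by
  rcases ha.lt_or_gt with ha | ha <;> rcases hb.lt_or_gt with hb | hb <;>
    rcases hc.lt_or_gt with hc | hc <;>
      simp [Xor, mul_neg_iff, ha, hb, hc, ha.not_gt, hb.not_gt, hc.not_gt]

/-- A mirror separates `x` from `g h x` exactly when it separates one, but not both, of the pairs
`x, g x` and `g x, g h x`. -/
theorem inversions_mul [R.IsReduced] {x : V} (hx : IsRegularPoint R x) (g h : ExtAffineWeyl R) :
    inversions x (g * h) = inversions x g ∆ (MulAut.conj g • inversions x h) := by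
  have hconj (t) : t ∈ MulAut.conj g • inversions x h ↔ g⁻¹ * t * g ∈ inversions x h := by
    rw [Set.mem_smul_set_iff_inv_smul_mem, MulAut.smul_def, MulAut.conj_inv_apply]
  have hrefl : ∀ t ∈ affReflections R,
      t ∈ inversions x (g * h) ↔ t ∈ inversions x g ∆ (MulAut.conj g • inversions x h) := by
    rintro _ ⟨i, n, rfl⟩
    obtain ⟨j, m, hcoroot, hj⟩ := exists_inv_conj_affRefl g i n
    rw [Set.mem_symmDiff, hconj, hj]
    simp only [affRefl_mem_inversions, hcoroot, affAct_mul]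
    exact mul_neg_iff_xor (hx i n) (hx.affAct g i n) ((hx.affAct h).affAct g i n)
  have hsub (g' t) : t ∈ inversions x g' → t ∈ affReflections R := fun ⟨i, n, ht, _⟩ => ⟨i, n, ht⟩
  ext t
  refine ⟨fun ht => (hrefl t (hsub _ t ht)).1 ht, fun ht => (hrefl t ?_).2 ht⟩
  rcases Set.mem_symmDiff.1 ht with ⟨ht, -⟩ | ⟨ht, -⟩
  · exact hsub g t ht
  · obtain ⟨i, n, hi⟩ := hsub h _ ((hconj t).1 ht)
    obtain ⟨j, m, -, hj⟩ := exists_conj_affRefl g i n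
    exact ⟨j, m, by rw [← hj, ← hi]; group⟩

end AffineAction

section Alcove

variable {ι V V' : Type*} [AddCommGroup V] [Module ℝ V] [AddCommGroup V'] [Module ℝ V']
  {R : RootPairing ι ℝ V V'} {b : R.Base}

theorem mul_sub_intCast_pos {a c : ℝ} (ha : a ∈ Set.Ioo 0 1) (hc : c ∈ Set.Ioo 0 1) (n : ℤ) :
    0 < (a - n) * (c - n) := by
  rcases le_or_gt n 0 with hn | hn
  · have hn' : (n : ℝ) ≤ 0 := by exact_mod_cast hn
    exact mul_pos (by linarith [ha.1]) (by linarith [hc.1])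
  · have hn' : (1 : ℝ) ≤ n := by exact_mod_cast hn
    exact mul_pos_of_neg_of_neg (by linarith [ha.2]) (by linarith [hc.2])

theorem isPos_or_isPos_reflectionPerm_self (b : R.Base) (i : ι) :
    b.IsPos i ∨ b.IsPos (R.reflectionPerm i i) :=
  RootPairing.Base.IsPos.or_neg b i

theorem affineCoroot_mul_pos_of_mem_alcove {x y : V} (hx : x ∈ alcove b) (hy : y ∈ alcove b)
    (i : ι) (n : ℤ) : 0 < affineCoroot R i n x * affineCoroot R i n y := by
  rcases isPos_or_isPos_reflectionPerm_self b i with hi | hi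
  · exact mul_sub_intCast_pos (hx i hi) (hy i hi) n
  · rw [← neg_mul_neg, ← affineCoroot_reflectionPerm_self, ← affineCoroot_reflectionPerm_self]
    exact mul_sub_intCast_pos (hx _ hi) (hy _ hi) (-n)

theorem isRegularPoint_of_mem_alcove {x : V} (hx : x ∈ alcove b) : IsRegularPoint R x :=
  fun i n => left_ne_zero_of_mul (affineCoroot_mul_pos_of_mem_alcove hx hx i n).ne'

variable (b) in
/-- The open fundamental Weyl chamber. -/
def weylChamber : Set V := {x | ∀ i ∈ b.support, 0 < R.coroot' i x}

theorem mem_weylChamber_of_mem_alcove {x : V} (hx : x ∈ alcove b) : x ∈ weylChamber b :=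
  fun i hi => (hx i (RootPairing.Base.isPos_of_mem_support hi)).1

theorem IsHighestCoroot.coroot'_lt {θ : ι} (hθ : IsHighestCoroot b θ) {x : V}
    (hx : x ∈ weylChamber b) {j : ι} (hj : j ≠ θ) : R.coroot' j x < R.coroot' θ x := by
  rcases eq_zero_or_pos_of_mem_rootCone (b := b.flip) (f := R.toLinearMap x) hx (hθ j) with h | h
  · exact absurd (R.coroot.injective (sub_eq_zero.1 h)).symm hj
  · rw [map_sub] at h
    exact sub_pos.1 h

theorem IsHighestCoroot.coroot'_le {θ : ι} (hθ : IsHighestCoroot b θ) {x : V}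
    (hx : x ∈ weylChamber b) (j : ι) : R.coroot' j x ≤ R.coroot' θ x := by
  rcases eq_or_ne j θ with rfl | hj
  · exact le_rfl
  · exact (hθ.coroot'_lt hx hj).le

theorem IsHighestCoroot.abs_coroot'_le {θ : ι} (hθ : IsHighestCoroot b θ) {x : V}
    (hx : x ∈ weylChamber b) (j : ι) : |R.coroot' j x| ≤ R.coroot' θ x := by
  refine abs_le'.2 ⟨hθ.coroot'_le hx j, ?_⟩
  have hneg := affineCoroot_reflectionPerm_self (R := R) j 0 x
  simp only [affineCoroot, neg_zero, Int.cast_zero, sub_zero] at hneg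
  exact hneg ▸ hθ.coroot'_le hx _

section IsRootSystem

variable [R.IsRootSystem]

theorem IsHighestCoroot.unique {θ θ' : ι} (hθ : IsHighestCoroot b θ)
    (hθ' : IsHighestCoroot b θ') : θ = θ' := by
  refine R.coroot.injective (sub_eq_zero.1 ?_)
  exact eq_zero_of_mem_rootCone_of_neg_mem (b := b.flip) (hθ θ') (by rw [neg_sub]; exact hθ' θ)

theorem weylChamber_nonempty (b : R.Base) : (weylChamber b).Nonempty := by
  refine ⟨R.toPerfPair.symm (heightFunctional b.flip), fun i hi => ?_⟩
  have happly := LinearMap.congr_fun (R.toPerfPair.apply_symm_apply (heightFunctional b.flip))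
    (R.coroot i)
  exact zero_lt_one.trans_eq ((heightFunctional_root (b := b.flip) hi).symm.trans happly.symm)

end IsRootSystem

variable [Finite ι] [R.IsCrystallographic] [R.IsReduced]

theorem coroot'_pos_of_isPos {x : V} (hx : x ∈ weylChamber b) {i : ι} (hi : b.IsPos i) :
    0 < R.coroot' i x :=
  (eq_zero_or_pos_of_mem_rootCone (b := b.flip) (f := R.toLinearMap x) hx
    (root_mem_rootCone_of_isPos (isPos_flip hi))).resolve_left (R.flip.ne_zero i)

theorem IsHighestCoroot.isPos [R.IsRootSystem] {θ : ι} (hθ : IsHighestCoroot b θ) : b.IsPos θ := by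
  refine (isPos_or_isPos_reflectionPerm_self b θ).resolve_right fun hneg => ?_
  obtain ⟨x, hx⟩ := weylChamber_nonempty b
  have hpos := coroot'_pos_of_isPos hx hneg
  have hflip := affineCoroot_reflectionPerm_self (R := R) θ 0 x
  simp only [affineCoroot, neg_zero, Int.cast_zero, sub_zero] at hflip
  linarith [hθ.coroot'_le hx (R.reflectionPerm θ θ)]

theorem mem_alcove_iff [R.IsRootSystem] {θ : ι} (hθ : IsHighestCoroot b θ) {x : V} :
    x ∈ alcove b ↔ x ∈ weylChamber b ∧ R.coroot' θ x < 1 :=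
  ⟨fun hx => ⟨mem_weylChamber_of_mem_alcove hx, (hx θ hθ.isPos).2⟩, fun hx _ hi =>
    ⟨coroot'_pos_of_isPos hx.1 hi, (hθ.coroot'_le hx.1 _).trans_lt hx.2⟩⟩

theorem alcove_nonempty [R.IsRootSystem] [R.IsIrreducible] [Nonempty ι] (b : R.Base) :
    (alcove b).Nonempty := by
  obtain ⟨θ, hθ⟩ := exists_isHighestCoroot b
  obtain ⟨y, hy⟩ := weylChamber_nonempty b
  have hθy := coroot'_pos_of_isPos hy hθ.isPos
  refine ⟨(1 + R.coroot' θ y)⁻¹ • y, (mem_alcove_iff hθ).2 ⟨fun i hi => ?_, ?_⟩⟩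
  · rw [map_smul, smul_eq_mul]
    exact mul_pos (by positivity) (hy i hi)
  · rw [map_smul, smul_eq_mul, inv_mul_lt_iff₀ (by positivity)]
    linarith

omit [Finite ι] [R.IsReduced] in
theorem exists_isPos_affRefl (b : R.Base) (i : ι) (n : ℤ) :
    ∃ j m, b.IsPos j ∧ affRefl (R := R) i n = affRefl j m := by
  rcases isPos_or_isPos_reflectionPerm_self b i with hi | hi
  · exact ⟨i, n, hi, rfl⟩
  · exact ⟨_, -n, hi, (affRefl_reflectionPerm_self i n).symm⟩

omit [Finite ι] in
theorem injOn_affRefl (b : R.Base) :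
    Set.InjOn (fun h : ι × ℤ => affRefl (R := R) h.1 h.2) {h | b.IsPos h.1} := by
  rintro ⟨i, n⟩ hi ⟨j, m⟩ hj h
  rcases eq_or_eq_reflectionPerm_of_affRefl_eq h with ⟨rfl, rfl⟩ | ⟨rfl, -⟩
  · rfl
  · exact absurd hj ((RootPairing.Base.IsPos.neg_iff_not b j).1 hi)

omit [Finite ι] [R.IsReduced] in
theorem separates_iff {x : V} (hx : x ∈ alcove b) (g : ExtAffineWeyl R) (i : ι) (n : ℤ) :
    Separates (R := R) i n (alcove b) (affAct g '' alcove b) ↔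
      affineCoroot R i n x * affineCoroot R i n (affAct g x) < 0 := by
  constructor
  · rintro (⟨hlt, hgt⟩ | ⟨hgt, hlt⟩)
    · exact mul_neg_of_neg_of_pos (sub_neg.2 (hlt x hx)) (sub_pos.2 (hgt _ ⟨x, hx, rfl⟩))
    · exact mul_neg_of_pos_of_neg (sub_pos.2 (hgt x hx)) (sub_neg.2 (hlt _ ⟨x, hx, rfl⟩))
  have halcove : ∀ y ∈ alcove b, 0 < affineCoroot R i n x * affineCoroot R i n y :=
    fun y hy => affineCoroot_mul_pos_of_mem_alcove hx hy i n
  have himage : ∀ y ∈ affAct g '' alcove b,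
      0 < affineCoroot R i n (affAct g x) * affineCoroot R i n y := by
    rintro _ ⟨y, hy, rfl⟩
    obtain ⟨j, m, hcoroot, -⟩ := exists_inv_conj_affRefl g i n
    rw [← hcoroot, ← hcoroot]
    exact affineCoroot_mul_pos_of_mem_alcove hx hy j m
  intro h
  rcases mul_neg_iff.1 h with ⟨hpos, hneg⟩ | ⟨hneg, hpos⟩
  · exact Or.inr ⟨fun y hy => sub_pos.1 ((pos_iff_pos_of_mul_pos (halcove y hy)).1 hpos),
      fun y hy => sub_neg.1 ((neg_iff_neg_of_mul_pos (himage y hy)).1 hneg)⟩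
  · exact Or.inl ⟨fun y hy => sub_neg.1 ((neg_iff_neg_of_mul_pos (halcove y hy)).1 hneg),
      fun y hy => sub_pos.1 ((pos_iff_pos_of_mul_pos (himage y hy)).1 hpos)⟩

omit [Finite ι] in
theorem length_eq_ncard_inversions {x : V} (hx : x ∈ alcove b) (g : ExtAffineWeyl R) :
    length b g = (inversions x g).ncard := by
  have himage : inversions x g =
      (fun h : ι × ℤ => affRefl (R := R) h.1 h.2) '' {h : ι × ℤ | b.IsPos h.1 ∧
        Separates (R := R) h.1 h.2 (alcove b) (affAct g '' alcove b)} := by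
    simp only [separates_iff hx, ← affRefl_mem_inversions]
    ext t
    refine ⟨fun ht => ?_, ?_⟩
    · obtain ⟨i, n, rfl, -⟩ := id ht
      obtain ⟨j, m, hj, h⟩ := exists_isPos_affRefl b i n
      exact ⟨(j, m), ⟨hj, h ▸ ht⟩, h.symm⟩
    · rintro ⟨⟨i, n⟩, ⟨-, h⟩, rfl⟩
      exact h
  rw [himage, ((injOn_affRefl b).mono fun h hh => hh.1).ncard_image, length]

omit [Finite ι] in
theorem inversions_affRefl_eq_singleton {x : V} (hx : x ∈ alcove b) {i : ι} {n : ℤ}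
    (hi : |affineCoroot R i n x| < 1)
    (h : ∀ j, b.IsPos j → j ≠ i →
      R.coroot' j (affAct (affRefl (R := R) i n) x) ∈ Set.Ioo (0 : ℝ) 1) :
    inversions x (affRefl (R := R) i n) = {affRefl i n} := by
  refine Set.Subset.antisymm (fun t ht => ?_) (Set.singleton_subset_iff.2 ?_)
  · obtain ⟨j, m, rfl, -⟩ := id ht
    obtain ⟨j, m, hj, heq⟩ := exists_isPos_affRefl b j m
    rw [heq] at ht ⊢
    rcases eq_or_ne j i with rfl | hji
    · have hlt : |(m : ℝ) - n| < 1 := ((affRefl_mem_inversions_affRefl x j m n).1 ht).trans hi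
      have hmn : m - n = 0 := Int.abs_lt_one_iff.1 (by exact_mod_cast hlt)
      rw [sub_eq_zero.1 hmn, Set.mem_singleton_iff]
    · rw [affRefl_mem_inversions] at ht
      exact absurd ht (mul_sub_intCast_pos (hx j hj) (h j hj hji) m).not_gt
  · rw [affRefl_mem_inversions_affRefl, sub_self, abs_zero, abs_pos]
    exact isRegularPoint_of_mem_alcove hx i n

theorem inversions_affRefl_simple {x : V} (hx : x ∈ alcove b) {i : ι} (hi : i ∈ b.support) :
    inversions x (affRefl (R := R) i 0) = {affRefl i 0} := by
  refine inversions_affRefl_eq_singleton hx ?_ fun j hj hji => ?_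
  · have hix := hx i (RootPairing.Base.isPos_of_mem_support hi)
    rw [affineCoroot, Int.cast_zero, sub_zero, abs_of_pos hix.1]
    exact hix.2
  · have hrefl : affAct (affRefl (R := R) i 0) x = R.reflection i x := by
      rw [affAct_affRefl, affineCoroot, Int.cast_zero, sub_zero, R.reflection_apply]
    rw [hrefl, R.coroot'_reflection]
    exact hx _ (hj.reflectionPerm hi hji)

omit [Finite ι] [R.IsReduced] in
theorem IsHighestCoroot.pairingIn_eq_zero_or_one {x : V} (hx : x ∈ weylChamber b) {θ : ι}
    (hθ : IsHighestCoroot b θ) {j : ι} (hj : 0 < R.coroot' j x) (hjθ : j ≠ θ) :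
    R.pairingIn ℤ θ j = 0 ∨ R.pairingIn ℤ θ j = 1 := by
  have hreflection : R.coroot' (R.reflectionPerm θ j) x =
      R.coroot' j x - R.pairingIn ℤ θ j * R.coroot' θ x := by
    rw [← R.coroot'_reflection, R.reflection_apply, map_sub, map_smul, R.root_coroot'_eq_pairing,
      smul_eq_mul, mul_comm, ← R.algebraMap_pairingIn ℤ, eq_intCast]
  have habs := abs_le.1 (hθ.abs_coroot'_le hx (R.reflectionPerm θ j))
  rw [hreflection] at habs
  have hlt := hθ.coroot'_lt hx hjθ
  have hgt : -1 < R.pairingIn ℤ θ j := by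
    by_contra! hle
    have hle' : (R.pairingIn ℤ θ j : ℝ) ≤ -1 := by exact_mod_cast hle
    nlinarith
  have hlt' : R.pairingIn ℤ θ j < 2 := by
    by_contra! hle
    have hle' : (2 : ℝ) ≤ R.pairingIn ℤ θ j := by exact_mod_cast hle
    nlinarith
  lia

theorem inversions_affRefl_highest [R.IsRootSystem] {x : V} (hx : x ∈ alcove b) {θ : ι}
    (hθ : IsHighestCoroot b θ) : inversions x (affRefl (R := R) θ 1) = {affRefl θ 1} := by
  have hxc := mem_weylChamber_of_mem_alcove hx
  have hθx := hx θ hθ.isPos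
  refine inversions_affRefl_eq_singleton hx ?_ fun j hj hjθ => ?_
  · rw [affineCoroot, Int.cast_one, abs_lt]
    constructor <;> linarith
  · have hjx := hx j hj
    have hlt := hθ.coroot'_lt hxc hjθ
    rw [coroot'_affAct_affRefl, affineCoroot, ← R.algebraMap_pairingIn ℤ, eq_intCast]
    rcases hθ.pairingIn_eq_zero_or_one hxc hjx.1 hjθ with h | h <;> rw [h] <;> push_cast <;>
      constructor <;> linarith

omit [Finite ι] in
theorem affRefl_simple_mem_inversions {x : V} (hx : x ∈ alcove b) (g : ExtAffineWeyl R) {i : ι}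
    (hi : i ∈ b.support) : affRefl i 0 ∈ inversions x g ↔ R.coroot' i (affAct g x) < 0 := by
  rw [affRefl_mem_inversions, affineCoroot, affineCoroot, Int.cast_zero, sub_zero, sub_zero]
  rw [← neg_pos, ← mul_neg, mul_pos_iff_of_pos_left (mem_weylChamber_of_mem_alcove hx i hi),
    neg_pos]

theorem affRefl_highest_mem_inversions [R.IsRootSystem] {x : V} (hx : x ∈ alcove b)
    (g : ExtAffineWeyl R) {θ : ι} (hθ : IsHighestCoroot b θ) :
    affRefl θ 1 ∈ inversions x g ↔ 1 < R.coroot' θ (affAct g x) := by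
  rw [affRefl_mem_inversions, affineCoroot, affineCoroot, Int.cast_one, ← sub_pos (b := (1 : ℝ)),
    ← neg_pos, ← neg_mul]
  exact mul_pos_iff_of_pos_left (neg_pos.2 (sub_neg.2 (hx θ hθ.isPos).2))

variable [R.IsRootSystem] [R.IsIrreducible] [Nonempty ι]

theorem exists_simple_mem_inversions {x : V} (hx : x ∈ alcove b) {g : ExtAffineWeyl R}
    (hg : (inversions x g).Nonempty) : ∃ s ∈ simples b, s ∈ inversions x g := by
  obtain ⟨_, i, n, rfl, hneg⟩ := hg
  by_contra! h
  obtain ⟨θ, hθ⟩ := exists_isHighestCoroot b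
  have hreg := (isRegularPoint_of_mem_alcove hx).affAct g
  refine hneg.not_gt (affineCoroot_mul_pos_of_mem_alcove hx ((mem_alcove_iff hθ).2
    ⟨fun j hj => ?_, ?_⟩) i n)
  · have hle := h (affRefl j 0) (Or.inl ⟨j, hj, rfl⟩)
    rw [affRefl_simple_mem_inversions hx g hj, not_lt] at hle
    exact hle.lt_of_ne' (by simpa [affineCoroot] using hreg j 0)
  · have hle := h (affRefl θ 1) (Or.inr ⟨θ, hθ, rfl⟩)
    rw [affRefl_highest_mem_inversions hx g hθ, not_lt] at hle
    exact hle.lt_of_ne (by simpa [affineCoroot, sub_eq_zero] using hreg θ 1)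

theorem isInversionSystem_inversions {x : V} (hx : x ∈ alcove b) :
    IsInversionSystem (simples b) (affReflections R) (inversions x) where
  finite := inversions_finite x
  mul := inversions_mul (isRegularPoint_of_mem_alcove hx)
  simple_subset := by
    rintro _ (⟨i, -, rfl⟩ | ⟨i, -, rfl⟩)
    · exact ⟨i, 0, rfl⟩
    · exact ⟨i, 1, rfl⟩
  sq := by
    rintro _ ⟨i, n, rfl⟩
    exact affRefl_mul_self i n
  conj := by
    rintro _ ⟨i, n, rfl⟩ g
    obtain ⟨j, m, -, h⟩ := exists_conj_affRefl g i n
    exact ⟨j, m, h⟩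
  self_mem := by
    rintro _ ⟨i, n, rfl⟩
    rw [affRefl_mem_inversions_affRefl, sub_self, abs_zero, abs_pos]
    exact isRegularPoint_of_mem_alcove hx i n
  simple := by
    rintro _ (⟨i, hi, rfl⟩ | ⟨i, hi, rfl⟩)
    · exact inversions_affRefl_simple hx hi
    · exact inversions_affRefl_highest hx hi
  exists_simple _ := exists_simple_mem_inversions hx

theorem isLengthFn_length (b : R.Base) :
    IsLengthFn (simples b) (affReflections R) (length b) := by
  obtain ⟨x, hx⟩ := alcove_nonempty b
  rw [funext (length_eq_ncard_inversions hx)]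
  exact (isInversionSystem_inversions hx).isLengthFn

/-- If all simple reflections were descents of `w`, the point `w⁻¹ x` would lie in the chamber
opposite to the fundamental one, yet on the far side of the mirror of `s₀`. -/
theorem exists_not_right_descent (b : R.Base) (w : ExtAffineWeyl R) :
    ∃ s ∈ simples b, ¬ length b (w * s) < length b w := by
  by_contra! h
  obtain ⟨x, hx⟩ := alcove_nonempty b
  obtain ⟨θ, hθ⟩ := exists_isHighestCoroot b
  have hl := isLengthFn_length b
  have hmem : ∀ s ∈ simples b, s ∈ inversions x w⁻¹ := by
    intro s hs
    rw [(isInversionSystem_inversions hx).mem_iff_ncard_mul_lt (hl.simple_subset hs),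
      ← length_eq_ncard_inversions hx, ← length_eq_ncard_inversions hx, ← hl.length_mul_simple hs,
      hl.inv]
    exact h s hs
  have hfar := (affRefl_highest_mem_inversions hx w⁻¹ hθ).1 (hmem _ (Or.inr ⟨θ, hθ, rfl⟩))
  have hchamber : -affAct w⁻¹ x ∈ weylChamber b := by
    intro i hi
    rw [map_neg, neg_pos]
    exact (affRefl_simple_mem_inversions hx w⁻¹ hi).1 (hmem _ (Or.inl ⟨i, hi, rfl⟩))
  have hnear := coroot'_pos_of_isPos hchamber hθ.isPos
  rw [map_neg] at hnear
  linarith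

end Alcove

section Descents

variable {ι V V' : Type*} [AddCommGroup V] [Module ℝ V] [AddCommGroup V'] [Module ℝ V']
  {R : RootPairing ι ℝ V V'}

theorem nonempty_index_of_isIrreducible (R : RootPairing ι ℝ V V') [R.IsRootSystem]
    [R.IsIrreducible] : Nonempty ι := by
  by_contra! h
  have := RootPairing.IsIrreducible.nontrivial R
  have hspan := RootPairing.IsRootSystem.span_root_eq_top (P := R)
  rw [Set.range_eq_empty, Submodule.span_empty] at hspan
  exact bot_ne_top hspan

variable [R.IsCrystallographic]

theorem inr_ofIdx (i : ι) :
    (SemidirectProduct.inr (RootPairing.weylGroup.ofIdx R i) : ExtAffineWeyl R) = affRefl i 0 := by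
  refine SemidirectProduct.ext ?_ rfl
  rw [SemidirectProduct.left_inr, affRefl, zero_smul, ofAdd_zero]

theorem affRefl_zero_mem_finiteWeyl (i : ι) : affRefl i 0 ∈ finiteWeyl R :=
  ⟨_, inr_ofIdx i⟩

theorem affRefl_one_notMem_finiteWeyl (i : ι) : affRefl i 1 ∉ finiteWeyl R := by
  rintro ⟨w, hw⟩
  have hroot := congrArg (fun g : ExtAffineWeyl R => ((g.left.toAdd : weightLattice R) : V)) hw
  simp only [SemidirectProduct.left_inr, toAdd_one, affRefl, one_smul, toAdd_ofAdd,
    ZeroMemClass.coe_zero] at hroot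
  exact R.ne_zero i hroot.symm

theorem affAct_affRefl_zero (i : ι) (x : V) :
    affAct (affRefl (R := R) i 0) x = R.reflection i x := by
  rw [affAct_affRefl, affineCoroot, R.reflection_apply, Int.cast_zero, sub_zero]

theorem affRefl_reflectionPerm (i j : ι) :
    affRefl (R := R) (R.reflectionPerm j i) 0 = affRefl j 0 * affRefl i 0 * affRefl j 0 := by
  refine affAct_injective (funext fun x => ?_)
  simp only [affAct_mul, affAct_affRefl_zero, R.reflection_reflectionPerm, LinearEquiv.mul_apply]

variable (b : R.Base)

theorem affRefl_zero_mem_finiteSimples {i : ι} (hi : i ∈ b.support) :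
    affRefl i 0 ∈ finiteSimples b :=
  ⟨.inl ⟨i, hi, rfl⟩, affRefl_zero_mem_finiteWeyl i⟩

theorem mem_simples_iff (s : ExtAffineWeyl R) :
    s ∈ simples b ↔ s ∈ finiteSimples b ∨ s ∈ affineSimple b := by
  constructor
  · rintro (⟨i, hi, rfl⟩ | hs)
    · exact .inl (affRefl_zero_mem_finiteSimples b hi)
    · exact .inr hs
  · rintro (hs | hs)
    · exact hs.1
    · exact .inr hs

theorem disjoint_finiteSimples_affineSimple :
    Disjoint (finiteSimples b) (affineSimple b) := by
  refine Set.disjoint_left.2 ?_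
  rintro _ hs ⟨i, -, rfl⟩
  exact affRefl_one_notMem_finiteWeyl i hs.2

theorem finiteWeyl_eq_closure [Finite ι] [R.IsReduced] :
    finiteWeyl R = Subgroup.closure (finiteSimples b) := by
  have hrefl (i : ι) : affRefl (R := R) i 0 ∈ Subgroup.closure (finiteSimples b) := by
    refine b.induction_reflect i (p := fun i => affRefl i 0 ∈ Subgroup.closure (finiteSimples b))
      (fun i hi => ?_)
      (fun i hi => Subgroup.subset_closure (affRefl_zero_mem_finiteSimples b hi))
      fun i j hi hj => ?_
    · rw [← neg_zero, affRefl_reflectionPerm_self]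
      exact hi
    · have hj' := Subgroup.subset_closure (affRefl_zero_mem_finiteSimples b hj)
      rw [affRefl_reflectionPerm]
      exact mul_mem (mul_mem hj' hi) hj'
  refine le_antisymm ?_ ((Subgroup.closure_le _).2 Set.inter_subset_right)
  rintro _ ⟨⟨w, hw⟩, rfl⟩
  induction hw using RootPairing.weylGroup.induction with
  | mem i =>
    have hi := hrefl i
    rw [← inr_ofIdx] at hi
    exact hi
  | one => exact one_mem _
  | mul _ _ _ _ ihg ihh =>
    have hmul := mul_mem ihg ihh
    rw [← map_mul] at hmul
    exact hmul

theorem isLongest_inr [Finite ι] [R.IsReduced] {w₀ : R.weylGroup}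
    (hw₀ : ∀ u : R.weylGroup,
      length b (SemidirectProduct.inr u) ≤ length b (SemidirectProduct.inr w₀)) :
    IsLongest (length b) (finiteSimples b) (SemidirectProduct.inr w₀) where
  mem_closure := finiteWeyl_eq_closure b ▸ ⟨w₀, rfl⟩
  length_le := by
    rw [← finiteWeyl_eq_closure]
    rintro _ ⟨u, rfl⟩
    exact hw₀ u

theorem bruhatLE_eq_abstractBruhatLE :
    BruhatLE b = AbstractBruhatLE (affReflections R) (length b) := by
  unfold BruhatLE AbstractBruhatLE
  congr! 7 with x z
  exact ⟨fun ⟨i, n, hz⟩ => ⟨_, ⟨i, n, rfl⟩, hz⟩, fun ⟨_, ⟨i, n, rfl⟩, hz⟩ => ⟨i, n, hz⟩⟩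

variable [Finite ι] [R.IsReduced] [R.IsRootSystem] [R.IsIrreducible] [Nonempty ι]

theorem mem_rightDescents_iff (w s : ExtAffineWeyl R) :
    s ∈ rightDescents b w ↔ s ∈ simples b ∧ length b (w * s) < length b w := by
  have hl := isLengthFn_length b
  rw [rightDescents, bruhatLE_eq_abstractBruhatLE, Set.mem_ofPred_eq]
  refine and_congr_right fun hs => ⟨fun hle => ?_, fun hlt => ?_⟩
  · refine hle.eq_or_length_lt.resolve_left fun heq => ?_
    have := hl.mul_simple hs w
    rw [heq] at this
    lia
  · exact .single ⟨hlt, s, hl.simple_subset hs, (hl.mul_simple_cancel hs w).symm⟩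

theorem compl_Y₀_eq :
    (Y₀ b)ᶜ = {w | ∃ s ∈ finiteSimples b, length b (w * s) < length b w} := by
  ext w
  rw [Set.mem_compl_iff, Y₀, Set.mem_ofPred_eq, Set.mem_ofPred_eq, Set.not_subset]
  constructor
  · rintro ⟨s, hs, hs'⟩
    rw [mem_rightDescents_iff, mem_simples_iff] at hs
    exact ⟨s, hs.1.resolve_right hs', hs.2⟩
  · rintro ⟨s, hs, hlt⟩
    exact ⟨s, (mem_rightDescents_iff b w s).2 ⟨hs.1, hlt⟩,
      Set.disjoint_left.1 (disjoint_finiteSimples_affineSimple b) hs⟩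

/-- Some simple reflection is not a right descent of `w`, so that `s₀` is not one as soon as all
the finite simple reflections are. -/
theorem Γ₀_eq : Γ₀ b = {w | ∀ s ∈ finiteSimples b, length b (w * s) < length b w} := by
  ext w
  rw [Γ₀, Set.mem_ofPred_eq, Set.mem_ofPred_eq]
  refine ⟨fun hw s hs => ((mem_rightDescents_iff b w s).1 (hw ▸ hs)).2, fun hw => ?_⟩
  refine subset_antisymm (fun s hs => ?_) fun s hs =>
    (mem_rightDescents_iff b w s).2 ⟨hs.1, hw s hs⟩
  rw [mem_rightDescents_iff, mem_simples_iff] at hs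
  refine hs.1.resolve_right fun ⟨θ, hθ, hsθ⟩ => ?_
  obtain ⟨t, ht, hlt⟩ := exists_not_right_descent b w
  rcases (mem_simples_iff b t).1 ht with ht | ⟨θ', hθ', rfl⟩
  · exact hlt (hw t ht)
  · rw [hθ'.unique hθ, ← hsθ] at hlt
    exact hlt hs.2

end Descents

section KazhdanLusztig

variable {ι V V' : Type*} [AddCommGroup V] [Module ℝ V] [AddCommGroup V'] [Module ℝ V']
  {R : RootPairing ι ℝ V V'} [R.IsCrystallographic] (b : R.Base)

theorem isKL_iff_isAbstractKL (w : ExtAffineWeyl R) (p : ExtAffineWeyl R →₀ ℤ[X]) :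
    IsKL b w p ↔ IsAbstractKL (affReflections R) (length b) (T b genericParam) w p := by
  constructor
  · rintro ⟨hle, hself, hdeg, hbar⟩
    rw [bruhatLE_eq_abstractBruhatLE] at hle hdeg
    refine ⟨hle, hself, hdeg, ?_⟩
    rw [mem_barInvariants_iff, evalSum_eq_sum, evalSum_eq_sum]
    exact hbar
  · rintro ⟨hle, hself, hdeg, hbar⟩
    rw [← bruhatLE_eq_abstractBruhatLE] at hle hdeg
    rw [mem_barInvariants_iff, evalSum_eq_sum, evalSum_eq_sum] at hbar
    exact ⟨hle, hself, hdeg, hbar⟩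

variable [Finite ι] [R.IsReduced] [R.IsRootSystem] [R.IsIrreducible] [Nonempty ι]

theorem isAbstractKL_klPoly (w : ExtAffineWeyl R) :
    IsAbstractKL (affReflections R) (length b) (T b genericParam) w (klPoly b w) := by
  have hl := isLengthFn_length b
  obtain ⟨p, hp, -⟩ := exists_isAbstractKL (isHeckeBasis_T _ hl) hl w
  have hex : ∃ p, IsKL b w p := ⟨p, (isKL_iff_isAbstractKL b w p).2 hp⟩
  rw [← isKL_iff_isAbstractKL, klPoly, dif_pos hex]
  exact hex.choose_spec

theorem klPoly_mul_simple {w s : ExtAffineWeyl R} (hs : s ∈ simples b)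
    (hw : length b (w * s) < length b w) (y : ExtAffineWeyl R) :
    klPoly b w (y * s) = klPoly b w y := by
  have hl := isLengthFn_length b
  have hτ := isHeckeBasis_T (b := b) genericParam hl
  obtain ⟨p, hp, hsymm⟩ := exists_isAbstractKL hτ hl w
  rw [IsAbstractKL.unique hτ hl (isAbstractKL_klPoly b w) hp]
  exact hsymm s hs hw y

theorem eq_or_lt_of_klPoly_ne_zero {w y : ExtAffineWeyl R} (hy : klPoly b w y ≠ 0) :
    y = w ∨ length b y < length b w :=
  ((isAbstractKL_klPoly b w).le_of_ne_zero y hy).eq_or_length_lt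

theorem repr_finsuppSum_smul {k W M A : Type*} [Semiring k] [AddCommMonoid M] [Module k M]
    [Zero A] (B : Module.Basis W k M) (p : W →₀ A) {c : W → A → k} (hc : ∀ y, c y 0 = 0) (y : W) :
    B.repr (p.sum fun y f => c y f • B y) y = c y (p y) := by
  classical
  simp only [Finsupp.sum, map_sum, map_smul, Module.Basis.repr_self, Finsupp.finsetSum_apply,
    Finsupp.smul_apply, Finsupp.single_apply, smul_eq_mul, mul_ite, mul_one, mul_zero,
    Finset.sum_ite_eq', Finsupp.mem_support_iff]
  exact ite_eq_left_iff.2 fun hy => by rw [not_not.1 hy, hc]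

variable {k : Type*} [Field k] (q v : k)

/-- The standard basis of the Hecke algebra of the extended affine Weyl group. -/
abbrev standardBasis : Module.Basis (ExtAffineWeyl R) k (Hecke b q) :=
  (isHeckeBasis_T q (isLengthFn_length b)).basis

theorem repr_C (w y : ExtAffineWeyl R) : (standardBasis b q).repr (C b q v w) y =
    v⁻¹ ^ length b w * Polynomial.aeval q (klPoly b w y) := by
  have hsum := repr_finsuppSum_smul (standardBasis b q) (klPoly b w)
    (c := fun _ f => Polynomial.aeval q f) (fun _ => map_zero _) y
  simp only [IsHeckeBasis.basis_apply] at hsum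
  rw [C, map_smul, Finsupp.smul_apply, smul_eq_mul, hsum]

theorem repr_C' (w y : ExtAffineWeyl R) : (standardBasis b q).repr (C' b q v w) y =
    v ^ length b w * ((-1) ^ (length b w - length b y) * q⁻¹ ^ length b y *
      Polynomial.aeval q⁻¹ (klPoly b w y)) := by
  have hsum := repr_finsuppSum_smul (standardBasis b q) (klPoly b w)
    (c := fun y f => (-1) ^ (length b w - length b y) * q⁻¹ ^ length b y * Polynomial.aeval q⁻¹ f)
    (fun _ => by rw [map_zero, mul_zero]) y
  simp only [IsHeckeBasis.basis_apply] at hsum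
  rw [C', map_smul, Finsupp.smul_apply, smul_eq_mul, hsum]

variable {q v}

theorem isSymmetricFamily_C (hv : v ≠ 0) :
    IsSymmetricFamily (isHeckeBasis_T q (isLengthFn_length b)) 1 (C b q v) where
  self_ne_zero w := by
    rw [repr_C, (isAbstractKL_klPoly b w).self, map_one, mul_one]
    exact pow_ne_zero _ (inv_ne_zero hv)
  eq_or_lt w y hy := by
    rw [repr_C] at hy
    exact eq_or_lt_of_klPoly_ne_zero b fun hzero => hy (by rw [hzero, map_zero, mul_zero])
  mul_simple w s hs hw y _ := by
    rw [repr_C, repr_C, one_mul, klPoly_mul_simple b hs hw]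

theorem isSymmetricFamily_C' (hq : q ≠ 0) (hv : v ≠ 0) :
    IsSymmetricFamily (isHeckeBasis_T q (isLengthFn_length b)) (-q⁻¹) (C' b q v) where
  self_ne_zero w := by
    rw [repr_C', (isAbstractKL_klPoly b w).self, map_one, mul_one, Nat.sub_self, pow_zero, one_mul]
    exact mul_ne_zero (pow_ne_zero _ hv) (pow_ne_zero _ (inv_ne_zero hq))
  eq_or_lt w y hy := by
    rw [repr_C'] at hy
    exact eq_or_lt_of_klPoly_ne_zero b fun hzero => hy (by rw [hzero, map_zero, mul_zero, mul_zero])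
  mul_simple w s hs hw y hy := by
    have hsymm := klPoly_mul_simple b hs hw y
    rw [repr_C', repr_C', hsymm]
    obtain hzero | hne := eq_or_ne (klPoly b w y) 0
    · simp only [hzero, map_zero, mul_zero]
    have hlen := (isLengthFn_length b).mul_simple_of_lt hs hy
    have hle : length b y + 1 ≤ length b w := by
      rcases eq_or_lt_of_klPoly_ne_zero b (hsymm.trans_ne hne) with heq | hlt
      · rw [← heq, hlen]
      · exact hlen ▸ hlt.le
    obtain ⟨d, hd⟩ := Nat.exists_eq_add_of_le hle
    rw [show length b w - length b (y * s) = d by lia,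
      show length b w - length b y = d + 1 by lia, hlen, pow_succ, pow_succ]
    ring

end KazhdanLusztig

end AffineHecke

end

theorem lemma2p2
    {ι V V' k : Type*} [Finite ι] [AddCommGroup V] [Module ℝ V] [AddCommGroup V'] [Module ℝ V']
    (R : RootPairing ι ℝ V V') [R.IsRootSystem] [R.IsCrystallographic] [R.IsReduced]
    [R.IsIrreducible] (b : R.Base)
    [Field k] (q v : k) (hq : q ≠ 0) (hv : v ^ 2 = q)
    (w₀ : R.weylGroup)
    (hw₀ : ∀ u : R.weylGroup, AffineHecke.length b (SemidirectProduct.inr u) ≤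
      AffineHecke.length b (SemidirectProduct.inr w₀)) :
    ∃ I I' M M' : Submodule (AffineHecke.Hecke b q) (AffineHecke.Hecke b q),
      I.restrictScalars k =
        Submodule.span k (AffineHecke.C b q v '' (AffineHecke.Y₀ b)ᶜ) ∧
      I'.restrictScalars k =
        Submodule.span k (AffineHecke.C' b q v '' (AffineHecke.Y₀ b)ᶜ) ∧
      M.restrictScalars k =
        Submodule.span k (AffineHecke.C b q v '' AffineHecke.Γ₀ b) ∧
      M'.restrictScalars k =
        Submodule.span k (AffineHecke.C' b q v '' AffineHecke.Γ₀ b) ∧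
      M = Submodule.span (AffineHecke.Hecke b q)
        {AffineHecke.C b q v (SemidirectProduct.inr w₀)} ∧
      M' = Submodule.span (AffineHecke.Hecke b q)
        {AffineHecke.C' b q v (SemidirectProduct.inr w₀)} ∧
      (∃ e : (AffineHecke.Hecke b q ⧸ I) ≃ₗ[AffineHecke.Hecke b q] M',
        ∀ h : AffineHecke.Hecke b q,
          (e (Submodule.Quotient.mk h) : AffineHecke.Hecke b q) =
            h * AffineHecke.C' b q v (SemidirectProduct.inr w₀)) ∧
      (∃ e : (AffineHecke.Hecke b q ⧸ I') ≃ₗ[AffineHecke.Hecke b q] M,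
        ∀ h : AffineHecke.Hecke b q,
          (e (Submodule.Quotient.mk h) : AffineHecke.Hecke b q) =
            h * AffineHecke.C b q v (SemidirectProduct.inr w₀)) := by
  open AffineHecke in
  have := nonempty_index_of_isIrreducible R
  have hv₀ : v ≠ 0 := by
    rintro rfl
    exact hq (by rw [← hv, zero_pow two_ne_zero])
  have hl := isLengthFn_length b
  have hC := isSymmetricFamily_C b (q := q) hv₀
  have hC' := isSymmetricFamily_C' b hq hv₀
  have hw := isLongest_inr b hw₀
  have hr : (q * 1 + 1) * ((1 : k) - 1) = 0 := by rw [sub_self, mul_zero]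
  have hr' : (q * -q⁻¹ + 1) * (-q⁻¹ - 1) = 0 := by
    rw [mul_neg, mul_inv_cancel₀ hq, neg_add_cancel, zero_mul]
  have hS₀ : finiteSimples b ⊆ simples b := Set.inter_subset_left
  obtain ⟨I, M', hI, hM', hM'C', he⟩ :=
    exists_ideals hl hC' hr hr' (by field_simp) hS₀ hw hC
  obtain ⟨I', M, hI', hM, hMC, he'⟩ :=
    exists_ideals hl hC hr' hr (by field_simp) hS₀ hw hC'
  rw [compl_Y₀_eq, Γ₀_eq]
  exact ⟨I, I', M, M', hI, hI', hM, hM', hMC, hM'C', he, he'⟩
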